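/- **Setting.** Let $d\ge 0$, $k\ge1$, $N\ge0$ be integers, $T,\varepsilon_0>0$, $D\subset\mathbb R^d$ open. Let $\theta_0\equiv 0$, $\theta_{N+1}\equiv T$ and let $\theta_1,\dots,\theta_N:D\to\mathbb R$ be functions of class $C^{k-1}$ with $0=\theta_0(x)<\theta_1(x)<\dots<\theta_N(x)<\theta_{N+1}(x)=T$ for all $x\in D$. For $1\le i\le k$, $0\le j\le N$ let $F_i^j:\mathbb R\times D\to\mathbb R^d$ and $R^j:\mathbb R\times D\times(-\varepsilon_0,\varepsilon_0)\to\mathbb R^d$ be of class $C^k$ and $T$-periodic in $t$. Consider the $T$-periodic nonsmooth system $$\dot x=\sum_{i=1}^k\varepsilon^iF_i(t,x)+\varepsilon^{k+1}R(t,x,\varepsilon),\qquad (1)$$ where $F_i=F_i^j$ and $R=R^j$ for $\theta_j(x)<t<\theta_{j+1}(x)$, $t$ being taken modulo $T$. Solutions are understood in the sense of Filippov: $x:\mathbb R\to D$ is locally absolutely continuous and, for almost every $t$, $\dot x(t)$ lies in the convex hull of the values at $(t,x(t),\varepsilon)$ of the fields $F^j=\sum_{i=1}^k\varepsilon^iF^j_i+\varepsilon^{k+1}R^j$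 over all zones $j$ whose closure contains $(t\bmod T,x(t))$. **Melnikov functions.** Let $S_l$ be the set of $b=(b_1,\dots,b_l)\in\mathbb Z_{\ge0}^l$ with $b_1+2b_2+\dots+lb_l=l$, put $L_b=b_1+\dots+b_l$ and $c_b=\big(b_1!\,b_2!\,2!^{b_2}\cdots b_l!\,l!^{b_l}\big)^{-1}$, and let $S_{q,l}$ be the set of $l$-tuples of positive integers with sum $q$. For $1\le i\le k$, $0\le j\le N$ define recursively $$K_i^j(s,x)=F_i^j(s,x)+\sum_{l=1}^{i-1}\sum_{b\in S_l}c_b\,\partial_x^{L_b}F_{i-l}^j(s,x)\prod_{m=1}^l\big(z_m^j(s,x)\big)^{b_m},\qquad z_i^0(t,x)=i!\int_0^tK_i^0(s,x)\,ds,$$ and, for $j\ge1$, $$z_i^j(t,x)=z_i^{j-1}(\theta_j(x),x)+i!\int_{\theta_j(x)}^tK_i^j(s,x)\,ds+i!\sum_{p=1}^{i-1}\frac1{p!}\,\frac{\partial^p}{\partial\varepsilon^p}\Big(\delta_{i-p}^j\big(A_j^p(x,\varepsilon),x\big)\Big)\Big|_{\varepsilon=0},$$ where $\delta_i^j=\frac1{i!}(z_i^{j-1}-z_i^j)$,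 $A_j^p(x,\varepsilon)=\sum_{q=0}^p\frac{\varepsilon^q}{q!}\alpha_j^q(x)$, $\alpha_j^0=\theta_j$, and, for $q\ge1$, $$\alpha_j^q(x)=\sum_{l=1}^q\frac{q!}{l!}\sum_{u\in S_{q,l}}D^l\theta_j(x)\big(w_{u_1}^j(x),\dots,w_{u_l}^j(x)\big),$$ $$w_i^j(x)=\frac1{i!}z_i^{j-1}(\theta_j(x),x)+\sum_{a=1}^{i-1}\sum_{b\in S_a}\frac{c_b}{(i-a)!}\,\partial_t^{L_b}z_{i-a}^{j-1}(\theta_j(x),x)\prod_{m=1}^a\big(\alpha_j^m(x)\big)^{b_m}.$$ (Powers and products of vectors mean that a derivative, as a multilinear map, is applied to these vectors with these multiplicities.) The Melnikov function of order $i$ is $M_i(x)=\frac1{i!}z_i^N(T,x)$. **Theorem.** Let $\ell\in\{1,\dots,k\}$ and suppose that $M_1,\dots,M_{\ell-1}$ vanish identically on $D$. Let $a^*\in D$ satisfy $M_\ell(a^*)=0$ and $\det DM_\ell(a^*)\ne0$. If $\ell=k$, suppose in addition that $\theta_1,\dots,\theta_N$ are of class $C^k$ near $a^*$. Then, for $|\varepsilon|\neq0$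 sufficiently small, system (1) has a $T$-periodic solution $x(\cdot,\varepsilon)$ with $x(0,\varepsilon)\to a^*$ as $\varepsilon\to0$, and it is unique: there is a neighbourhood $U$ of $a^*$ such that, for $|\varepsilon|\ne0$ sufficiently small, every $T$-periodic solution with initial value (at $t=0$) in $U$ is equal to $x(\cdot,\varepsilon)$. -/

import Mathlib

open Set Filter Topology MeasureTheory
open scoped Nat

noncomputable section

/-- Course-of-values recursion: `strongSeq step n` is computed by `step n` from the values of the
sequence at the indices smaller than `n` (the other entries are replaced by `0`). -/
def strongSeq {β : Type*} [Zero β] (step : ℕ → (ℕ → β) → β) (n : ℕ) : β :=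
  step n (fun m => if _h : m < n then strongSeq step m else 0)
termination_by n

/-- `S_l`: the `l`-tuples `(b_1, …, b_l)` of non-negative integers with
`b_1 + 2 b_2 + ⋯ + l b_l = l` (the entry `b_{m+1}` is `b m`, `m : Fin l`). -/
def faaTuples (l : ℕ) : Finset (Fin l → ℕ) :=
  (Fintype.piFinset fun _ => Finset.range (l + 1)).filter
    fun b => ∑ m : Fin l, ((m : ℕ) + 1) * b m = l

/-- `S_{q,l}`: the `l`-tuples of positive integers with sum `q`. -/
def posTuples (q l : ℕ) : Finset (Fin l → ℕ) :=
  (Fintype.piFinset fun _ => Finset.Icc 1 q).filter fun u => ∑ r, u r = q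

/-- The coefficient `1 / (b_1! b_2! 2!^{b_2} ⋯ b_l! l!^{b_l})`. -/
def faaCoeff {l : ℕ} (b : Fin l → ℕ) : ℝ :=
  1 / ∏ m : Fin l, ((b m)! * (((m : ℕ) + 1)! : ℝ) ^ b m)

/-- `D^{L}g(x) ∏_{m=1}^l (v_m)^{b_m}` with `L = b_1 + ⋯ + b_l`: the `L`-th derivative of `g` at `x`
applied to the list of vectors in which each `v_m` is repeated `b_m` times. -/
def faaDeriv {E G : Type*} [NormedAddCommGroup E] [NormedSpace ℝ E]
    [NormedAddCommGroup G] [NormedSpace ℝ G]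
    {l : ℕ} (b : Fin l → ℕ) (g : E → G) (x : E) (v : ℕ → E) : G :=
  iteratedFDeriv ℝ (∑ m, b m) g x
    (fun r => v (((finSigmaFinEquiv (n := b)).symm r).1 + 1))

/-- The data of a `T`-periodic system
`x' = ∑_{i=1}^k ε^i F_i(t,x) + ε^{k+1} R(t,x,ε)` on `D ⊆ ℝ^d`, whose right-hand side is given by
`F_i^j = F i j` and `R^j = R j` for `θ_j(x) < t < θ_{j+1}(x)`, `j = 0, …, N`. -/
structure SwitchedSystem (d : ℕ) where
  /-- period -/
  T : ℝ
  /-- bound for the parameter -/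
  ε₀ : ℝ
  /-- order of the expansion -/
  k : ℕ
  /-- number of switching times -/
  N : ℕ
  /-- domain of the state -/
  D : Set (EuclideanSpace ℝ (Fin d))
  /-- switching times, `θ 0 = 0` and `θ (N + 1) = T` -/
  θ : ℕ → EuclideanSpace ℝ (Fin d) → ℝ
  /-- `F i j t x = F_i^j(t,x)` -/
  F : ℕ → ℕ → ℝ → EuclideanSpace ℝ (Fin d) → EuclideanSpace ℝ (Fin d)
  /-- `R j t x ε = R^j(t,x,ε)` -/
  R : ℕ → ℝ → EuclideanSpace ℝ (Fin d) → ℝ → EuclideanSpace ℝ (Fin d)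

namespace SwitchedSystem

variable {d : ℕ}

/-- The standing assumptions on the data. -/
structure IsAdmissible (S : SwitchedSystem d) : Prop where
  T_pos : 0 < S.T
  ε₀_pos : 0 < S.ε₀
  k_pos : 1 ≤ S.k
  isOpen_D : IsOpen S.D
  θ_zero : ∀ x ∈ S.D, S.θ 0 x = 0
  θ_last : ∀ x ∈ S.D, S.θ (S.N + 1) x = S.T
  θ_lt : ∀ j ≤ S.N, ∀ x ∈ S.D, S.θ j x < S.θ (j + 1) x
  θ_contDiff : ∀ j, 1 ≤ j → j ≤ S.N → ContDiffOn ℝ (S.k - 1 : ℕ) (S.θ j) S.D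
  F_contDiff : ∀ i, 1 ≤ i → i ≤ S.k → ∀ j ≤ S.N,
    ContDiffOn ℝ S.k (fun p : ℝ × EuclideanSpace ℝ (Fin d) => S.F i j p.1 p.2) (univ ×ˢ S.D)
  R_contDiff : ∀ j ≤ S.N,
    ContDiffOn ℝ S.k (fun p : ℝ × EuclideanSpace ℝ (Fin d) × ℝ => S.R j p.1 p.2.1 p.2.2)
      (univ ×ˢ S.D ×ˢ Ioo (-S.ε₀) S.ε₀)
  F_periodic : ∀ i, 1 ≤ i → i ≤ S.k → ∀ j ≤ S.N, ∀ t, ∀ x ∈ S.D, S.F i j (t + S.T) x = S.F i j t x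
  R_periodic : ∀ j ≤ S.N, ∀ t, ∀ x ∈ S.D, ∀ ε ∈ Ioo (-S.ε₀) S.ε₀,
    S.R j (t + S.T) x ε = S.R j t x ε

/-- `F^j(t,x,ε) = ∑_{i=1}^k ε^i F_i^j(t,x) + ε^{k+1} R^j(t,x,ε)`. -/
def field (S : SwitchedSystem d) (j : ℕ) (ε t : ℝ) (x : EuclideanSpace ℝ (Fin d)) :
    EuclideanSpace ℝ (Fin d) :=
  ∑ i ∈ Finset.Icc 1 S.k, ε ^ i • S.F i j t x + ε ^ (S.k + 1) • S.R j t x ε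

/-- Filippov's set-valued right-hand side: the convex hull of the values `F^j(t,x,ε)` over the zones
whose closure contains `(t mod T, x)`. Off the switching manifold it is the single value of the
right-hand side. -/
def filippovSet (S : SwitchedSystem d) (ε t : ℝ) (x : EuclideanSpace ℝ (Fin d)) :
    Set (EuclideanSpace ℝ (Fin d)) :=
  convexHull ℝ {v | ∃ j ≤ S.N, ∃ n : ℤ,
    S.θ j x ≤ t - n * S.T ∧ t - n * S.T ≤ S.θ (j + 1) x ∧ v = S.field j ε t x}

/-- Solutions on the whole line, with values in `D`: locally absolutely continuous functions (that
is, indefinite integrals) whose derivative lies in the Filippov set for almost every time. -/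
def IsSolution (S : SwitchedSystem d) (ε : ℝ) (x : ℝ → EuclideanSpace ℝ (Fin d)) : Prop :=
  (∀ t, x t ∈ S.D) ∧
  ∃ v : ℝ → EuclideanSpace ℝ (Fin d), LocallyIntegrable v volume ∧
    (∀ t, x t = x 0 + ∫ s in (0 : ℝ)..t, v s) ∧
    ∀ᵐ t, v t ∈ S.filippovSet ε t (x t)

/-- `T`-periodic solutions. -/
def IsPeriodicSolution (S : SwitchedSystem d) (ε : ℝ) (x : ℝ → EuclideanSpace ℝ (Fin d)) : Prop :=
  S.IsSolution ε x ∧ Function.Periodic x S.T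

/-- The integrand of the recursion: `F_i^j(s,x)` plus
`∑_{l=1}^{i-1} ∑_{b ∈ S_l} (1 / (b_1! b_2! 2!^{b_2} ⋯)) ∂_x^{L_b} F_{i-l}^j(s,x) ∏_m (z_m(s,x))^{b_m}`,
where `z` stands for `z^j`. -/
def integrand (S : SwitchedSystem d) (j i : ℕ)
    (z : ℕ → ℝ → EuclideanSpace ℝ (Fin d) → EuclideanSpace ℝ (Fin d))
    (s : ℝ) (x : EuclideanSpace ℝ (Fin d)) : EuclideanSpace ℝ (Fin d) :=
  S.F i j s x + ∑ l ∈ Finset.Icc 1 (i - 1), ∑ b ∈ faaTuples l,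
    faaCoeff b • faaDeriv b (S.F (i - l) j s) x (fun m => z m s x)

/-- `α_j^q(x)` in terms of the sequence `w = w^j(x)`, with `α_j^0(x) = θ_j(x)`. -/
def alphaOf (S : SwitchedSystem d) (j : ℕ) (x : EuclideanSpace ℝ (Fin d))
    (w : ℕ → EuclideanSpace ℝ (Fin d)) (q : ℕ) : ℝ :=
  if q = 0 then S.θ j x else
    ∑ l ∈ Finset.Icc 1 q, ((q ! : ℝ) / (l ! : ℝ)) * ∑ u ∈ posTuples q l,
      iteratedFDeriv ℝ l (S.θ j) x (fun r => w (u r))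

/-- The sequence `i ↦ w_i^j(x)`, where `zp` stands for `z^{j-1}`. -/
def wSeq (S : SwitchedSystem d) (j : ℕ)
    (zp : ℕ → ℝ → EuclideanSpace ℝ (Fin d) → EuclideanSpace ℝ (Fin d))
    (x : EuclideanSpace ℝ (Fin d)) : ℕ → EuclideanSpace ℝ (Fin d) :=
  strongSeq fun i w =>
    (1 / (i ! : ℝ)) • zp i (S.θ j x) x +
    ∑ a ∈ Finset.Icc 1 (i - 1), ∑ b ∈ faaTuples a,
      ((1 / ((i - a)! : ℝ)) * faaCoeff b * ∏ m : Fin a, S.alphaOf j x w ((m : ℕ) + 1) ^ b m) •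
        iteratedDeriv (∑ m, b m) (fun t => zp (i - a) t x) (S.θ j x)

/-- `A_j^p(x,ε) = ∑_{q=0}^p (ε^q / q!) α_j^q(x)`, where `zp` stands for `z^{j-1}`. -/
def crossingJet (S : SwitchedSystem d) (j p : ℕ)
    (zp : ℕ → ℝ → EuclideanSpace ℝ (Fin d) → EuclideanSpace ℝ (Fin d))
    (x : EuclideanSpace ℝ (Fin d)) (ε : ℝ) : ℝ :=
  ∑ q ∈ Finset.range (p + 1), ε ^ q / (q ! : ℝ) * S.alphaOf j x (S.wSeq j zp x) q

/-- The functions `z_i^j(t,x) = S.z j i t x`. In the correction term,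
`δ_{i-p}^j(t,x) = (z_{i-p}^{j-1}(t,x) - z_{i-p}^j(t,x)) / (i-p)!`. -/
def z (S : SwitchedSystem d) :
    ℕ → ℕ → ℝ → EuclideanSpace ℝ (Fin d) → EuclideanSpace ℝ (Fin d)
  | 0 => strongSeq fun i z t x =>
      (i ! : ℝ) • ∫ s in (0 : ℝ)..t, S.integrand 0 i z s x
  | j + 1 => strongSeq fun i z t x =>
      S.z j i (S.θ (j + 1) x) x +
      (i ! : ℝ) • (∫ s in (S.θ (j + 1) x)..t, S.integrand (j + 1) i z s x) +
      (i ! : ℝ) • ∑ p ∈ Finset.Icc 1 (i - 1), (1 / (p ! : ℝ)) •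
        iteratedDeriv p (fun ε : ℝ =>
          (1 / ((i - p)! : ℝ)) •
            (S.z j (i - p) (S.crossingJet (j + 1) p (S.z j) x ε) x -
              z (i - p) (S.crossingJet (j + 1) p (S.z j) x ε) x)) 0

/-- The Melnikov function of order `i`, `M_i(x) = z_i^N(T,x) / i!`. -/
def melnikov (S : SwitchedSystem d) (i : ℕ) (x : EuclideanSpace ℝ (Fin d)) :
    EuclideanSpace ℝ (Fin d) :=
  (1 / (i ! : ℝ)) • S.z S.N i S.T x

end SwitchedSystem

end

/-!
The proof treats the system as a smooth one, piece by piece. Near `a` the fields `F^j / ε` are cut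
off to globally defined `C^ℓ` functions `G_j`. The flow of `x' = ε G_j` exists on any given time
interval for small `ε` and, being a fixed point of a uniform contraction on a space of continuous
functions, depends `C^ℓ`-smoothly on all its arguments, also on the initial time
(`exists_contDiff_flow`). The crossing
times `τ_j(x,ε)` come from the implicit function theorem, which applies because at `ε = 0` the
curves are constant and the surfaces `t = θ_j(x)` are transversal to them. This gives orbits
consisting of pieces `x + ε ψ_j(t,x,ε)` with `C^ℓ` functions `ψ_j` and `τ_j`
(`SwitchedSystem.IsLocalization.exists_isOrbit`). Only `ℓ` derivatives of the `θ_j` near `a` are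
needed for this.

The recursion that defines `z_i^j` is the comparison of the coefficients of `ε^i` in the integral
equations of the pieces, in the equation `τ_j = θ_j(y(τ_j))`, and in the condition that consecutive
pieces meet at the crossing time: all derivatives of compositions are expanded by the formula of
Faà di Bruno (`HasJet.comp_contDiffAt`, `sum_posTuples_iteratedFDeriv`), and the correction term in
`z_i^j` is what is left of the expansion at `τ_j(x,ε)` of the difference of two consecutive pieces.
Hence `z_i^j(t,x) / i!` is the coefficient of `ε^i` in the `j`-th piece
(`SwitchedSystem.IsPiecewiseFlow.z_eq`), and the displacement after one period is
`ε M_1(x) + ⋯ + ε^ℓ M_ℓ(x) + o(ε^ℓ)`. As `M_1, …, M_{ℓ-1}` vanish, Taylor's formula in `ε` writes it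
as `ε^ℓ h(x,ε)` with `h` of class `C^1` and `h(·,0) = M_ℓ` near `a`
(`SwitchedSystem.IsLocalization.exists_displacement_eq`). The implicit function theorem yields a
unique branch of zeros of `h(·,ε)`.

It remains to compare these orbits with Filippov solutions. A Filippov solution that starts near `a`
moves with speed `O(ε)`, so it stays near `a` during one period and `t - θ_j` increases strictly
along it. Therefore it crosses every switching surface exactly once, there is no sliding, and it
follows the pieces of the orbit by uniqueness of solutions of smooth equations
(`SwitchedSystem.IsOrbit.eq_of_isSolution`). Conversely, an orbit with vanishing displacement is
repeated periodically to give a periodic Filippov solution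
(`SwitchedSystem.IsOrbit.exists_isPeriodicSolution`).
-/

universe u

/-! ### Composition operators on spaces of continuous functions -/

/-- A `C^1` map is differentiable along a continuous curve (with compact domain) uniformly. -/
theorem hasFDerivAt_comp_continuousMap {K E F : Type*} [TopologicalSpace K] [CompactSpace K]
    [NormedAddCommGroup E] [NormedSpace ℝ E] [NormedAddCommGroup F] [NormedSpace ℝ F]
    {f : E → F} (hf : ContDiff ℝ 1 f) (g : C(K, E)) (L : C(K, E) →L[ℝ] C(K, F))
    (hL : ∀ h r, L h r = fderiv ℝ f (g r) (h r)) :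
    HasFDerivAt (fun g : C(K, E) => (⟨f, hf.continuous⟩ : C(E, F)).comp g) L g := by
  rw [hasFDerivAt_iff_isLittleO_nhds_zero, Asymptotics.isLittleO_iff]
  intro c hc
  have hK : IsCompact (range g) := isCompact_range g.continuous
  have key : ∀ᶠ h : E in 𝓝 0, ∀ y ∈ range g,
      ‖f (y + h) - f y - fderiv ℝ f y h‖ ≤ c * ‖h‖ := by
    refine hK.eventually_forall_of_forall_eventually fun y _ => ?_
    have h1 := (hf.hasStrictFDerivAt (x := y) one_ne_zero).isLittleO
    rw [Asymptotics.isLittleO_iff] at h1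
    have h2 : Tendsto (fun z : E × E => (z.2 + z.1, z.2)) (𝓝 (0, y)) (𝓝 (y, y)) := by
      have : Continuous fun z : E × E => (z.2 + z.1, z.2) := by fun_prop
      simpa using this.tendsto (0, y)
    have h3 : ∀ᶠ z : E × E in 𝓝 (0, y), ‖fderiv ℝ f z.2 - fderiv ℝ f y‖ < c / 2 := by
      have : Continuous fun z : E × E => ‖fderiv ℝ f z.2 - fderiv ℝ f y‖ := by
        have := hf.continuous_fderiv one_ne_zero
        fun_prop
      exact this.tendsto (0, y) |>.eventually_lt_const (by simpa using half_pos hc)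
    filter_upwards [h2.eventually (h1 (half_pos hc)), h3] with z hz hz'
    simp only [add_sub_cancel_left] at hz
    calc ‖f (z.2 + z.1) - f z.2 - fderiv ℝ f z.2 z.1‖
        = ‖(f (z.2 + z.1) - f z.2 - fderiv ℝ f y z.1)
            - (fderiv ℝ f z.2 - fderiv ℝ f y) z.1‖ := by
          congr 1; simp
      _ ≤ c / 2 * ‖z.1‖ + c / 2 * ‖z.1‖ :=
          (norm_sub_le _ _).trans (add_le_add hz
            (((fderiv ℝ f z.2 - fderiv ℝ f y).le_opNorm _).trans (by gcongr)))
      _ = c * ‖z.1‖ := by ring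
  obtain ⟨δ, hδ, hball⟩ := Metric.eventually_nhds_iff.1 key
  filter_upwards [Metric.ball_mem_nhds (0 : C(K, E)) hδ] with h hh
  rw [ContinuousMap.norm_le _ (by positivity)]
  intro r
  have hr : ‖h r‖ ≤ ‖h‖ := h.norm_coe_le_norm r
  have := hball (y := h r) (by
    rw [dist_zero_right]; exact hr.trans_lt (by simpa using hh)) (g r) ⟨r, rfl⟩
  simp only [ContinuousMap.sub_apply, ContinuousMap.comp_apply, ContinuousMap.coe_mk,
    ContinuousMap.add_apply, hL]
  exact this.trans (by gcongr)

/-- Pointwise application of a continuous family of operators to a continuous function. -/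
noncomputable def ContinuousMap.pointwiseApplyL (K E F : Type*) [TopologicalSpace K]
    [CompactSpace K] [NormedAddCommGroup E] [NormedSpace ℝ E] [NormedAddCommGroup F]
    [NormedSpace ℝ F] : C(K, E →L[ℝ] F) →L[ℝ] C(K, E) →L[ℝ] C(K, F) :=
  LinearMap.mkContinuous₂
    (LinearMap.mk₂ ℝ (fun (A : C(K, E →L[ℝ] F)) (h : C(K, E)) =>
      (⟨fun r => A r (h r), by fun_prop⟩ : C(K, F)))
      (fun _ _ _ => by ext; simp) (fun _ _ _ => by ext; simp)
      (fun _ _ _ => by ext; simp) (fun _ _ _ => by ext; simp)) 1 (by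
    intro A h
    rw [ContinuousMap.norm_le _ (by positivity)]
    intro r
    rw [one_mul]
    exact ((A r).le_opNorm _).trans
      (by gcongr; exacts [A.norm_coe_le_norm r, h.norm_coe_le_norm r]))

/-- The composition operator `g ↦ f ∘ g` on continuous functions with compact domain is as smooth
as `f`. -/
theorem contDiff_comp_continuousMap {K : Type*} [TopologicalSpace K] [CompactSpace K] {n : ℕ} :
    ∀ {E F : Type u} [NormedAddCommGroup E] [NormedSpace ℝ E] [NormedAddCommGroup F]
    [NormedSpace ℝ F] {f : E → F} (hf : ContDiff ℝ n f),
    ContDiff ℝ n (fun g : C(K, E) => (⟨f, hf.continuous⟩ : C(E, F)).comp g) := by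
  induction n with
  | zero =>
    intro E F _ _ _ _ f hf
    exact contDiff_zero.2 (ContinuousMap.continuous_postcomp _)
  | succ n ih =>
    intro E F _ _ _ _ f hf
    have hf1 : ContDiff ℝ 1 f := hf.of_le (by norm_cast; omega)
    have hf' : ContDiff ℝ n (fderiv ℝ f) := hf.fderiv_right (by norm_cast)
    refine contDiff_succ_iff_hasFDerivAt.2 ?_
    refine ⟨fun g => ContinuousMap.pointwiseApplyL K E F
      ((⟨fderiv ℝ f, hf'.continuous⟩ : C(E, E →L[ℝ] F)).comp g), ?_, fun g => ?_⟩
    · exact (ContinuousMap.pointwiseApplyL K E F).contDiff.comp (ih hf')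
    · exact hasFDerivAt_comp_continuousMap hf1 g _ fun h r => rfl

/-- Primitives from `0`, as an operator on continuous functions on the unit interval. -/
noncomputable def ContinuousMap.primitiveL (E : Type*) [NormedAddCommGroup E] [NormedSpace ℝ E] :
    C(unitInterval, E) →L[ℝ] C(unitInterval, E) :=
  LinearMap.mkContinuous
    { toFun := fun g => ⟨fun r => ∫ s in (0 : ℝ)..r, IccExtend zero_le_one g s, by
        have : Continuous (IccExtend zero_le_one g) := g.continuous.Icc_extend'
        exact (intervalIntegral.continuous_primitive
          (fun a b => this.intervalIntegrable a b) 0).comp continuous_subtype_val⟩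
      map_add' := fun g h => by
        ext r
        have hg : Continuous (IccExtend zero_le_one g) := g.continuous.Icc_extend'
        have hh : Continuous (IccExtend zero_le_one h) := h.continuous.Icc_extend'
        simp only [ContinuousMap.coe_mk, ContinuousMap.add_apply]
        rw [← intervalIntegral.integral_add (hg.intervalIntegrable _ _)
          (hh.intervalIntegrable _ _)]
        rfl
      map_smul' := fun c g => by
        ext r
        simp only [ContinuousMap.coe_mk, ContinuousMap.smul_apply, RingHom.id_apply]
        rw [← intervalIntegral.integral_smul]
        rfl } 1 (by
    intro g
    rw [ContinuousMap.norm_le _ (by positivity), one_mul]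
    intro r
    have := intervalIntegral.norm_integral_le_of_norm_le_const (a := 0) (b := (r : ℝ)) (C := ‖g‖)
      (f := IccExtend zero_le_one g) fun s _ => g.norm_coe_le_norm _
    refine this.trans (mul_le_of_le_one_right (norm_nonneg _) ?_)
    rw [sub_zero, abs_of_nonneg r.2.1]
    exact r.2.2)

theorem ContinuousMap.primitiveL_apply {E : Type*} [NormedAddCommGroup E] [NormedSpace ℝ E]
    (g : C(unitInterval, E)) (r : unitInterval) {f : ℝ → E}
    (hf : ∀ s : unitInterval, f s = g s) :
    ContinuousMap.primitiveL E g r = ∫ s in (0 : ℝ)..r, f s := by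
  refine intervalIntegral.integral_congr fun s hs => ?_
  rw [uIcc_of_le r.2.1] at hs
  have h1 : s ∈ Icc (0 : ℝ) 1 := ⟨hs.1, hs.2.trans r.2.2⟩
  exact (IccExtend_of_mem zero_le_one g h1).trans (hf ⟨s, h1⟩).symm

/-- Constant functions, as a continuous linear map. -/
noncomputable def ContinuousMap.constantL (K E : Type*) [TopologicalSpace K] [CompactSpace K]
    [NormedAddCommGroup E] [NormedSpace ℝ E] : E →L[ℝ] C(K, E) :=
  LinearMap.mkContinuous
    { toFun := fun x => ContinuousMap.const K x
      map_add' := fun _ _ => rfl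
      map_smul' := fun _ _ => rfl } 1 (fun x => by
    rw [ContinuousMap.norm_le _ (by positivity)]
    intro r
    rw [one_mul]
    exact le_rfl)

@[simp] theorem ContinuousMap.constantL_apply {K E : Type*} [TopologicalSpace K] [CompactSpace K]
    [NormedAddCommGroup E] [NormedSpace ℝ E] (x : E) (r : K) :
    ContinuousMap.constantL K E x r = x := rfl

/-- The inclusion of the unit interval in `ℝ`, as a continuous function. -/
def unitInterval.coeMap : C(unitInterval, ℝ) := ⟨Subtype.val, continuous_subtype_val⟩

/-- Pairing continuous functions pointwise preserves smooth dependence on parameters. -/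
theorem ContDiff.prodMk_continuousMap {K P E F : Type*} [TopologicalSpace K] [CompactSpace K]
    [NormedAddCommGroup P] [NormedSpace ℝ P]
    [NormedAddCommGroup E] [NormedSpace ℝ E] [NormedAddCommGroup F] [NormedSpace ℝ F] {n : ℕ}
    {u : P → C(K, E)} {v : P → C(K, F)} (hu : ContDiff ℝ n u) (hv : ContDiff ℝ n v) :
    ContDiff ℝ n (fun p => (u p).prodMk (v p)) := by
  have h : (fun p => (u p).prodMk (v p)) = fun p =>
      ContinuousLinearMap.compLeftContinuous ℝ K (ContinuousLinearMap.inl ℝ E F) (u p) +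
      ContinuousLinearMap.compLeftContinuous ℝ K (ContinuousLinearMap.inr ℝ E F) (v p) := by
    funext p
    ext r <;> simp
  rw [h]
  exact ((ContinuousLinearMap.contDiff _).comp hu).add ((ContinuousLinearMap.contDiff _).comp hv)

/-! ### Taylor expansion in the last variable -/

/-- **Hadamard's lemma**: `f(p,ε) = f(p,0) + ε h(p,ε)` with `h` one degree less smooth than `f`. -/
theorem exists_contDiff_eq_add_smul {P E : Type u} [NormedAddCommGroup P] [NormedSpace ℝ P]
    [NormedAddCommGroup E] [NormedSpace ℝ E] [CompleteSpace E] {n : ℕ} {f : P × ℝ → E}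
    (hf : ContDiff ℝ (n + 1 : ℕ) f) :
    ∃ h : P × ℝ → E, ContDiff ℝ n h ∧ ∀ p ε, f (p, ε) = f (p, 0) + ε • h (p, ε) := by
  have hg : ContDiff ℝ n fun z : P × ℝ => fderiv ℝ f z ((0 : P), (1 : ℝ)) :=
    (hf.fderiv_right (by norm_cast)).clm_apply contDiff_const
  set g : P × ℝ → E := fun z => fderiv ℝ f z ((0 : P), (1 : ℝ)) with hgdef
  let curve : P × ℝ → C(unitInterval, P × ℝ) := fun z =>
    (ContinuousMap.constantL unitInterval P z.1).prodMk (z.2 • unitInterval.coeMap)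
  have hcurve : ContDiff ℝ n curve :=
    ContDiff.prodMk_continuousMap ((ContinuousLinearMap.contDiff _).comp contDiff_fst)
      (contDiff_snd.smul contDiff_const)
  refine ⟨fun z => ContinuousMap.primitiveL E
    ((⟨g, hg.continuous⟩ : C(P × ℝ, E)).comp (curve z)) 1, ?_, fun p ε => ?_⟩
  · have h1 : ContDiff ℝ n fun z => ContinuousMap.primitiveL E
        ((⟨g, hg.continuous⟩ : C(P × ℝ, E)).comp (curve z)) :=
      (ContinuousLinearMap.contDiff _).comp ((contDiff_comp_continuousMap hg).comp hcurve)
    exact (ContinuousMap.evalCLM ℝ (1 : unitInterval)).contDiff.comp h1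
  · have hint : ContinuousMap.primitiveL E
        ((⟨g, hg.continuous⟩ : C(P × ℝ, E)).comp (curve (p, ε))) 1 =
        ∫ s in (0 : ℝ)..1, g (p, s * ε) :=
      ContinuousMap.primitiveL_apply _ _ fun s => by simp [curve, unitInterval.coeMap, mul_comm]
    have hd : ∀ s : ℝ, HasDerivAt (fun s : ℝ => f (p, s * ε)) (ε • g (p, s * ε)) s := fun s => by
      have h1 : HasDerivAt (fun s : ℝ => (p, s * ε)) ((0 : P), ε) s := by
        simpa using (hasDerivAt_const s p).prodMk ((hasDerivAt_id s).mul_const ε)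
      have h2 := ((hf.differentiable (by simp)) (p, s * ε)).hasFDerivAt.comp_hasDerivAt s h1
      have h3 : ε • g (p, s * ε) = fderiv ℝ f (p, s * ε) (0, ε) := by
        rw [hgdef, ← map_smul]
        simp
      rw [h3]
      exact h2
    have hc : Continuous fun s : ℝ => ε • g (p, s * ε) := by
      have := hg.continuous
      fun_prop
    have := intervalIntegral.integral_eq_sub_of_hasDerivAt (a := 0) (b := 1)
      (fun s _ => hd s) (hc.intervalIntegrable _ _)
    rw [intervalIntegral.integral_smul] at this
    simp only [hint, this, one_mul, zero_mul]
    abel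

/-- Taylor expansion of a `C^n` function in its last variable. The coefficient `c i` has
`n - i` derivatives left, and so has the remainder after the terms of order less than `i`, which
is `ε ^ i` times a function that extends `c i` to `ε ≠ 0`. -/
theorem exists_taylor_snd {P E : Type u} [NormedAddCommGroup P] [NormedSpace ℝ P]
    [NormedAddCommGroup E] [NormedSpace ℝ E] [CompleteSpace E] {n : ℕ} :
    ∀ {f : P × ℝ → E} (_ : ContDiff ℝ n f), ∃ c : ℕ → P → E, ∀ i ≤ n,
      ContDiff ℝ (n - i : ℕ) (c i) ∧ ∃ h : P × ℝ → E, ContDiff ℝ (n - i : ℕ) h ∧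
        (∀ p, h (p, 0) = c i p) ∧
        ∀ p ε, f (p, ε) = ∑ m ∈ Finset.range i, ε ^ m • c m p + ε ^ i • h (p, ε) := by
  induction n with
  | zero =>
    intro f hf
    refine ⟨fun _ p => f (p, 0), fun i hi => ?_⟩
    obtain rfl : i = 0 := by omega
    exact ⟨hf.comp (contDiff_prodMk_left 0), f, hf, fun _ => rfl, fun p ε => by simp⟩
  | succ n ih =>
    intro f hf
    obtain ⟨g, hg, hfg⟩ := exists_contDiff_eq_add_smul hf
    obtain ⟨c, hc⟩ := ih hg
    refine ⟨fun i => Nat.casesOn i (fun p => f (p, 0)) c, fun i hi => ?_⟩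
    cases i with
    | zero => exact ⟨hf.comp (contDiff_prodMk_left 0), f, hf, fun _ => rfl, fun p ε => by simp⟩
    | succ i =>
      obtain ⟨h1, h, h2, h3, h4⟩ := hc i (by omega)
      rw [Nat.add_sub_add_right]
      refine ⟨h1, h, h2, h3, fun p ε => ?_⟩
      rw [hfg, h4, Finset.sum_range_succ']
      simp only [smul_add, Finset.smul_sum, smul_smul, ← pow_succ', pow_zero, one_smul]
      exact (add_left_comm _ _ _).trans (by rw [← add_assoc]; rfl)

/-! ### Cutting off, and smooth dependence of fixed points and of flows on parameters -/

/-- A `C^n` function on an open set agrees, near a given compact subset, with a compactly supported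
`C^n` function on the whole space. -/
theorem exists_contDiff_hasCompactSupport_eventuallyEq {E F : Type*} [NormedAddCommGroup E]
    [NormedSpace ℝ E] [FiniteDimensional ℝ E] [NormedAddCommGroup F] [NormedSpace ℝ F] {n : ℕ}
    {K Ω : Set E} (hK : IsCompact K) (hΩ : IsOpen Ω) (hKΩ : K ⊆ Ω) {f : E → F}
    (hf : ContDiffOn ℝ n f Ω) :
    ∃ g : E → F, ContDiff ℝ n g ∧ HasCompactSupport g ∧ ∀ᶠ x in 𝓝ˢ K, g x = f x := by
  obtain ⟨K', hK', hKK', hK'Ω⟩ := exists_compact_between hK hΩ hKΩ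
  obtain ⟨χ, h0, h1, -⟩ := exists_contMDiffMap_zero_one_nhds_of_isClosed
    (n := (n : ℕ∞)) (modelWithCornersSelf ℝ E) isOpen_interior.isClosed_compl hK.isClosed
    (disjoint_compl_left_iff_subset.2 hKK')
  have hχ : ContDiff ℝ n χ := by
    have := χ.contMDiff
    rw [contMDiff_iff_contDiff] at this
    exact_mod_cast this
  refine ⟨fun x => χ x • f x, ?_, ?_, ?_⟩
  · rw [contDiff_iff_contDiffAt]
    intro x
    by_cases hx : x ∈ interior K'
    · have hxΩ : Ω ∈ 𝓝 x := hΩ.mem_nhds (hK'Ω (interior_subset hx))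
      exact hχ.contDiffAt.smul (hf.contDiffAt hxΩ)
    · have : (fun x => χ x • f x) =ᶠ[𝓝 x] fun _ => 0 := by
        filter_upwards [h0.filter_mono (nhds_le_nhdsSet (mem_compl hx))] with y hy
        rw [hy, zero_smul]
      exact contDiffAt_const.congr_of_eventuallyEq this
  · refine HasCompactSupport.intro hK' fun x hx => ?_
    rw [h0.self_of_nhdsSet x fun h => hx (interior_subset h), zero_smul]
  · filter_upwards [h1] with x hx
    rw [hx, one_smul]

theorem ContDiffAt.exists_contDiff_eventuallyEq {E F : Type*} [NormedAddCommGroup E]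
    [NormedSpace ℝ E] [FiniteDimensional ℝ E] [NormedAddCommGroup F] [NormedSpace ℝ F] {n : ℕ}
    {f : E → F} {x : E} (hf : ContDiffAt ℝ n f x) :
    ∃ g : E → F, ContDiff ℝ n g ∧ g =ᶠ[𝓝 x] f := by
  obtain ⟨Ω, hfΩ, hΩ, hxΩ⟩ := eventually_nhds_iff.1 (hf.eventually (by simp))
  obtain ⟨g, hg, -, hgf⟩ := exists_contDiff_hasCompactSupport_eventuallyEq isCompact_singleton hΩ
    (singleton_subset_iff.2 hxΩ) fun y hy => (hfΩ y hy).contDiffWithinAt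
  exact ⟨g, hg, by simpa [nhdsSet_singleton, Filter.EventuallyEq] using hgf⟩

/-- A smooth bounded function which is the identity on a given interval. -/
theorem exists_contDiff_eq_id_abs_le (n : ℕ) {B : ℝ} (hB : 0 < B) :
    ∃ σ : ℝ → ℝ, ContDiff ℝ n σ ∧ (∀ s, |s| ≤ B → σ s = s) ∧ ∀ s, |σ s| ≤ 2 * B := by
  let f : ContDiffBump (0 : ℝ) := ⟨B, 2 * B, hB, by linarith⟩
  refine ⟨fun s => f s * s, f.contDiff.mul contDiff_id, fun s hs => ?_, fun s => ?_⟩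
  · simp only
    rw [f.one_of_mem_closedBall (by simpa [f] using hs), one_mul]
  · rw [abs_mul, abs_of_nonneg f.nonneg]
    rcases le_or_gt (2 * B) |s| with h | h
    · rw [f.zero_of_le_dist (by simpa [f] using h), zero_mul]
      positivity
    · exact (mul_le_of_le_one_left (abs_nonneg s) f.le_one).trans h.le

/-- The fixed point of a smooth family of uniform contractions depends smoothly on the
parameter. -/
theorem exists_contDiff_fixedPoint {P X : Type*} [NormedAddCommGroup P] [NormedSpace ℝ P]
    [CompleteSpace P] [NormedAddCommGroup X] [NormedSpace ℝ X] [CompleteSpace X] {n : ℕ}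
    (hn : n ≠ 0) {T : P × X → X} (hT : ContDiff ℝ n T)
    (hc : ∀ p x y, ‖T (p, x) - T (p, y)‖ ≤ 1 / 2 * ‖x - y‖) :
    ∃ w : P → X, ContDiff ℝ n w ∧ ∀ p, T (p, w p) = w p := by
  have hlip : ∀ p, LipschitzWith (1 / 2) fun x => T (p, x) := fun p =>
    LipschitzWith.of_dist_le_mul fun x y => by
      simpa [dist_eq_norm] using hc p x y
  have hcontr : ∀ p, ContractingWith (1 / 2) fun x => T (p, x) := fun p =>
    ⟨by rw [← NNReal.coe_lt_coe]; norm_num, hlip p⟩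
  let w : P → X := fun p => ContractingWith.fixedPoint _ (hcontr p)
  have hw : ∀ p, T (p, w p) = w p := fun p => (hcontr p).fixedPoint_isFixedPt
  have huniq : ∀ p x, T (p, x) = x → x = w p := fun p x hx =>
    (hcontr p).fixedPoint_unique hx
  refine ⟨w, contDiff_iff_contDiffAt.2 fun p => ?_, hw⟩
  have hn' : ((n : ℕ) : WithTop ℕ∞) ≠ 0 := by exact_mod_cast hn
  let f : P × X → X := fun z => z.2 - T z
  have hf : ContDiff ℝ n f := contDiff_snd.sub hT
  set D : X →L[ℝ] X := fderiv ℝ T (p, w p) ∘L .inr ℝ P X with hD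
  have hDnorm : ‖D‖ < 1 := by
    have h1 : HasFDerivAt (fun x => T (p, x)) D (w p) :=
      ((hT.differentiable hn').differentiableAt.hasFDerivAt).comp (w p)
        (hasFDerivAt_prodMk_right p (w p))
    have := h1.le_of_lipschitz (hlip p)
    exact this.trans_lt (by norm_num)
  have hinv : (fderiv ℝ f (p, w p) ∘L .inr ℝ P X).IsInvertible := by
    have h1 : fderiv ℝ f (p, w p) ∘L .inr ℝ P X = 1 - D := by
      have : fderiv ℝ f (p, w p) = .snd ℝ P X - fderiv ℝ T (p, w p) :=
        (hasFDerivAt_snd.sub ((hT.differentiable hn').differentiableAt.hasFDerivAt)).fderiv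
      rw [this, hD]
      ext x
      simp
    rw [h1]
    exact ⟨ContinuousLinearEquiv.unitsEquiv ℝ X (Units.oneSub D hDnorm), rfl⟩
  have hfp : ContDiffAt ℝ n f (p, w p) := hf.contDiffAt
  have h2 := hfp.contDiffAt_implicitFunction hn' hinv
  refine h2.congr_of_eventuallyEq ?_
  filter_upwards [hfp.eventually_apply_implicitFunction hn' hinv] with q hq
  refine (huniq q _ ?_).symm
  have h3 : f (p, w p) = 0 := by simp [f, hw]
  rw [h3] at hq
  exact (sub_eq_zero.1 hq).symm

/-- **Smooth dependence of the flow** of `x' = ε G(t,x,ε)` on the initial time `t₀`, the time `t`,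
the initial value `x` and `ε`. The solution is written as `x + ε Ψ(t₀,t,x,ε)`. -/
theorem exists_contDiff_flow {E : Type u} [NormedAddCommGroup E] [NormedSpace ℝ E]
    [CompleteSpace E] {n : ℕ} (hn : n ≠ 0) {G : ℝ × E × ℝ → E} (hG : ContDiff ℝ n G)
    {L : NNReal} (hL : LipschitzWith L G) {B : ℝ} (hB : 0 < B) :
    ∃ ε₁ > 0, ∃ Ψ : ℝ × ℝ × E × ℝ → E, ContDiff ℝ n Ψ ∧
      ∀ t₀ t x ε, |t₀| ≤ B → |t| ≤ B → |ε| ≤ ε₁ →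
        Ψ (t₀, t, x, ε) = ∫ s in t₀..t, G (s, x + ε • Ψ (t₀, s, x, ε), ε) := by
  obtain ⟨σ, hσ, hσid, hσB⟩ := exists_contDiff_eq_id_abs_le n hB
  have hε₁ : 0 < 1 / (16 * B * (L + 1)) := by positivity
  obtain ⟨e, he, heid, heB⟩ := exists_contDiff_eq_id_abs_le n hε₁
  let Q := ℝ × ℝ × E × ℝ
  let h : Q → ℝ := fun q => σ q.2.1 - σ q.1
  have hh : ContDiff ℝ n h := (hσ.comp contDiff_snd.fst).sub (hσ.comp contDiff_fst)
  -- the curve `r ↦ (t₀ + r (t - t₀), x + ε η(r), ε)` on the unit interval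
  let curve : Q × C(unitInterval, E) → C(unitInterval, ℝ × E × ℝ) := fun z =>
    (ContinuousMap.constantL unitInterval ℝ (σ z.1.1) + h z.1 • unitInterval.coeMap).prodMk
      ((ContinuousMap.constantL unitInterval E z.1.2.2.1 + e z.1.2.2.2 • z.2).prodMk
        (ContinuousMap.constantL unitInterval ℝ z.1.2.2.2))
  have hcurve : ContDiff ℝ n curve := by
    refine ContDiff.prodMk_continuousMap (ContDiff.add ?_ ?_)
      (ContDiff.prodMk_continuousMap (ContDiff.add ?_ ?_) ?_)
    · exact (ContinuousLinearMap.contDiff _).comp (hσ.comp contDiff_fst.fst)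
    · exact (hh.comp contDiff_fst).smul contDiff_const
    · exact (ContinuousLinearMap.contDiff _).comp contDiff_fst.snd.snd.fst
    · exact (he.comp contDiff_fst.snd.snd.snd).smul contDiff_snd
    · exact (ContinuousLinearMap.contDiff _).comp contDiff_fst.snd.snd.snd
  let T : Q × C(unitInterval, E) → C(unitInterval, E) := fun z =>
    h z.1 • ContinuousMap.primitiveL E ((⟨G, hG.continuous⟩ : C(ℝ × E × ℝ, E)).comp (curve z))
  have hT : ContDiff ℝ n T := (hh.comp contDiff_fst).smul
    ((ContinuousLinearMap.contDiff _).comp ((contDiff_comp_continuousMap hG).comp hcurve))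
  have hTapply : ∀ q η (r : unitInterval) (f : ℝ → E), (∀ r : unitInterval, f r = η r) →
      T (q, η) r = h q • ∫ s in (0 : ℝ)..r,
        G (σ q.1 + h q * s, q.2.2.1 + e q.2.2.2 • f s, q.2.2.2) := by
    intro q η r f hf
    simp only [T, ContinuousMap.smul_apply]
    congr 1
    exact ContinuousMap.primitiveL_apply (f := fun s =>
      G (σ q.1 + h q * s, q.2.2.1 + e q.2.2.2 • f s, q.2.2.2)) _ _ fun s => by
        simp [curve, unitInterval.coeMap, hf]
  have hcontr : ∀ q η η', ‖T (q, η) - T (q, η')‖ ≤ 1 / 2 * ‖η - η'‖ := by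
    intro q η η'
    rw [ContinuousMap.norm_le _ (by positivity)]
    intro r
    have hcurves : ∀ η : C(unitInterval, E), Continuous fun s : ℝ =>
        G (σ q.1 + h q * s, q.2.2.1 + e q.2.2.2 • IccExtend zero_le_one η s, q.2.2.2) := by
      intro η
      have h1 : Continuous (IccExtend zero_le_one η) := η.continuous.Icc_extend'
      have h2 := hG.continuous
      fun_prop
    have hext : ∀ (η : C(unitInterval, E)) (r : unitInterval),
        IccExtend zero_le_one η (r : ℝ) = η r := fun η r => by simp
    rw [ContinuousMap.sub_apply, hTapply q η r _ (hext η), hTapply q η' r _ (hext η'), ← smul_sub,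
      ← intervalIntegral.integral_sub ((hcurves η).intervalIntegrable _ _)
        ((hcurves η').intervalIntegrable _ _), norm_smul]
    have hint := intervalIntegral.norm_integral_le_of_norm_le_const (a := 0) (b := (r : ℝ))
      (C := L * (2 * (1 / (16 * B * (L + 1))) * ‖η - η'‖))
      (f := fun s => G (σ q.1 + h q * s, q.2.2.1 + e q.2.2.2 • IccExtend zero_le_one η s, q.2.2.2) -
        G (σ q.1 + h q * s, q.2.2.1 + e q.2.2.2 • IccExtend zero_le_one η' s, q.2.2.2))
      fun s _ => by
        refine (hL.norm_sub_le _ _).trans ?_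
        gcongr
        simp only [Prod.mk_sub_mk, sub_self, add_sub_add_left_eq_sub, ← smul_sub]
        rw [Prod.norm_mk, Prod.norm_mk, norm_zero, max_eq_left (norm_nonneg _),
          max_eq_right (norm_nonneg _), norm_smul]
        gcongr
        · exact heB _
        · exact (η - η').norm_coe_le_norm _
    have hr : |(r : ℝ) - 0| ≤ 1 := by
      rw [sub_zero, abs_of_nonneg r.2.1]; exact r.2.2
    have hhB : |h q| ≤ 4 * B := (abs_sub _ _).trans (by linarith [hσB q.2.1, hσB q.1])
    have hB' : 4 * B * (L * (2 * (1 / (16 * B * (L + 1))) * ‖η - η'‖)) ≤ 1 / 2 * ‖η - η'‖ := by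
      have h0 : 4 * B * (L * (2 * (1 / (16 * B * (L + 1))) * ‖η - η'‖)) =
          (L / (L + 1)) * (1 / 2 * ‖η - η'‖) := by
        field_simp
        ring
      rw [h0]
      refine mul_le_of_le_one_left (by positivity) ?_
      rw [div_le_one (by positivity)]
      linarith
    calc ‖h q‖ * _ ≤ 4 * B * (L * (2 * (1 / (16 * B * (L + 1))) * ‖η - η'‖)) := by
          rw [Real.norm_eq_abs]
          refine mul_le_mul hhB (hint.trans (mul_le_of_le_one_right (by positivity) hr))
            (norm_nonneg _) (by positivity)
      _ ≤ _ := hB'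
  obtain ⟨w, hw, hwT⟩ := exists_contDiff_fixedPoint hn hT hcontr
  have huniq : ∀ q η, T (q, η) = η → η = w q := by
    intro q η hη
    have := hcontr q η (w q)
    rw [hη, hwT] at this
    have h0 : ‖η - w q‖ = 0 := le_antisymm (by linarith [norm_nonneg (η - w q)]) (norm_nonneg _)
    exact sub_eq_zero.1 (norm_eq_zero.1 h0)
  refine ⟨_, hε₁, fun q => w q 1, ?_, ?_⟩
  · exact (ContinuousMap.evalCLM ℝ (1 : unitInterval) : C(unitInterval, E) →L[ℝ] E).contDiff.comp hw
  intro t₀ t x ε ht₀ ht hε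
  have hσt₀ := hσid t₀ ht₀
  have hσt := hσid t ht
  have heε := heid ε hε
  set q : Q := (t₀, t, x, ε) with hq
  have hhq : h q = t - t₀ := by simp [h, hq, hσt₀, hσt]
  -- restricting the solution to a shorter interval gives the solution on that interval
  have hcons : ∀ r : unitInterval, w (t₀, t₀ + (t - t₀) * r, x, ε) 1 = w q r := by
    intro r
    set s := t₀ + (t - t₀) * (r : ℝ) with hs
    have hsB : |s| ≤ B := by
      have hr0 := r.2.1
      have hr1 := r.2.2
      have : s = (1 - (r : ℝ)) * t₀ + r * t := by rw [hs]; ring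
      rw [this]
      rw [abs_le] at *
      constructor <;> nlinarith
    have hσs := hσid s hsB
    have hhs : h (t₀, s, x, ε) = (t - t₀) * r := by
      change σ s - σ t₀ = _
      rw [hσs, hσt₀, hs]
      ring
    let η : C(unitInterval, E) := ⟨fun u => w q (r * u), by fun_prop⟩
    have : η = w (t₀, s, x, ε) := by
      refine huniq _ _ ?_
      ext u
      rw [hTapply _ _ _ (fun u => IccExtend zero_le_one (w q) (r * u)) (fun v => by
        have : (r : ℝ) * v = ((r * v : unitInterval) : ℝ) := rfl
        rw [this, IccExtend_val]; rfl), hhs]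
      simp only [hσt₀, heε]
      have hsub := intervalIntegral.smul_integral_comp_mul_left (a := 0) (b := (u : ℝ))
        (fun v => G (t₀ + (t - t₀) * v, x + ε • IccExtend zero_le_one (w q) v, ε)) (r : ℝ)
      rw [mul_smul]
      simp only [mul_assoc]
      rw [hsub, mul_zero]
      have h1 := DFunLike.congr_fun (hwT q) (r * u)
      rw [hTapply q (w q) (r * u) (IccExtend zero_le_one (w q)) (fun v => by simp), hhq] at h1
      simp only [hq, hσt₀, heε] at h1
      exact h1
    rw [← this]
    simp [η]
  have h1 := DFunLike.congr_fun (hwT q) 1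
  rw [hTapply q (w q) 1 (fun r => w (t₀, t₀ + (t - t₀) * r, x, ε) 1) hcons, hhq] at h1
  have hsub := intervalIntegral.smul_integral_comp_add_mul (a := 0) (b := 1)
    (fun s => G (s, x + ε • w (t₀, s, x, ε) 1, ε)) (t - t₀) t₀
  simp only [mul_zero, add_zero, mul_one, add_sub_cancel] at hsub
  simp only [← hsub, ← h1]
  simp [hq, hσt₀, heε]

/-! ### Jets of functions of one real variable -/

/-- `f(ε) = ∑_{i ≤ n} ε^i c_i + o(ε^n)` as `ε → 0`; because `0` is not excluded, this contains
`f(0) = c_0`. -/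
def HasJet {E : Type*} [NormedAddCommGroup E] [NormedSpace ℝ E] (n : ℕ) (f : ℝ → E) (c : ℕ → E) :
    Prop :=
  (fun ε => f ε - ∑ i ∈ Finset.range (n + 1), ε ^ i • c i) =o[𝓝 0] fun ε : ℝ => ε ^ n

namespace HasJet

variable {E F : Type*} [NormedAddCommGroup E] [NormedSpace ℝ E] [NormedAddCommGroup F]
  [NormedSpace ℝ F] {n : ℕ} {f g : ℝ → E} {c c' : ℕ → E}

theorem congr_coeff (h : HasJet n f c) (hc : ∀ i ≤ n, c i = c' i) : HasJet n f c' := by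
  unfold HasJet at *
  convert h using 5 with ε i hi
  rw [hc i (by simpa [Nat.lt_succ_iff] using hi)]

theorem congr_fun (h : HasJet n f c) (hfg : f =ᶠ[𝓝 0] g) : HasJet n g c :=
  Asymptotics.IsLittleO.congr' h (by filter_upwards [hfg] with ε hε; rw [hε]) EventuallyEq.rfl

theorem add_isLittleO (h : HasJet n f c) (hg : (fun ε => g ε - f ε) =o[𝓝 0] fun ε : ℝ => ε ^ n) :
    HasJet n g c := by
  refine (Asymptotics.IsLittleO.add hg h).congr_left fun ε => ?_
  abel

theorem polynomial (n : ℕ) (c : ℕ → E) :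
    HasJet n (fun ε => ∑ i ∈ Finset.range (n + 1), ε ^ i • c i) c := by
  unfold HasJet
  simp only [sub_self]
  exact Asymptotics.isLittleO_zero _ _

theorem isLittleO_pow_succ (n : ℕ) (v : E) :
    (fun ε : ℝ => ε ^ (n + 1) • v) =o[𝓝 0] fun ε : ℝ => ε ^ n := by
  have h : (fun ε : ℝ => ε ^ (n + 1)) =o[𝓝 0] fun ε : ℝ => ε ^ n :=
    Asymptotics.isLittleO_pow_pow (Nat.lt_succ_self n)
  have h2 : (fun _ : ℝ => v) =O[𝓝 0] fun _ : ℝ => (1 : ℝ) :=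
    Asymptotics.isBigO_const_const v one_ne_zero _
  simpa using h.smul_isBigO h2

theorem isLittleO_pow_smul {u : ℝ → E} (hu : Tendsto u (𝓝 0) (𝓝 0)) (n : ℕ) :
    (fun ε : ℝ => ε ^ n • u ε) =o[𝓝 0] fun ε : ℝ => ε ^ n := by
  simpa using (Asymptotics.isBigO_refl (fun ε : ℝ => ε ^ n) (𝓝 0)).smul_isLittleO
    ((Asymptotics.isLittleO_one_iff ℝ).2 hu)

theorem of_succ (h : HasJet (n + 1) f c) : HasJet n f c := by
  have h1 : (fun ε : ℝ => ε ^ (n + 1)) =o[𝓝 0] fun ε : ℝ => ε ^ n :=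
    Asymptotics.isLittleO_pow_pow (Nat.lt_succ_self n)
  have h2 := (Asymptotics.IsLittleO.trans h h1).add (isLittleO_pow_succ n (c (n + 1)))
  refine h2.congr_left fun ε => ?_
  rw [Finset.sum_range_succ _ (n + 1)]
  abel

theorem mono (h : HasJet n f c) {m : ℕ} (hm : m ≤ n) : HasJet m f c := by
  induction n, hm using Nat.le_induction with
  | base => exact h
  | succ n _ ih => exact ih h.of_succ

theorem tendsto (h : HasJet n f c) : Tendsto f (𝓝 0) (𝓝 (c 0)) := by
  have := h.mono (Nat.zero_le n)
  unfold HasJet at this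
  simpa [Asymptotics.isLittleO_one_iff, tendsto_sub_nhds_zero_iff] using this

theorem apply_zero (h : HasJet n f c) : f 0 = c 0 :=
  tendsto_nhds_unique (tendsto_pure_nhds f 0) (h.tendsto.mono_left (pure_le_nhds 0))

theorem continuousAt (h : HasJet n f c) : ContinuousAt f 0 := by
  rw [ContinuousAt, h.apply_zero]
  exact h.tendsto

theorem unique (h : HasJet n f c) (h' : HasJet n f c') : ∀ i ≤ n, c i = c' i := by
  intro i
  induction i using Nat.strong_induction_on with
  | _ i ih =>
    intro hi
    have h1 := Asymptotics.IsLittleO.sub (h.mono hi) (h'.mono hi)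
    have h2 : (fun ε : ℝ => ε ^ i • (c' i - c i)) =o[𝓝 0] fun ε : ℝ => ε ^ i := by
      refine h1.congr_left fun ε => ?_
      rw [Finset.sum_range_succ, Finset.sum_range_succ,
        Finset.sum_congr rfl fun m hm => by
          rw [ih m (Finset.mem_range.1 hm) ((Finset.mem_range.1 hm).le.trans hi)]]
      rw [smul_sub]
      abel
    by_contra hne
    have hne' : ‖c' i - c i‖ ≠ 0 := by
      rw [norm_ne_zero_iff]
      exact sub_ne_zero.2 (Ne.symm hne)
    have h3 : (fun ε : ℝ => ε ^ i) =o[𝓝[≠] 0] fun ε : ℝ => ε ^ i := by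
      refine (Asymptotics.IsBigO.of_bound (‖c' i - c i‖⁻¹) ?_).trans_isLittleO
        (h2.mono nhdsWithin_le_nhds)
      refine Eventually.of_forall fun ε => ?_
      rw [norm_smul, mul_comm ‖ε ^ i‖, ← mul_assoc, inv_mul_cancel₀ hne', one_mul]
    have h4 : ∀ᶠ ε : ℝ in 𝓝[≠] 0, False := by
      filter_upwards [h3.def one_half_pos, self_mem_nhdsWithin] with ε hε hε'
      have : 0 < ‖ε ^ i‖ := norm_pos_iff.2 (pow_ne_zero i hε')
      linarith
    exact h4.exists.elim fun _ h => h

theorem add (h : HasJet n f c) (h' : HasJet n g c') :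
    HasJet n (fun ε => f ε + g ε) fun i => c i + c' i := by
  refine (Asymptotics.IsLittleO.add h h').congr_left fun ε => ?_
  simp only [smul_add, Finset.sum_add_distrib]
  abel

theorem sub (h : HasJet n f c) (h' : HasJet n g c') :
    HasJet n (fun ε => f ε - g ε) fun i => c i - c' i := by
  refine (Asymptotics.IsLittleO.sub h h').congr_left fun ε => ?_
  simp only [smul_sub, Finset.sum_sub_distrib]
  abel

theorem const_smul (h : HasJet n f c) (a : ℝ) :
    HasJet n (fun ε => a • f ε) fun i => a • c i := by
  refine (Asymptotics.IsLittleO.const_smul_left h a).congr_left fun ε => ?_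
  simp only [Pi.smul_apply, smul_sub, Finset.smul_sum]
  congr 1
  exact Finset.sum_congr rfl fun i _ => smul_comm _ _ _

theorem zero (n : ℕ) : HasJet n (fun _ => (0 : E)) fun _ => 0 := by
  simpa using polynomial n (fun _ => (0 : E))

theorem sum {ι : Type*} (s : Finset ι) {f : ι → ℝ → E} {c : ι → ℕ → E}
    (h : ∀ a ∈ s, HasJet n (f a) (c a)) :
    HasJet n (fun ε => ∑ a ∈ s, f a ε) fun i => ∑ a ∈ s, c a i := by
  classical
  induction s using Finset.induction_on with
  | empty => simpa using zero n
  | insert a s ha ih =>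
    simp only [Finset.sum_insert ha]
    exact (h a (Finset.mem_insert_self _ _)).add
      (ih fun b hb => h b (Finset.mem_insert_of_mem hb))

theorem pow_smul_const (n s : ℕ) (v : E) :
    HasJet n (fun ε => ε ^ s • v) fun i => if s = i then v else 0 := by
  unfold HasJet
  simp only [smul_ite, smul_zero, Finset.sum_ite_eq, Finset.mem_range]
  split_ifs with h
  · simp only [sub_self]
    exact Asymptotics.isLittleO_zero _ _
  · simp only [sub_zero]
    obtain ⟨m, rfl⟩ := Nat.exists_eq_add_of_le (not_lt.1 h)
    have h1 := isLittleO_pow_succ n v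
    have h2 : (fun ε : ℝ => ε ^ m) =O[𝓝 0] fun _ : ℝ => (1 : ℝ) :=
      (continuous_pow m).continuousAt.isBigO_one ℝ
    simpa [smul_smul, pow_add, mul_comm, mul_left_comm] using h2.smul_isLittleO h1

/-- Collecting the powers of `ε` in `∑_m ε^m g_m(ε)`. -/
theorem sum_pow_smul {g : ℕ → ℝ → E} {d : ℕ → ℕ → E} (h : ∀ m ≤ n, HasJet (n - m) (g m) (d m)) :
    HasJet n (fun ε => ∑ m ∈ Finset.range (n + 1), ε ^ m • g m ε)
      fun i => ∑ m ∈ Finset.range (i + 1), d m (i - m) := by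
  have h1 : ∀ m ∈ Finset.range (n + 1), HasJet n (fun ε => ε ^ m • g m ε)
      fun i => if m ≤ i then d m (i - m) else 0 := by
    intro m hm
    have hmn : m ≤ n := Nat.lt_succ_iff.1 (Finset.mem_range.1 hm)
    have h2 : (fun ε : ℝ => ε ^ m • (g m ε - ∑ i ∈ Finset.range (n - m + 1), ε ^ i • d m i))
        =o[𝓝 0] fun ε : ℝ => ε ^ m • ε ^ (n - m) :=
      (Asymptotics.isBigO_refl _ _).smul_isLittleO (h m hmn)
    simp only [smul_eq_mul, ← pow_add, Nat.add_sub_cancel' hmn] at h2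
    refine h2.congr_left fun ε => ?_
    rw [smul_sub, Finset.smul_sum]
    congr 1
    conv_rhs => rw [show n + 1 = m + (n - m + 1) by omega, Finset.sum_range_add]
    have h3 : ∑ i ∈ Finset.range m, ε ^ i • (fun i => if m ≤ i then d m (i - m) else 0) i = 0 :=
      Finset.sum_eq_zero fun i hi => by
        simp only
        rw [if_neg (by have := Finset.mem_range.1 hi; omega), smul_zero]
    rw [h3, zero_add]
    refine Finset.sum_congr rfl fun i _ => ?_
    simp only
    rw [if_pos (by omega), Nat.add_sub_cancel_left, smul_smul, pow_add]
  refine (sum _ h1).congr_coeff fun i hi => ?_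
  rw [← Finset.sum_filter]
  refine Finset.sum_congr ?_ fun _ _ => rfl
  ext m
  simp only [Finset.mem_filter, Finset.mem_range]
  omega

end HasJet

theorem ContDiffAt.hasJet {E : Type*} [NormedAddCommGroup E] [NormedSpace ℝ E] {n : ℕ} {f : ℝ → E}
    (hf : ContDiffAt ℝ n f 0) :
    HasJet n f fun i => (1 / (i ! : ℝ)) • iteratedDeriv i f 0 := by
  obtain ⟨g, hg, hgf⟩ := hf.exists_contDiff_eventuallyEq
  have h := taylor_isLittleO convex_univ (mem_univ (0 : ℝ)) hg.contDiffOn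
  have h1 : HasJet n g fun i => (1 / (i ! : ℝ)) • iteratedDeriv i g 0 := by
    unfold HasJet
    rw [nhdsWithin_univ] at h
    simp only [taylor_within_apply, sub_zero, iteratedDerivWithin_univ] at h
    refine h.congr_left fun ε => ?_
    congr 1
    refine Finset.sum_congr rfl fun i _ => ?_
    rw [smul_smul]
    congr 1
    ring
  exact (h1.congr_fun hgf).congr_coeff fun i _ => by rw [hgf.iteratedDeriv_eq]

theorem HasJet.iteratedDeriv_eq {E : Type*} [NormedAddCommGroup E] [NormedSpace ℝ E] {n : ℕ}
    {f : ℝ → E} {c : ℕ → E} (h : HasJet n f c) (hf : ContDiffAt ℝ n f 0) {i : ℕ} (hi : i ≤ n) :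
    iteratedDeriv i f 0 = (i ! : ℝ) • c i := by
  rw [h.unique hf.hasJet i hi, smul_smul, mul_one_div_cancel (by positivity), one_smul]

/-- Jets of an integral with parameter `ε`. -/
theorem HasJet.intervalIntegral {E : Type u} [NormedAddCommGroup E] [NormedSpace ℝ E]
    [CompleteSpace E] {n : ℕ} {c : ℕ → ℝ → E} {f h : ℝ × ℝ → E}
    (hc : ∀ i ≤ n, Continuous (c i)) (hh : Continuous h) (hhc : ∀ s, h (s, 0) = c n s)
    (hf : ∀ s ε, f (s, ε) = ∑ m ∈ Finset.range n, ε ^ m • c m s + ε ^ n • h (s, ε)) (a b : ℝ) :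
    HasJet n (fun ε => ∫ s in a..b, f (s, ε)) fun i => ∫ s in a..b, c i s := by
  have hI : Continuous fun ε : ℝ => ∫ s in a..b, h (s, ε) :=
    intervalIntegral.continuous_parametric_intervalIntegral_of_continuous' (by fun_prop) _ _
  have h0 : (fun ε : ℝ => ε ^ n • ((∫ s in a..b, h (s, ε)) - ∫ s in a..b, c n s)) =o[𝓝 0]
      fun ε : ℝ => ε ^ n := by
    refine isLittleO_pow_smul ?_ n
    rw [tendsto_sub_nhds_zero_iff]
    simpa [hhc] using hI.tendsto 0
  refine h0.congr_left fun ε => ?_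
  simp only [hf]
  rw [intervalIntegral.integral_add, intervalIntegral.integral_finsetSum,
    Finset.sum_range_succ, intervalIntegral.integral_smul,
    Finset.sum_congr rfl fun m _ => intervalIntegral.integral_smul _ _, smul_sub]
  · abel
  · intro m hm
    have := hc m (Finset.mem_range.1 hm).le
    exact Continuous.intervalIntegrable (by fun_prop) _ _
  · refine Continuous.intervalIntegrable (continuous_finsetSum _ fun m hm => ?_) _ _
    have := hc m (Finset.mem_range.1 hm).le
    fun_prop
  · exact Continuous.intervalIntegrable (by fun_prop) _ _

/-- Jets of `ε ↦ f(p(ε), ε)`, where the jets of the Taylor coefficients of `f(p, ·)` along the curve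
`p` are known. -/
theorem HasJet.comp_prodMk {P E : Type*} [NormedAddCommGroup P] [NormedSpace ℝ P]
    [NormedAddCommGroup E] [NormedSpace ℝ E] {n : ℕ} {c : ℕ → P → E} {f h : P × ℝ → E}
    (hh : Continuous h) (hhc : ∀ p, h (p, 0) = c n p)
    (hf : ∀ p ε, f (p, ε) = ∑ m ∈ Finset.range n, ε ^ m • c m p + ε ^ n • h (p, ε))
    {p : ℝ → P} (hp : ContinuousAt p 0) {d : ℕ → ℕ → E}
    (hd : ∀ m ≤ n, HasJet (n - m) (fun ε => c m (p ε)) (d m)) :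
    HasJet n (fun ε => f (p ε, ε)) fun i => ∑ m ∈ Finset.range (i + 1), d m (i - m) := by
  refine (HasJet.sum_pow_smul hd).add_isLittleO ?_
  have h1 : ContinuousAt (fun ε : ℝ => h (p ε, ε) - h (p ε, 0)) 0 :=
    ContinuousAt.sub (hh.continuousAt.comp (hp.prodMk continuousAt_id))
      (hh.continuousAt.comp (hp.prodMk continuousAt_const))
  have h2 := isLittleO_pow_smul (by simpa using h1.tendsto) n
  refine h2.congr_left fun ε => ?_
  rw [hf, Finset.sum_range_succ, hhc, smul_sub]
  abel

/-- A Taylor expansion with continuous remainder, as provided by `exists_taylor_snd`, gives jets. -/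
theorem HasJet.of_taylor {P E : Type*} [NormedAddCommGroup P] [NormedSpace ℝ P]
    [NormedAddCommGroup E] [NormedSpace ℝ E] {n : ℕ} {c : ℕ → P → E} {f h : P × ℝ → E}
    (hh : Continuous h) (hhc : ∀ p, h (p, 0) = c n p)
    (hf : ∀ p ε, f (p, ε) = ∑ m ∈ Finset.range n, ε ^ m • c m p + ε ^ n • h (p, ε)) (p : P) :
    HasJet n (fun ε => f (p, ε)) fun i => c i p := by
  have h1 : Continuous fun ε : ℝ => h (p, ε) - h (p, 0) := by fun_prop
  refine (isLittleO_pow_smul (by simpa using h1.tendsto 0) n).congr_left fun ε => ?_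
  simp only [hf p ε, Finset.sum_range_succ, smul_sub, hhc]
  abel

/-! ### Symmetry of higher derivatives and the formula of Faà di Bruno -/

/-- The iterated derivative of a `C^n` function of real variables is symmetric. -/
theorem ContDiff.iteratedFDeriv_comp_perm {E F : Type*} [NormedAddCommGroup E] [NormedSpace ℝ E]
    [NormedAddCommGroup F] [NormedSpace ℝ F] {n : ℕ} {g : E → F} (hg : ContDiff ℝ n g) {l : ℕ}
    (hl : l ≤ n) (x : E) (v : Fin l → E) (σ : Equiv.Perm (Fin l)) :
    iteratedFDeriv ℝ l g x (v ∘ σ) = iteratedFDeriv ℝ l g x v := by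
  induction l generalizing x with
  | zero => exact congrArg _ (Subsingleton.elim _ _)
  | succ l ih =>
    have hσ : σ ∈ Submonoid.closure
        (range fun i : Fin l => Equiv.swap i.castSucc i.succ) := by
      rw [Equiv.Perm.mclosure_swap_castSucc_succ]
      trivial
    induction hσ using Submonoid.closure_induction generalizing v with
    | one => rfl
    | mul σ τ _ _ h1 h2 =>
      have := h2 (v ∘ σ)
      rw [h1] at this
      exact this
    | mem σ hσ =>
      obtain ⟨i, rfl⟩ := hσ
      have hdiff : ∀ m < n, Differentiable ℝ (iteratedFDeriv ℝ m g) := fun m hm =>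
        hg.differentiable_iteratedFDeriv (by exact_mod_cast hm)
      -- `D^{l+1} g(x) v` is the derivative of `y ↦ D^l g(y) (tail v)` in the direction `v 0`
      have hleft : ∀ m < n, ∀ (x : E) (w : Fin (m + 1) → E), iteratedFDeriv ℝ (m + 1) g x w =
          fderiv ℝ (fun y => iteratedFDeriv ℝ m g y (Fin.tail w)) x (w 0) := by
        intro m hm x w
        rw [iteratedFDeriv_succ_apply_left]
        have h1 := (hdiff m hm x).hasFDerivAt
        have h2 := ((ContinuousMultilinearMap.apply ℝ (fun _ : Fin m => E) F
          (Fin.tail w)).hasFDerivAt).comp x h1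
        exact (DFunLike.congr_fun h2.fderiv (w 0)).symm
      rw [hleft l hl, hleft l hl]
      cases l with
      | zero => exact i.elim0
      | succ l =>
        refine Fin.cases ?_ (fun j => ?_) i
        · -- the first two arguments: symmetry of the second derivative of `D^l g`
          have h2 : ContDiff ℝ 2 (iteratedFDeriv ℝ l g) := by
            refine hg.iteratedFDeriv_right ?_
            norm_cast
            omega
          have hsymm := h2.contDiffAt.isSymmSndFDerivAt (x := x) (by simp)
          have hsnd : ∀ w : Fin (l + 2) → E,
              fderiv ℝ (fun y => iteratedFDeriv ℝ (l + 1) g y (Fin.tail w)) x (w 0) =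
              (fderiv ℝ (fderiv ℝ (iteratedFDeriv ℝ l g)) x (w 0)) (w 1)
                (Fin.tail (Fin.tail w)) := by
            intro w
            have h3 : (fun y => iteratedFDeriv ℝ (l + 1) g y (Fin.tail w)) = fun y =>
                fderiv ℝ (iteratedFDeriv ℝ l g) y (w 1) (Fin.tail (Fin.tail w)) := rfl
            rw [h3]
            have h4 := ((h2.fderiv_right (m := 1) (by norm_num)).differentiable one_ne_zero
              x).hasFDerivAt
            have h5 := ((ContinuousMultilinearMap.apply ℝ (fun _ : Fin l => E) F
              (Fin.tail (Fin.tail w))).hasFDerivAt).comp x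
              (((ContinuousLinearMap.apply ℝ _ (w 1)).hasFDerivAt).comp x h4)
            exact DFunLike.congr_fun h5.fderiv (w 0)
          rw [hsnd, hsnd]
          have e0 : (v ∘ Equiv.swap (Fin.castSucc (0 : Fin (l + 1))) (Fin.succ 0)) 0 = v 1 := by
            simp
          have e1 : (v ∘ Equiv.swap (Fin.castSucc (0 : Fin (l + 1))) (Fin.succ 0)) 1 = v 0 := by
            simp
          have e2 : Fin.tail (Fin.tail
              (v ∘ Equiv.swap (Fin.castSucc (0 : Fin (l + 1))) (Fin.succ 0))) =
              Fin.tail (Fin.tail v) := by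
            funext r
            simp only [Fin.tail, Function.comp_apply]
            congr 1
          rw [e0, e1, e2, hsymm]
        · -- the first argument is fixed
          have e0 : (v ∘ Equiv.swap (Fin.castSucc (Fin.succ j)) (Fin.succ (Fin.succ j))) 0 =
              v 0 := by
            simp only [Function.comp_apply]
            congr 1
          have e1 : Fin.tail
              (v ∘ Equiv.swap (Fin.castSucc (Fin.succ j)) (Fin.succ (Fin.succ j))) =
              Fin.tail v ∘ Equiv.swap (Fin.castSucc j) (Fin.succ j) := by
            funext r
            simp only [Fin.tail, Function.comp_apply]
            congr 1
            rw [← Fin.succ_castSucc, (Fin.succ_injective _).swap_apply]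
          rw [e0, e1]
          simp only [ih (by omega)]

/-- The number of ways to arrange a list in which the value `m` occurs `b m` times. -/
theorem card_filter_card_fiber_mul_prod_factorial {q : ℕ} (b : Fin q → ℕ) :
    (Finset.univ.filter fun w : Fin (∑ m, b m) → Fin q =>
      ∀ m, Fintype.card {r // w r = m} = b m).card * ∏ m, (b m)! = (∑ m, b m)! := by
  classical
  set w₀ : Fin (∑ m, b m) → Fin q := fun r => ((finSigmaFinEquiv (n := b)).symm r).1 with hw₀
  have hfib : ∀ m, Fintype.card {r // w₀ r = m} = b m := fun m => by
    have e : {r // w₀ r = m} ≃ Fin (b m) :=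
      ((finSigmaFinEquiv (n := b)).symm.subtypeEquiv fun r => Iff.rfl).trans
        (Equiv.sigmaSubtype m)
    rw [Fintype.card_congr e, Fintype.card_fin]
  have h1 : (Finset.univ : Finset (Equiv.Perm (Fin (∑ m, b m)))).card = (∑ m, b m)! := by
    rw [Finset.card_univ, Fintype.card_perm, Fintype.card_fin]
  have h5 := Finset.card_eq_sum_card_fiberwise
    (s := (Finset.univ : Finset (Equiv.Perm (Fin (∑ m, b m)))))
    (f := fun σ : Equiv.Perm (Fin (∑ m, b m)) => w₀ ∘ σ)
    (t := Finset.univ.filter fun w : Fin (∑ m, b m) → Fin q =>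
      ∀ m, Fintype.card {r // w r = m} = b m) ?_
  · rw [← h1, h5]
    refine (Finset.sum_const_nat ?_).symm
    intro w hw
    have hw' := (Finset.mem_filter.1 hw).2
    -- a permutation carrying `w₀` to `w`; the others differ from it by the stabilizer of `w₀`
    let σ₀ : Equiv.Perm (Fin (∑ m, b m)) := Equiv.ofFiberEquiv (f := w) (g := w₀) fun m =>
      Fintype.equivOfCardEq (by rw [hw', hfib])
    have hσ₀ : w₀ ∘ σ₀ = w := funext fun r => Equiv.ofFiberEquiv_map _ r
    have h2 := DomMulAct.stabilizer_card w₀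
    rw [Fintype.card_subtype] at h2
    simp only [hfib] at h2
    rw [← h2]
    refine Finset.card_bij' (fun σ _ => σ * σ₀⁻¹) (fun τ _ => τ * σ₀) ?_ ?_ ?_ ?_
    · intro σ hσ
      have hσ' : w₀ ∘ σ = w := by simpa using hσ
      simp only [Finset.mem_filter, Finset.mem_univ, true_and]
      funext r
      have h3 := congrFun (hσ'.trans hσ₀.symm) (σ₀⁻¹ r)
      simpa using h3
    · intro τ hτ
      have hτ' : w₀ ∘ τ = w₀ := by simpa using hτ
      simp only [Finset.mem_filter, Finset.mem_univ, true_and]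
      rw [← hσ₀]
      funext r
      exact congrFun hτ' (σ₀ r)
    · intro σ _
      simp
    · intro τ _
      simp
  · intro σ _
    simp only [Finset.coe_filter, Finset.mem_univ, true_and, mem_ofPred_eq]
    intro m
    rw [← hfib m]
    exact Fintype.card_congr (σ.subtypeEquiv fun r => Iff.rfl)

/-- Sums over compositions, sorted by the multiplicities of the parts. -/
theorem sum_posTuples_eq_sum_faaTuples {E F : Type*} [AddCommGroup F] [Module ℝ F] (q : ℕ)
    (v : ℕ → E) (f : ∀ l : ℕ, (Fin l → E) → F)
    (hf : ∀ l ≤ q, ∀ (v : Fin l → E) (σ : Equiv.Perm (Fin l)), f l (v ∘ σ) = f l v) :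
    ∑ l ∈ Finset.range (q + 1), (1 / (l ! : ℝ)) • ∑ w ∈ posTuples q l, f l (fun r => v (w r)) =
    ∑ b ∈ faaTuples q, (1 / ∏ m : Fin q, ((b m)! : ℝ)) •
      f (∑ m, b m) (fun r => v (((finSigmaFinEquiv (n := b)).symm r).1 + 1)) := by
  classical
  let cnt : ∀ {l : ℕ}, (Fin l → Fin q) → Fin q → ℕ := fun w m => Fintype.card {r // w r = m}
  have hcnt : ∀ {l : ℕ} (w : Fin l → Fin q) (g : Fin q → ℕ),
      ∑ r, g (w r) = ∑ m, g m * cnt w m := by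
    intro l w g
    rw [← Finset.sum_fiberwise Finset.univ w]
    refine Finset.sum_congr rfl fun m _ => ?_
    rw [Finset.sum_congr rfl fun r hr => by rw [(Finset.mem_filter.1 hr).2], Finset.sum_const,
      smul_eq_mul, mul_comm]
    congr 1
    exact (Fintype.card_subtype _).symm
  have hcard : ∀ {l : ℕ} (w : Fin l → Fin q), ∑ m, cnt w m = l := by
    intro l w
    have := hcnt w fun _ => 1
    simpa using this.symm
  have hsum_le : ∀ b ∈ faaTuples q, ∑ m, b m ≤ q := by
    intro b hb
    have h1 := (Finset.mem_filter.1 hb).2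
    refine le_trans (Finset.sum_le_sum fun m _ => ?_) h1.le
    exact Nat.le_mul_of_pos_left _ (Nat.succ_pos _)
  have hLHS : ∀ l, ∑ w ∈ posTuples q l, f l (fun r => v (w r)) =
      ∑ b ∈ faaTuples q, ∑ w : Fin l → Fin q with cnt w = b, f l (fun r => v (w r + 1)) := by
    intro l
    have h1 : ∑ w ∈ posTuples q l, f l (fun r => v (w r)) =
        ∑ w : Fin l → Fin q with ∑ r, ((w r : ℕ) + 1) = q, f l (fun r => v (w r + 1)) := by
      symm
      refine Finset.sum_bij (fun w _ r => (w r : ℕ) + 1) ?_ ?_ ?_ ?_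
      · intro w hw
        have := (Finset.mem_filter.1 hw).2
        simp only [posTuples, Finset.mem_filter, Fintype.mem_piFinset, Finset.mem_Icc]
        exact ⟨fun r => ⟨Nat.succ_pos _, (w r).2⟩, this⟩
      · intro w _ w' _ h
        funext r
        have := congrFun h r
        exact Fin.ext (Nat.succ_injective this)
      · intro w hw
        simp only [posTuples, Finset.mem_filter, Fintype.mem_piFinset, Finset.mem_Icc] at hw
        have hw' : ∀ r, w r - 1 + 1 = w r := fun r => by have := (hw.1 r).1; omega
        refine ⟨fun r => ⟨w r - 1, by have := hw.1 r; omega⟩, ?_, ?_⟩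
        · simp [hw', hw.2]
        · funext r
          exact hw' r
      · intro w _
        rfl
    rw [h1, ← Finset.sum_fiberwise_of_maps_to (g := cnt) (t := faaTuples q)]
    · refine Finset.sum_congr rfl fun b hb => Finset.sum_congr ?_ fun _ _ => rfl
      ext w
      simp only [Finset.mem_filter, Finset.mem_univ, true_and, and_iff_right_iff_imp]
      rintro rfl
      rw [hcnt w fun m => (m : ℕ) + 1]
      exact (Finset.mem_filter.1 hb).2
    · intro w hw
      have hw' := (Finset.mem_filter.1 hw).2
      rw [hcnt w fun m => (m : ℕ) + 1] at hw'
      simp only [faaTuples, Finset.mem_filter, Fintype.mem_piFinset, Finset.mem_range]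
      refine ⟨fun m => ?_, hw'⟩
      have h2 := Finset.single_le_sum (f := fun m : Fin q => ((m : ℕ) + 1) * cnt w m)
          (fun _ _ => Nat.zero_le _) (Finset.mem_univ m)
      rw [hw'] at h2
      exact Nat.lt_succ_of_le ((Nat.le_mul_of_pos_left _ (Nat.succ_pos _)).trans h2)
  simp only [hLHS, Finset.smul_sum (s := faaTuples q)]
  rw [Finset.sum_comm]
  refine Finset.sum_congr rfl fun b hb => ?_
  rw [Finset.sum_eq_single (∑ m, b m)]
  · have hconst : ∀ w ∈ (Finset.univ.filter fun w : Fin (∑ m, b m) → Fin q => cnt w = b),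
        f (∑ m, b m) (fun r => v (w r + 1)) =
        f (∑ m, b m) (fun r => v (((finSigmaFinEquiv (n := b)).symm r).1 + 1)) := by
      intro w hw
      have hw' := (Finset.mem_filter.1 hw).2
      let σ : Equiv.Perm (Fin (∑ m, b m)) := Equiv.ofFiberEquiv (f := w)
        (g := fun r => ((finSigmaFinEquiv (n := b)).symm r).1) fun m =>
          (Fintype.equivOfCardEq (β := Fin (b m))
            (by rw [Fintype.card_fin]; exact congrFun hw' m)).trans
          (((finSigmaFinEquiv (n := b)).symm.subtypeEquiv fun r => Iff.rfl).trans
            (Equiv.sigmaSubtype m)).symm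
      have hσ : ∀ r, ((finSigmaFinEquiv (n := b)).symm (σ r)).1 = w r := fun r =>
        Equiv.ofFiberEquiv_map (f := w)
          (g := fun r => ((finSigmaFinEquiv (n := b)).symm r).1) _ r
      rw [← hf _ (hsum_le b hb) (fun r => v (((finSigmaFinEquiv (n := b)).symm r).1 + 1)) σ]
      congr 1
      funext r
      simp only [Function.comp_apply, hσ]
    rw [Finset.sum_congr rfl hconst, Finset.sum_const, ← Nat.cast_smul_eq_nsmul ℝ, smul_smul]
    congr 1
    have h3 := card_filter_card_fiber_mul_prod_factorial b
    have h4 : (Finset.univ.filter fun w : Fin (∑ m, b m) → Fin q => cnt w = b) =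
        Finset.univ.filter fun w : Fin (∑ m, b m) → Fin q =>
          ∀ m, Fintype.card {r // w r = m} = b m := by
      ext w
      simp only [Finset.mem_filter, Finset.mem_univ, true_and, funext_iff, cnt]
    rw [h4, ← h3]
    have h5 : (∏ m, ((b m)! : ℝ)) ≠ 0 := Finset.prod_ne_zero_iff.2 fun m _ => by positivity
    have h6 : ((∑ m, b m)! : ℝ) ≠ 0 := by positivity
    rw [← h3] at h6
    push_cast at h6 ⊢
    have h7 := left_ne_zero_of_mul h6
    field_simp
  · intro l _ hl
    rw [Finset.sum_eq_zero, smul_zero]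
    intro w hw
    refine absurd ?_ hl
    rw [← (Finset.mem_filter.1 hw).2, hcard]
  · intro h
    exact absurd (Finset.mem_range.2 (Nat.lt_succ_of_le (hsum_le b hb))) h

theorem iteratedDeriv_comp_add_smul {E F : Type*} [NormedAddCommGroup E] [NormedSpace ℝ E]
    [NormedAddCommGroup F] [NormedSpace ℝ F] {n : ℕ} {g : E → F} (hg : ContDiff ℝ n g) (x p : E)
    {i : ℕ} (hi : i ≤ n) :
    iteratedDeriv i (fun ε : ℝ => g (x + ε • p)) 0 = iteratedFDeriv ℝ i g x fun _ => p := by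
  have h1 : ContDiff ℝ n fun y => g (x + y) := hg.comp (contDiff_const.add contDiff_id)
  have h2 := (ContinuousLinearMap.toSpanSingleton ℝ p).iteratedFDeriv_comp_right h1 0
    (i := i) (by exact_mod_cast hi)
  rw [iteratedDeriv_eq_iteratedFDeriv]
  have h3 : (fun ε : ℝ => g (x + ε • p)) =
      (fun y => g (x + y)) ∘ ContinuousLinearMap.toSpanSingleton ℝ p := by
    funext ε
    simp
  rw [h3, h2]
  simp [iteratedFDeriv_comp_add_left]

/-- The jet of a multilinear map evaluated on the diagonal along a polynomial curve without constant
term. -/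
theorem HasJet.multilinear_polynomial {E F : Type*} [NormedAddCommGroup E] [NormedSpace ℝ E]
    [NormedAddCommGroup F] [NormedSpace ℝ F] (n l : ℕ)
    (M : ContinuousMultilinearMap ℝ (fun _ : Fin l => E) F) (c : ℕ → E) :
    HasJet n (fun ε => M fun _ => ∑ m ∈ Finset.Icc 1 n, ε ^ m • c m)
      fun q => ∑ w ∈ posTuples q l, M fun r => c (w r) := by
  have h1 : ∀ ε : ℝ, (M fun _ => ∑ m ∈ Finset.Icc 1 n, ε ^ m • c m) =
      ∑ w ∈ Fintype.piFinset fun _ : Fin l => Finset.Icc 1 n,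
        ε ^ (∑ r, w r) • M fun r => c (w r) := by
    intro ε
    rw [M.map_sum_finset (fun _ m => ε ^ m • c m) fun _ => Finset.Icc 1 n]
    refine Finset.sum_congr rfl fun w _ => ?_
    rw [M.map_smul_univ (fun r => ε ^ w r) fun r => c (w r), Finset.prod_pow_eq_pow_sum]
  simp only [h1]
  refine (HasJet.sum _ fun w _ => HasJet.pow_smul_const n _ _).congr_coeff fun q hq => ?_
  rw [← Finset.sum_filter]
  refine Finset.sum_congr ?_ fun _ _ => rfl
  ext w
  simp only [posTuples, Finset.mem_filter, Fintype.mem_piFinset, Finset.mem_Icc]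
  refine and_congr_left fun hw => forall_congr' fun r => and_congr_right fun _ => ?_
  have : w r ≤ q := hw ▸ Finset.single_le_sum (fun _ _ => Nat.zero_le _) (Finset.mem_univ r)
  exact ⟨fun _ => this, fun _ => this.trans hq⟩

/-- The jet of a composition, with the coefficients written as sums over compositions of `q`. -/
theorem HasJet.comp_contDiffAt {E F : Type u} [NormedAddCommGroup E] [NormedSpace ℝ E]
    [FiniteDimensional ℝ E] [NormedAddCommGroup F] [NormedSpace ℝ F] [CompleteSpace F] {n : ℕ}
    {γ : ℝ → E} {c : ℕ → E} (hγ : HasJet n γ c) {g : E → F} (hg : ContDiffAt ℝ n g (c 0)) :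
    HasJet n (fun ε => g (γ ε)) fun q => ∑ l ∈ Finset.range (q + 1), (1 / (l ! : ℝ)) •
      ∑ w ∈ posTuples q l, iteratedFDeriv ℝ l g (c 0) fun r => c (w r) := by
  -- it suffices to treat functions that are smooth on the whole space
  suffices H : ∀ G : E → F, ContDiff ℝ n G → HasJet n (fun ε => G (γ ε)) fun q =>
      ∑ l ∈ Finset.range (q + 1), (1 / (l ! : ℝ)) •
        ∑ w ∈ posTuples q l, iteratedFDeriv ℝ l G (c 0) fun r => c (w r) by
    obtain ⟨G, hG, hGg⟩ := hg.exists_contDiff_eventuallyEq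
    refine ((H G hG).congr_fun (hγ.tendsto.eventually hGg)).congr_coeff fun q _ => ?_
    refine Finset.sum_congr rfl fun l _ => ?_
    rw [(hGg.iteratedFDeriv ℝ l).eq_of_nhds]
  intro G hG
  cases n with
  | zero =>
    unfold HasJet
    have h1 : Tendsto (fun ε => G (γ ε)) (𝓝 0) (𝓝 (G (c 0))) :=
      (hG.continuous.tendsto _).comp hγ.tendsto
    simpa [Asymptotics.isLittleO_one_iff, tendsto_sub_nhds_zero_iff, posTuples] using h1
  | succ n =>
    -- the polynomial part of the curve, `c₀ + ε p(ε)`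
    let p : ℝ → E := fun ε => ∑ m ∈ Finset.range (n + 1), ε ^ m • c (m + 1)
    have hp : Continuous p := by fun_prop
    have hpoly : ∀ ε : ℝ, ∑ i ∈ Finset.range (n + 1 + 1), ε ^ i • c i = c 0 + ε • p ε := by
      intro ε
      rw [Finset.sum_range_succ', Finset.smul_sum]
      simp only [smul_smul, ← pow_succ', pow_zero, one_smul]
      rw [add_comm]
    have hpIcc : ∀ ε : ℝ, ε • p ε = ∑ m ∈ Finset.Icc 1 (n + 1), ε ^ m • c m := by
      intro ε
      have h1 : Finset.Icc 1 (n + 1) = Finset.Ico 1 (n + 1 + 1) := by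
        ext m
        simp only [Finset.mem_Icc, Finset.mem_Ico]
        omega
      rw [Finset.smul_sum, h1, Finset.sum_Ico_eq_sum_range]
      refine Finset.sum_congr rfl fun m _ => ?_
      rw [smul_smul, ← pow_succ', add_comm 1 m]
    have hγp : (fun ε => γ ε - (c 0 + ε • p ε)) =o[𝓝 0] fun ε : ℝ => ε ^ (n + 1) := by
      refine Asymptotics.IsLittleO.congr_left hγ fun ε => ?_
      rw [hpoly]
    have hGp : (fun ε => G (γ ε) - G (c 0 + ε • p ε)) =o[𝓝 0] fun ε : ℝ => ε ^ (n + 1) := by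
      have h1 := ((hG.hasStrictFDerivAt (x := c 0) (by simp)).isBigO_sub).comp_tendsto
        (k := fun ε : ℝ => (γ ε, c 0 + ε • p ε)) (l' := 𝓝 0) ?_
      · exact h1.trans_isLittleO hγp
      · have h2 : Tendsto (fun ε => c 0 + ε • p ε) (𝓝 0) (𝓝 (c 0)) := by
          have : Continuous fun ε => c 0 + ε • p ε := by fun_prop
          simpa using this.tendsto 0
        exact hγ.tendsto.prodMk_nhds h2
    refine HasJet.add_isLittleO ?_ hGp
    let f : E × ℝ → F := fun z => G (c 0 + z.2 • z.1)
    have hf : ContDiff ℝ (n + 1 : ℕ) f :=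
      hG.comp (contDiff_const.add (contDiff_snd.smul contDiff_fst))
    obtain ⟨d, hd⟩ := exists_taylor_snd hf
    -- the Taylor coefficients of `f(p, ·)` are the derivatives of `G` on the diagonal
    have hcoef : ∀ i ≤ n + 1, ∀ p, d i p =
        (1 / (i ! : ℝ)) • iteratedFDeriv ℝ i G (c 0) fun _ => p := by
      intro i hi p
      obtain ⟨-, h, hh, hh0, hfh⟩ := hd (n + 1) le_rfl
      have h1 : HasJet (n + 1) (fun ε => f (p, ε)) fun i => d i p :=
        HasJet.of_taylor hh.continuous hh0 hfh p
      have h2 : ContDiff ℝ (n + 1 : ℕ) fun ε : ℝ => f (p, ε) := hf.comp (contDiff_prodMk_right p)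
      rw [h1.unique h2.contDiffAt.hasJet i hi, iteratedDeriv_comp_add_smul hG _ _ hi]
    obtain ⟨-, h, hh, hh0, hfh⟩ := hd (n + 1) le_rfl
    have hmain : HasJet (n + 1) (fun ε => ∑ l ∈ Finset.range (n + 1 + 1), (1 / (l ! : ℝ)) •
        iteratedFDeriv ℝ l G (c 0) fun _ => ∑ m ∈ Finset.Icc 1 (n + 1), ε ^ m • c m) fun q =>
        ∑ l ∈ Finset.range (q + 1), (1 / (l ! : ℝ)) •
          ∑ w ∈ posTuples q l, iteratedFDeriv ℝ l G (c 0) fun r => c (w r) := by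
      refine (HasJet.sum _ fun l _ => (HasJet.multilinear_polynomial (n + 1) l
        (iteratedFDeriv ℝ l G (c 0)) c).const_smul (1 / (l ! : ℝ))).congr_coeff fun q hq => ?_
      symm
      refine Finset.sum_subset (Finset.range_subset_range.2 (by omega)) fun l _ hl => ?_
      -- there are no compositions of `q` with more than `q` parts
      have hl' : q < l := by simpa using hl
      have : posTuples q l = ∅ := by
        refine Finset.eq_empty_of_forall_notMem fun w hw => ?_
        simp only [posTuples, Finset.mem_filter, Fintype.mem_piFinset, Finset.mem_Icc] at hw
        have h1 : ∑ _r : Fin l, 1 ≤ ∑ r, w r := Finset.sum_le_sum fun r _ => (hw.1 r).1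
        simp only [Finset.sum_const, Finset.card_univ, Fintype.card_fin, smul_eq_mul, mul_one] at h1
        omega
      rw [this, Finset.sum_empty, smul_zero]
    refine hmain.add_isLittleO ?_
    have h2 : Continuous fun ε : ℝ => h (p ε, ε) - h (p ε, 0) := by
      have := hh.continuous
      fun_prop
    have h3 := HasJet.isLittleO_pow_smul (by simpa using h2.tendsto 0) (n + 1)
    refine h3.congr_left fun ε => ?_
    have h4 : G (c 0 + ε • p ε) = f (p ε, ε) := rfl
    have h5 : ∀ l ∈ Finset.range (n + 1 + 1), ((1 / (l ! : ℝ)) •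
        iteratedFDeriv ℝ l G (c 0) fun _ => ∑ m ∈ Finset.Icc 1 (n + 1), ε ^ m • c m) =
        ε ^ l • d l (p ε) := by
      intro l hl
      rw [hcoef l (Nat.lt_succ_iff.1 (Finset.mem_range.1 hl)), ← hpIcc,
        (iteratedFDeriv ℝ l G (c 0)).map_smul_univ (fun _ => ε) fun _ => p ε, smul_comm]
      simp
    rw [h4, hfh, Finset.sum_congr rfl h5, Finset.sum_range_succ _ (n + 1), smul_sub, hh0]
    abel

/-- **Formula of Faà di Bruno** in terms of multiplicities. -/
theorem sum_posTuples_iteratedFDeriv {E F : Type*} [NormedAddCommGroup E] [NormedSpace ℝ E]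
    [FiniteDimensional ℝ E] [NormedAddCommGroup F] [NormedSpace ℝ F] {n : ℕ} {g : E → F} {x : E}
    (hg : ContDiffAt ℝ n g x) {q : ℕ} (hq : q ≤ n) {c v : ℕ → E}
    (hv : ∀ m, 1 ≤ m → m ≤ q → v m = (m ! : ℝ) • c m) :
    ∑ l ∈ Finset.range (q + 1), (1 / (l ! : ℝ)) •
      ∑ w ∈ posTuples q l, (iteratedFDeriv ℝ l g x fun r => c (w r)) =
    ∑ b ∈ faaTuples q, faaCoeff b • faaDeriv b g x v := by
  obtain ⟨G, hG, hGg⟩ := hg.exists_contDiff_eventuallyEq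
  rw [sum_posTuples_eq_sum_faaTuples q c fun l v => iteratedFDeriv ℝ l g x v]
  · refine Finset.sum_congr rfl fun b _ => ?_
    unfold faaDeriv faaCoeff
    have h1 : (fun r => v (((finSigmaFinEquiv (n := b)).symm r).1 + 1)) = fun r =>
        (((((finSigmaFinEquiv (n := b)).symm r).1 + 1 : ℕ)! : ℝ)) •
          c (((finSigmaFinEquiv (n := b)).symm r).1 + 1) := by
      funext r
      exact hv _ (Nat.succ_pos _) ((finSigmaFinEquiv (n := b)).symm r).1.2
    rw [h1, ContinuousMultilinearMap.map_smul_univ, smul_smul]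
    congr 1
    have h2 : ∏ r : Fin (∑ m, b m),
        ((((finSigmaFinEquiv (n := b)).symm r).1 + 1 : ℕ)! : ℝ) =
        ∏ m : Fin q, (((m : ℕ) + 1)! : ℝ) ^ b m := by
      rw [← Equiv.prod_comp (finSigmaFinEquiv (n := b)), Fintype.prod_sigma]
      simp
    rw [h2, Finset.prod_mul_distrib]
    have h3 : (∏ m : Fin q, ((b m)! : ℝ)) ≠ 0 := Finset.prod_ne_zero_iff.2 fun m _ => by positivity
    have h4 : (∏ m : Fin q, (((m : ℕ) + 1)! : ℝ) ^ b m) ≠ 0 :=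
      Finset.prod_ne_zero_iff.2 fun m _ => by positivity
    field_simp
  · intro l hl v σ
    have h1 : iteratedFDeriv ℝ l g x = iteratedFDeriv ℝ l G x :=
      (hGg.iteratedFDeriv ℝ l).eq_of_nhds.symm
    rw [h1]
    exact hG.iteratedFDeriv_comp_perm (hl.trans hq) x v σ

/-! ### The recursion of the Melnikov functions computes jets -/

theorem strongSeq_eq {β : Type*} [Zero β] (step : ℕ → (ℕ → β) → β) (n : ℕ) :
    strongSeq step n = step n fun m => if m < n then strongSeq step m else 0 := by
  rw [strongSeq]
  rfl

theorem posTuples_succ_zero {q : ℕ} (hq : 1 ≤ q) : posTuples q 0 = ∅ := by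
  refine Finset.eq_empty_of_forall_notMem fun w hw => ?_
  simp only [posTuples, Finset.mem_filter, Finset.univ_eq_empty, Finset.sum_empty] at hw
  omega

theorem sum_range_succ_eq_sum_Icc_of_zero {M : Type*} [AddCommMonoid M] (f : ℕ → M) (q : ℕ)
    (h : f 0 = 0) : ∑ l ∈ Finset.range (q + 1), f l = ∑ l ∈ Finset.Icc 1 q, f l := by
  symm
  refine Finset.sum_subset (fun l hl => ?_) fun l hl hl' => ?_
  · rw [Finset.mem_Icc] at hl
    rw [Finset.mem_range]
    omega
  · have : l = 0 := by
      rw [Finset.mem_Icc] at hl'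
      rw [Finset.mem_range] at hl
      omega
    rw [this, h]

theorem sum_faaTuples_zero {E F : Type*} [NormedAddCommGroup E] [NormedSpace ℝ E]
    [NormedAddCommGroup F] [NormedSpace ℝ F] (g : E → F) (x : E) (v : ℕ → E) :
    ∑ b ∈ faaTuples 0, faaCoeff b • faaDeriv b g x v = g x := by
  have h : faaTuples 0 = {fun m => m.elim0} := by
    ext b
    simp only [faaTuples, Finset.mem_filter, Fintype.mem_piFinset, Finset.mem_singleton]
    exact ⟨fun _ => funext fun m => m.elim0, fun _ => ⟨fun m => m.elim0, by simp⟩⟩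
  rw [h, Finset.sum_singleton]
  have h1 : faaCoeff (fun m : Fin 0 => (m.elim0 : ℕ)) = 1 := by simp [faaCoeff]
  have h2 : faaDeriv (fun m : Fin 0 => (m.elim0 : ℕ)) g x v = iteratedFDeriv ℝ 0 g x
      (fun r => v (((finSigmaFinEquiv (n := fun m : Fin 0 => (m.elim0 : ℕ))).symm r).1 + 1)) := rfl
  rw [h1, h2, one_smul, iteratedFDeriv_zero_apply]

theorem prod_finSigmaFinEquiv {l : ℕ} (b : Fin l → ℕ) (v : ℕ → ℝ) :
    ∏ r : Fin (∑ m, b m), v (((finSigmaFinEquiv (n := b)).symm r).1 + 1) =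
      ∏ m : Fin l, v ((m : ℕ) + 1) ^ b m := by
  rw [← Equiv.prod_comp (finSigmaFinEquiv (n := b)), Fintype.prod_sigma]
  simp

theorem faaDeriv_real {F : Type*} [NormedAddCommGroup F] [NormedSpace ℝ F] {l : ℕ}
    (b : Fin l → ℕ) (g : ℝ → F) (t : ℝ) (v : ℕ → ℝ) :
    faaDeriv b g t v =
      (∏ m : Fin l, v ((m : ℕ) + 1) ^ b m) • iteratedDeriv (∑ m, b m) g t := by
  unfold faaDeriv
  rw [iteratedFDeriv_apply_eq_iteratedDeriv_mul_prod, prod_finSigmaFinEquiv]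

theorem HasJet.smul_id {E : Type*} [NormedAddCommGroup E] [NormedSpace ℝ E] {n : ℕ} {f : ℝ → E}
    {c c' : ℕ → E} (h : HasJet n f c) (h0 : c' 0 = 0) (hc : ∀ i ≤ n, c' (i + 1) = c i) :
    HasJet (n + 1) (fun ε => ε • f ε) c' := by
  have h1 : (fun ε : ℝ => ε • (f ε - ∑ i ∈ Finset.range (n + 1), ε ^ i • c i)) =o[𝓝 0]
      fun ε : ℝ => ε • ε ^ n := (Asymptotics.isBigO_refl _ _).smul_isLittleO h
  unfold HasJet
  simp only [smul_eq_mul, ← pow_succ'] at h1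
  refine h1.congr_left fun ε => ?_
  rw [Finset.sum_range_succ' _ (n + 1), h0, smul_zero, add_zero, smul_sub, Finset.smul_sum]
  congr 1
  refine Finset.sum_congr rfl fun i hi => ?_
  rw [hc i (Nat.lt_succ_iff.1 (Finset.mem_range.1 hi)), smul_smul, pow_succ']

namespace SwitchedSystem

variable {d : ℕ}

/-- The rescaled right-hand side `F^j / ε = ∑_{i=1}^k ε^{i-1} F_i^j(t,x) + ε^k R^j(t,x,ε)`. -/
def rescaledField (S : SwitchedSystem d) (j : ℕ) (ε t : ℝ) (x : EuclideanSpace ℝ (Fin d)) :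
    EuclideanSpace ℝ (Fin d) :=
  ∑ i ∈ Finset.Icc 1 S.k, ε ^ (i - 1) • S.F i j t x + ε ^ S.k • S.R j t x ε

/-- The integrand of the recursion is a coefficient of the jet of the rescaled right-hand side
along a curve, if `z_m / m!` are the coefficients of the jet of this
curve. -/
theorem hasJet_rescaled_field (S : SwitchedSystem d) {j n : ℕ} (hnk : n + 1 ≤ S.k) {s : ℝ}
    {x : EuclideanSpace ℝ (Fin d)}
    (hF : ∀ i, 1 ≤ i → i ≤ S.k → ContDiffAt ℝ n (S.F i j s) x)
    (hR : ContinuousAt (fun p : EuclideanSpace ℝ (Fin d) × ℝ => S.R j s p.1 p.2) (x, 0))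
    {γ : ℝ → EuclideanSpace ℝ (Fin d)} {c : ℕ → EuclideanSpace ℝ (Fin d)} (hγ : HasJet n γ c)
    (hc0 : c 0 = x) :
    ∃ κ : ℕ → EuclideanSpace ℝ (Fin d),
      HasJet n (fun ε => S.rescaledField j ε s (γ ε)) κ ∧
      ∀ i ≤ n, ∀ z : ℕ → ℝ → EuclideanSpace ℝ (Fin d) → EuclideanSpace ℝ (Fin d),
        (∀ m, 1 ≤ m → m ≤ i → z m s x = (m ! : ℝ) • c m) →
          S.integrand j (i + 1) z s x = κ i := by
  subst hc0
  have h1 : ∀ m ≤ n, HasJet (n - m) (fun ε => S.F (m + 1) j s (γ ε)) _ := fun m hm =>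
    (hγ.mono (Nat.sub_le n m)).comp_contDiffAt
      ((hF (m + 1) (by omega) (by omega)).of_le (by exact_mod_cast Nat.sub_le n m))
  refine ⟨_, (HasJet.sum_pow_smul h1).add_isLittleO ?_, fun i hi z hz => ?_⟩
  · -- the terms of order higher than `n`
    have hsplit : ∀ ε : ℝ, ∑ i ∈ Finset.Icc 1 S.k, ε ^ (i - 1) • S.F i j s (γ ε) =
        ∑ m ∈ Finset.range (n + 1), ε ^ m • S.F (m + 1) j s (γ ε) +
        ∑ m ∈ Finset.Ico (n + 1) S.k, ε ^ m • S.F (m + 1) j s (γ ε) := by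
      intro ε
      have h2 : Finset.Icc 1 S.k = Finset.Ico 1 (S.k + 1) := by
        ext m
        simp only [Finset.mem_Icc, Finset.mem_Ico]
        omega
      rw [Finset.sum_range_add_sum_Ico _ hnk, h2, Finset.sum_Ico_eq_sum_range]
      refine Finset.sum_congr (by simp) fun m _ => ?_
      rw [Nat.add_sub_cancel_left, add_comm 1 m]
    have hhigh : ∀ m, n + 1 ≤ m → ∀ {u : ℝ → EuclideanSpace ℝ (Fin d)}, ContinuousAt u 0 →
        (fun ε : ℝ => ε ^ m • u ε) =o[𝓝 0] fun ε : ℝ => ε ^ n := by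
      intro m hm u hu
      have h2 : (fun ε : ℝ => ε ^ m) =o[𝓝 0] fun ε : ℝ => ε ^ n :=
        Asymptotics.isLittleO_pow_pow (by omega)
      simpa using h2.smul_isBigO (hu.isBigO_one ℝ)
    have hsum : (fun ε : ℝ => ∑ m ∈ Finset.Ico (n + 1) S.k, ε ^ m • S.F (m + 1) j s (γ ε)) =o[𝓝 0]
        fun ε : ℝ => ε ^ n := by
      refine Asymptotics.IsLittleO.fun_sum fun m hm => ?_
      rw [Finset.mem_Ico] at hm
      refine hhigh m hm.1 ?_
      refine ContinuousAt.comp ?_ hγ.continuousAt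
      rw [hγ.apply_zero]
      exact (hF (m + 1) (by omega) (by omega)).continuousAt
    have hrem : (fun ε : ℝ => ε ^ S.k • S.R j s (γ ε) ε) =o[𝓝 0] fun ε : ℝ => ε ^ n := by
      refine hhigh _ hnk ?_
      refine ContinuousAt.comp (f := fun ε : ℝ => (γ ε, ε))
        (g := fun p : EuclideanSpace ℝ (Fin d) × ℝ => S.R j s p.1 p.2) ?_
        (hγ.continuousAt.prodMk continuousAt_id)
      simp only [hγ.apply_zero]
      exact hR
    refine (hsum.add hrem).congr_left fun ε => ?_
    rw [rescaledField, hsplit]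
    abel
  · have h2 : ∀ m ∈ Finset.range (i + 1), ∑ l ∈ Finset.range (i - m + 1), (1 / (l ! : ℝ)) •
        ∑ w ∈ posTuples (i - m) l, (iteratedFDeriv ℝ l (S.F (m + 1) j s) (c 0) fun r => c (w r)) =
        ∑ b ∈ faaTuples (i - m),
          faaCoeff b • faaDeriv b (S.F (m + 1) j s) (c 0) fun m => z m s (c 0) := by
      intro m hm
      have hm' := Finset.mem_range.1 hm
      exact sum_posTuples_iteratedFDeriv (hF (m + 1) (by omega) (by omega)) (by omega)
        fun q hq hq' => hz q hq (by omega)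
    rw [Finset.sum_congr rfl h2, ← Finset.sum_range_reflect]
    have h3 : ∀ l ∈ Finset.range (i + 1), (∑ b ∈ faaTuples (i - (i + 1 - 1 - l)),
          faaCoeff b • faaDeriv b (S.F (i + 1 - 1 - l + 1) j s) (c 0) fun m => z m s (c 0)) =
        ∑ b ∈ faaTuples l,
          faaCoeff b • faaDeriv b (S.F (i + 1 - l) j s) (c 0) fun m => z m s (c 0) := by
      intro l hl
      have hl' := Finset.mem_range.1 hl
      rw [show i - (i + 1 - 1 - l) = l by omega, show i + 1 - 1 - l + 1 = i + 1 - l by omega]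
    rw [Finset.sum_congr rfl h3, Finset.sum_range_succ', sum_faaTuples_zero]
    refine Eq.trans ?_ (add_comm _ _)
    unfold integrand
    congr 1
    have h4 : Finset.Icc 1 (i + 1 - 1) = Finset.Ico 1 (i + 1) := by
      ext m
      simp only [Finset.mem_Icc, Finset.mem_Ico]
      omega
    rw [h4, Finset.sum_Ico_eq_sum_range]
    refine Finset.sum_congr (by simp) fun l _ => ?_
    rw [add_comm 1 l]

/-- If `C_m` are the coefficients of the jets of the flow of zone `j - 1` and `W`, `A` satisfy the
recursions for the jets of the crossing point and of the crossing time, then the sequences `w` and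
`α` are given by `W` and `A`. -/
theorem wSeq_eq_and_alphaOf_eq (S : SwitchedSystem d) {j n : ℕ} {x : EuclideanSpace ℝ (Fin d)}
    {zp : ℕ → ℝ → EuclideanSpace ℝ (Fin d) → EuclideanSpace ℝ (Fin d)}
    {C : ℕ → ℝ → EuclideanSpace ℝ (Fin d)} {W : ℕ → EuclideanSpace ℝ (Fin d)} {A : ℕ → ℝ}
    (hzp : ∀ m, 1 ≤ m → m ≤ n →
      (fun t => zp m t x) =ᶠ[𝓝 (S.θ j x)] fun t => (m ! : ℝ) • C m t)
    (hA : ∀ q, 1 ≤ q → q ≤ n → A q = ∑ l ∈ Finset.range (q + 1), (1 / (l ! : ℝ)) •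
      ∑ w ∈ posTuples q l, iteratedFDeriv ℝ l (S.θ j) x fun r => W (w r))
    (hW : ∀ i, 1 ≤ i → i ≤ n → W i = C i (S.θ j x) + ∑ a ∈ Finset.Icc 1 (i - 1),
      ∑ b ∈ faaTuples a, faaCoeff b • faaDeriv b (C (i - a)) (S.θ j x) fun q => (q ! : ℝ) • A q) :
    (∀ i, 1 ≤ i → i ≤ n → S.wSeq j zp x i = W i) ∧
      ∀ q, 1 ≤ q → q ≤ n → S.alphaOf j x (S.wSeq j zp x) q = (q ! : ℝ) * A q := by
  have halpha : ∀ w : ℕ → EuclideanSpace ℝ (Fin d), ∀ q, 1 ≤ q → q ≤ n →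
      (∀ m, 1 ≤ m → m ≤ q → w m = W m) → S.alphaOf j x w q = (q ! : ℝ) * A q := by
    intro w q hq hqn hw
    unfold alphaOf
    rw [if_neg (by omega), hA q hq hqn, sum_range_succ_eq_sum_Icc_of_zero _ _ (by
      rw [posTuples_succ_zero hq, Finset.sum_empty, smul_zero]), Finset.mul_sum]
    refine Finset.sum_congr rfl fun l _ => ?_
    rw [smul_eq_mul, ← mul_assoc, mul_one_div]
    congr 1
    refine Finset.sum_congr rfl fun u hu => ?_
    congr 1
    funext r
    simp only [posTuples, Finset.mem_filter, Fintype.mem_piFinset, Finset.mem_Icc] at hu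
    exact hw _ (hu.1 r).1 (hu.1 r).2
  have hmain : ∀ i, 1 ≤ i → i ≤ n → S.wSeq j zp x i = W i := by
    intro i
    induction i using Nat.strong_induction_on with
    | _ i ih =>
      intro hi hin
      unfold wSeq
      rw [strongSeq_eq, hW i hi hin]
      congr 1
      · rw [(hzp i hi hin).eq_of_nhds, smul_smul, one_div_mul_cancel (by positivity), one_smul]
      · refine Finset.sum_congr rfl fun a ha => Finset.sum_congr rfl fun b hb => ?_
        rw [Finset.mem_Icc] at ha
        rw [faaDeriv_real, smul_smul]
        have h1 : iteratedDeriv (∑ m, b m) (fun t => zp (i - a) t x) (S.θ j x) =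
            ((i - a)! : ℝ) • iteratedDeriv (∑ m, b m) (C (i - a)) (S.θ j x) := by
          rw [(hzp (i - a) (by omega) (by omega)).iteratedDeriv_eq]
          exact iteratedDeriv_const_smul_field (n := ∑ m, b m) ((i - a)! : ℝ) (C (i - a))
        have h2 : ∀ m : Fin a, S.alphaOf j x
            (fun m => if m < i then strongSeq (fun i w =>
              (1 / (i ! : ℝ)) • zp i (S.θ j x) x +
              ∑ a ∈ Finset.Icc 1 (i - 1), ∑ b ∈ faaTuples a,
                ((1 / ((i - a)! : ℝ)) * faaCoeff b *
                  ∏ m : Fin a, S.alphaOf j x w ((m : ℕ) + 1) ^ b m) •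
                  iteratedDeriv (∑ m, b m) (fun t => zp (i - a) t x) (S.θ j x)) m else 0)
              ((m : ℕ) + 1) = (((m : ℕ) + 1)! : ℝ) * A ((m : ℕ) + 1) := by
          intro m
          refine halpha _ _ (by omega) (by omega) fun m' hm' hm'' => ?_
          rw [if_pos (by omega)]
          exact ih m' (by omega) hm' (by omega)
        simp only [h2]
        rw [h1, smul_smul]
        simp only [smul_eq_mul]
        congr 1
        have : ((i - a)! : ℝ) ≠ 0 := by positivity
        field_simp
  exact ⟨hmain, fun q hq hqn => halpha _ q hq hqn fun m hm hmq => hmain m hm (hmq.trans hqn)⟩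

end SwitchedSystem

namespace SwitchedSystem

variable {d : ℕ}

/-- The smooth extensions `Y_j(t,ε)` to `(-B, B)` of the pieces of the solution with initial value
`x`, its crossing times `τ_j(ε)`, and smooth extensions `G_j(t,x,ε)` of the rescaled right-hand
sides `F^j / ε`. Everything is required only for `ε` near `0`, depending on the times involved. -/
structure IsPiecewiseFlow (S : SwitchedSystem d) (n : ℕ) (B : ℝ) (x : EuclideanSpace ℝ (Fin d))
    (Y : ℕ → ℝ × ℝ → EuclideanSpace ℝ (Fin d)) (τ : ℕ → ℝ → ℝ)
    (G : ℕ → ℝ × EuclideanSpace ℝ (Fin d) × ℝ → EuclideanSpace ℝ (Fin d)) : Prop where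
  B_pos : 0 < B
  contDiffAt_F : ∀ j ≤ S.N, ∀ i, 1 ≤ i → i ≤ S.k → ∀ t, ContDiffAt ℝ n (S.F i j t) x
  continuousAt_R : ∀ j ≤ S.N, ∀ t, ContinuousAt
    (fun p : EuclideanSpace ℝ (Fin d) × ℝ => S.R j t p.1 p.2) (x, 0)
  contDiffAt_θ : ∀ j < S.N, ContDiffAt ℝ n (S.θ (j + 1)) x
  θ_mem : ∀ j < S.N, S.θ (j + 1) x ∈ Ioo (-B) B
  contDiff_Y : ∀ j ≤ S.N, ContDiff ℝ n (Y j)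
  contDiff_G : ∀ j ≤ S.N, ContDiff ℝ n (G j)
  contDiffAt_τ : ∀ j < S.N, ContDiffAt ℝ n (τ (j + 1)) 0
  Y_zero : ∀ j ≤ S.N, ∀ t, Y j (t, 0) = x
  G_eq : ∀ j ≤ S.N, ∀ t ∈ Ioo (-B) B, ∀ᶠ p : EuclideanSpace ℝ (Fin d) × ℝ in 𝓝 (x, 0),
    G j (t, p.1, p.2) = S.rescaledField j p.2 t p.1
  Y_integral : ∀ j ≤ S.N, ∀ s ∈ Ioo (-B) B, ∀ t ∈ Ioo (-B) B, ∀ᶠ ε in 𝓝 (0 : ℝ),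
    Y j (t, ε) - Y j (s, ε) = ε • ∫ u in s..t, G j (u, Y j (u, ε), ε)
  Y_init : ∀ᶠ ε in 𝓝 (0 : ℝ), Y 0 (0, ε) = x
  τ_eq : ∀ j < S.N, ∀ᶠ ε in 𝓝 (0 : ℝ),
    τ (j + 1) ε = S.θ (j + 1) (Y j (τ (j + 1) ε, ε))
  Y_match : ∀ j < S.N, ∀ᶠ ε in 𝓝 (0 : ℝ),
    Y (j + 1) (τ (j + 1) ε, ε) = Y j (τ (j + 1) ε, ε)

namespace IsPiecewiseFlow

variable {S : SwitchedSystem d} {n : ℕ} {B : ℝ} {x : EuclideanSpace ℝ (Fin d)}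
  {Y : ℕ → ℝ × ℝ → EuclideanSpace ℝ (Fin d)} {τ : ℕ → ℝ → ℝ}
  {G : ℕ → ℝ × EuclideanSpace ℝ (Fin d) × ℝ → EuclideanSpace ℝ (Fin d)}

/-- The integral equations for the coefficients `C_i(t)` of the jets of `Y_j(t, ·)`. -/
theorem exists_coeff_integral_eq (h : S.IsPiecewiseFlow n B x Y τ G) (hn : 1 ≤ n) (hnk : n ≤ S.k)
    {j : ℕ} (hj : j ≤ S.N) {C : ℕ → ℝ → EuclideanSpace ℝ (Fin d)}
    (hC : ∀ t, HasJet n (fun ε => Y j (t, ε)) fun i => C i t) (hC0 : ∀ t, C 0 t = x) :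
    ∃ κ : ℕ → ℝ → EuclideanSpace ℝ (Fin d),
      (∀ i, 1 ≤ i → i ≤ n → ∀ s ∈ Ioo (-B) B, ∀ t ∈ Ioo (-B) B,
        C i t - C i s = ∫ u in s..t, κ i u) ∧
      ∀ i, 1 ≤ i → i ≤ n → ∀ t ∈ Ioo (-B) B,
        ∀ z : ℕ → ℝ → EuclideanSpace ℝ (Fin d) → EuclideanSpace ℝ (Fin d),
        (∀ m, 1 ≤ m → m < i → z m t x = (m ! : ℝ) • C m t) → S.integrand j i z t x = κ i t := by
  have hf : ContDiff ℝ n fun p : ℝ × ℝ => G j (p.1, Y j p, p.2) :=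
    (h.contDiff_G j hj).comp (contDiff_fst.prodMk ((h.contDiff_Y j hj).prodMk contDiff_snd))
  obtain ⟨g, hg⟩ := exists_taylor_snd hf
  obtain ⟨-, r, hr, hr0, hgr⟩ := hg n le_rfl
  refine ⟨fun i => g (i - 1), fun i hi hin s hs t ht => ?_, fun i hi hin t ht z hz => ?_⟩
  · have h1 := HasJet.intervalIntegral (f := fun p : ℝ × ℝ => G j (p.1, Y j p, p.2))
      (fun i hi => (hg i hi).1.continuous) hr.continuous hr0 hgr s t
    have h2 : HasJet n (fun ε => ε • ∫ u in s..t, G j (u, Y j (u, ε), ε))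
        fun i => Nat.casesOn i 0 fun i => ∫ u in s..t, g i u :=
      (h1.smul_id rfl fun i _ => rfl).of_succ
    have h3 := ((hC t).sub (hC s)).congr_fun (h.Y_integral j hj s hs t ht)
    have h4 := h3.unique h2 i hin
    obtain ⟨i, rfl⟩ := Nat.exists_eq_add_of_le' hi
    exact h4
  · have h1 := HasJet.of_taylor (f := fun p : ℝ × ℝ => G j (p.1, Y j p, p.2))
      hr.continuous hr0 hgr t
    obtain ⟨κ, hκ, hκz⟩ := S.hasJet_rescaled_field (j := j) (n := n - 1) (s := t) (by omega)
      (fun i hi hik => (h.contDiffAt_F j hj i hi hik t).of_le (by exact_mod_cast Nat.sub_le n 1))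
      (h.continuousAt_R j hj t) ((hC t).mono (Nat.sub_le n 1)) (hC0 t)
    have h2 : Tendsto (fun ε : ℝ => (Y j (t, ε), ε)) (𝓝 0) (𝓝 (x, 0)) := by
      have := (hC t).tendsto
      rw [hC0] at this
      exact this.prodMk_nhds tendsto_id
    have h3 := (h1.mono (Nat.sub_le n 1)).congr_fun (h2.eventually (h.G_eq j hj t ht))
    have h4 := hκz (i - 1) (by omega) z fun m hm hmi => hz m hm (by omega)
    rw [Nat.sub_add_cancel hi] at h4
    rw [h4]
    exact hκ.unique h3 (i - 1) (by omega)

/-- The relations between the coefficients of the jets of `Y_j` and `Y_{j+1}` at the crossing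
time. -/
theorem coeff_succ_apply_θ (h : S.IsPiecewiseFlow n B x Y τ G) {j : ℕ} (hj : j < S.N)
    {zp z' : ℕ → ℝ → EuclideanSpace ℝ (Fin d) → EuclideanSpace ℝ (Fin d)}
    {C C' : ℕ → ℝ → EuclideanSpace ℝ (Fin d)}
    {r r' : ℝ × ℝ → EuclideanSpace ℝ (Fin d)} (hr : Continuous r) (hr' : Continuous r')
    (hr0 : ∀ t, r (t, 0) = C n t) (hr0' : ∀ t, r' (t, 0) = C' n t)
    (hYr : ∀ t ε, Y j (t, ε) = ∑ m ∈ Finset.range n, ε ^ m • C m t + ε ^ n • r (t, ε))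
    (hYr' : ∀ t ε, Y (j + 1) (t, ε) = ∑ m ∈ Finset.range n, ε ^ m • C' m t + ε ^ n • r' (t, ε))
    (hC : ∀ m ≤ n, ContDiff ℝ (n - m : ℕ) (C m)) (hC' : ∀ m ≤ n, ContDiff ℝ (n - m : ℕ) (C' m))
    (hC0 : ∀ t, C 0 t = x) (hC0' : ∀ t, C' 0 t = x)
    (hzp : ∀ m, 1 ≤ m → m ≤ n → ∀ t ∈ Ioo (-B) B, zp m t x = (m ! : ℝ) • C m t)
    {i : ℕ} (hi : 1 ≤ i) (hin : i ≤ n)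
    (hz' : ∀ m, 1 ≤ m → m < i → ∀ t ∈ Ioo (-B) B, z' m t x = (m ! : ℝ) • C' m t) :
    C' i (S.θ (j + 1) x) = C i (S.θ (j + 1) x) +
      ∑ p ∈ Finset.Icc 1 (i - 1), (1 / (p ! : ℝ)) • iteratedDeriv p (fun ε : ℝ =>
        (1 / ((i - p)! : ℝ)) • (zp (i - p) (S.crossingJet (j + 1) p zp x ε) x -
          z' (i - p) (S.crossingJet (j + 1) p zp x ε) x)) 0 := by
  set ϑ := S.θ (j + 1) x with hϑ
  have hIoo : Ioo (-B) B ∈ 𝓝 ϑ := isOpen_Ioo.mem_nhds (h.θ_mem j hj)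
  have hτ0 : τ (j + 1) 0 = ϑ := by
    have := (h.τ_eq j hj).self_of_nhds
    rw [h.Y_zero j hj.le] at this
    exact this
  -- the jets of the crossing time and of the crossing point
  obtain ⟨A, hA⟩ : ∃ A, HasJet n (τ (j + 1)) A := ⟨_, (h.contDiffAt_τ j hj).hasJet⟩
  have hA0 : A 0 = ϑ := by rw [← hA.apply_zero, hτ0]
  have hcomp : ∀ {D : ℕ → ℝ → EuclideanSpace ℝ (Fin d)},
      (∀ m ≤ n, ContDiff ℝ (n - m : ℕ) (D m)) → ∀ m ≤ n, HasJet (n - m)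
        (fun ε => D m (τ (j + 1) ε)) fun q => ∑ l ∈ Finset.range (q + 1), (1 / (l ! : ℝ)) •
          ∑ w ∈ posTuples q l, iteratedFDeriv ℝ l (D m) ϑ fun r => A (w r) := by
    intro D hD m hm
    rw [← hA0]
    exact (hA.mono (Nat.sub_le n m)).comp_contDiffAt (hD m hm).contDiffAt
  have hW := HasJet.comp_prodMk hr hr0 hYr hA.continuousAt (hcomp hC)
  set W : ℕ → EuclideanSpace ℝ (Fin d) := fun i => ∑ m ∈ Finset.range (i + 1),
    ∑ l ∈ Finset.range (i - m + 1), (1 / (l ! : ℝ)) •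
      ∑ w ∈ posTuples (i - m) l, iteratedFDeriv ℝ l (C m) ϑ fun r => A (w r) with hWdef
  have hconst0 : ∀ (D : ℝ → EuclideanSpace ℝ (Fin d)) (y : EuclideanSpace ℝ (Fin d)),
      (∀ t, D t = y) → ∀ q, 1 ≤ q → ∑ l ∈ Finset.range (q + 1), (1 / (l ! : ℝ)) •
        ∑ w ∈ posTuples q l, (iteratedFDeriv ℝ l D ϑ fun r => A (w r)) = 0 := by
    intro D y hD q hq
    have hD' : D = fun _ => y := funext hD
    refine Finset.sum_eq_zero fun l _ => ?_
    cases l with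
    | zero => rw [posTuples_succ_zero hq, Finset.sum_empty, smul_zero]
    | succ l =>
      rw [hD', Finset.sum_eq_zero, smul_zero]
      intro w _
      rw [iteratedFDeriv_const_of_ne (by omega)]
      rfl
  have hW0 : W 0 = x := by
    rw [← hW.apply_zero, hτ0, h.Y_zero j hj.le]
  have hAq : ∀ q, 1 ≤ q → q ≤ n → A q = ∑ l ∈ Finset.range (q + 1), (1 / (l ! : ℝ)) •
      ∑ w ∈ posTuples q l, iteratedFDeriv ℝ l (S.θ (j + 1)) x fun r => W (w r) := by
    intro q _ hqn
    have h1 : HasJet n (fun ε => S.θ (j + 1) (Y j (τ (j + 1) ε, ε))) A :=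
      hA.congr_fun (h.τ_eq j hj)
    have h2 := hW.comp_contDiffAt (g := S.θ (j + 1)) (by rw [hW0]; exact h.contDiffAt_θ j hj)
    rw [hW0] at h2
    exact h1.unique h2 q hqn
  have hWi : ∀ i, 1 ≤ i → i ≤ n → W i = C i ϑ + ∑ a ∈ Finset.Icc 1 (i - 1),
      ∑ b ∈ faaTuples a, faaCoeff b • faaDeriv b (C (i - a)) ϑ fun q => (q ! : ℝ) • A q := by
    intro i hi hin
    have h1 : W i = ∑ m ∈ Finset.range (i + 1), if m = 0 then 0 else ∑ b ∈ faaTuples (i - m),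
        faaCoeff b • faaDeriv b (C m) ϑ fun q => (q ! : ℝ) • A q := by
      refine Finset.sum_congr rfl fun m hm => ?_
      have hm' := Finset.mem_range.1 hm
      split_ifs with hm0
      · subst hm0
        exact hconst0 _ _ hC0 _ (by omega)
      · exact sum_posTuples_iteratedFDeriv (hC m (by omega)).contDiffAt (by omega)
          fun q _ _ => rfl
    rw [h1, ← Finset.sum_range_reflect, Finset.sum_range_succ', add_comm]
    congr 1
    · rw [if_neg (by omega), show i - (i + 1 - 1 - 0) = 0 by omega, sum_faaTuples_zero]
      rfl
    · have h2 : Finset.Icc 1 (i - 1) = Finset.Ico 1 i := by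
        ext m
        simp only [Finset.mem_Icc, Finset.mem_Ico]
        omega
      obtain ⟨i, rfl⟩ := Nat.exists_eq_add_of_le' hi
      rw [h2, Finset.sum_Ico_eq_sum_range, Finset.sum_range_succ, if_pos (by omega), add_zero]
      refine Finset.sum_congr (by simp) fun a ha => ?_
      have ha' := Finset.mem_range.1 ha
      rw [if_neg (by omega), show i + 1 - (i + 1 + 1 - 1 - (a + 1)) = 1 + a by omega,
        show i + 1 + 1 - 1 - (a + 1) = i + 1 - (1 + a) by omega]
  have hjet : ∀ p ≤ n, ∀ ε : ℝ, S.crossingJet (j + 1) p zp x ε =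
      ∑ q ∈ Finset.range (p + 1), ε ^ q • A q := by
    intro p hp ε
    have h1 := (S.wSeq_eq_and_alphaOf_eq (zp := zp) (fun m hm hmn => by
      filter_upwards [hIoo] with t ht using hzp m hm hmn t ht) hAq hWi).2
    refine Finset.sum_congr rfl fun q hq => ?_
    have hq' := Finset.mem_range.1 hq
    have h2 : (q ! : ℝ) ≠ 0 := by positivity
    rcases Nat.eq_zero_or_pos q with rfl | hq0
    · simp [alphaOf, hA0, hϑ]
    · rw [h1 q hq0 (by omega), smul_eq_mul]
      field_simp
  -- the jet of the difference of the two pieces along the crossing times vanishes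
  have hΔ : ∀ m ≤ n, ContDiff ℝ (n - m : ℕ) fun t => C m t - C' m t := fun m hm =>
    (hC m hm).sub (hC' m hm)
  have hdiff := HasJet.comp_prodMk (c := fun m t => C m t - C' m t)
    (f := fun p => Y j p - Y (j + 1) p) (h := fun p => r p - r' p) (hr.sub hr')
    (fun t => by rw [hr0, hr0'])
    (fun t ε => by
      rw [hYr, hYr']
      simp only [smul_sub, Finset.sum_sub_distrib]
      abel) hA.continuousAt (hcomp hΔ)
  have hzero := (hdiff.congr_fun (g := fun _ => 0) (by
    filter_upwards [h.Y_match j hj] with ε hε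
    rw [hε, sub_self])).unique (HasJet.zero n) i hin
  -- the terms of the correction are the coefficients with `1 ≤ m < i`
  have hterm : ∀ p ∈ Finset.Icc 1 (i - 1), (1 / (p ! : ℝ)) • iteratedDeriv p (fun ε : ℝ =>
        (1 / ((i - p)! : ℝ)) • (zp (i - p) (S.crossingJet (j + 1) p zp x ε) x -
          z' (i - p) (S.crossingJet (j + 1) p zp x ε) x)) 0 =
      ∑ l ∈ Finset.range (p + 1), (1 / (l ! : ℝ)) • ∑ w ∈ posTuples p l,
        iteratedFDeriv ℝ l (fun t => C (i - p) t - C' (i - p) t) ϑ fun r => A (w r) := by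
    intro p hp
    rw [Finset.mem_Icc] at hp
    have hpoly : HasJet p (fun ε : ℝ => ∑ q ∈ Finset.range (p + 1), ε ^ q • A q) A :=
      HasJet.polynomial p A
    have hΔp : ContDiff ℝ p fun t => C (i - p) t - C' (i - p) t :=
      (hΔ (i - p) (by omega)).of_le (by norm_cast; omega)
    have h1 := hpoly.comp_contDiffAt (g := fun t => C (i - p) t - C' (i - p) t) hΔp.contDiffAt
    rw [hA0] at h1
    have hsmooth : ContDiff ℝ p fun ε : ℝ => ∑ q ∈ Finset.range (p + 1), ε ^ q • A q :=
      ContDiff.sum fun q _ => (contDiff_id.pow q).smul contDiff_const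
    have h2 : (fun ε : ℝ => (1 / ((i - p)! : ℝ)) •
        (zp (i - p) (S.crossingJet (j + 1) p zp x ε) x -
          z' (i - p) (S.crossingJet (j + 1) p zp x ε) x)) =ᶠ[𝓝 0] fun ε =>
        C (i - p) (∑ q ∈ Finset.range (p + 1), ε ^ q • A q) -
          C' (i - p) (∑ q ∈ Finset.range (p + 1), ε ^ q • A q) := by
      have h3 := hpoly.tendsto
      rw [hA0] at h3
      filter_upwards [h3.eventually hIoo] with ε hε
      rw [hjet p (by omega), hzp (i - p) (by omega) (by omega) _ hε,
        hz' (i - p) (by omega) (by omega) _ hε, ← smul_sub, smul_smul,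
        one_div_mul_cancel (by positivity), one_smul]
    rw [h2.iteratedDeriv_eq, h1.iteratedDeriv_eq (hΔp.comp hsmooth).contDiffAt le_rfl, smul_smul,
      one_div_mul_cancel (by positivity), one_smul]
  rw [Finset.sum_congr rfl hterm]
  rw [← Finset.sum_range_reflect, Finset.sum_range_succ'] at hzero
  have hfirst : ∀ f : ℕ → EuclideanSpace ℝ (Fin d), f i = 0 →
      ∑ p ∈ Finset.range i, f (p + 1) = ∑ p ∈ Finset.Icc 1 (i - 1), f p := by
    intro f hf
    obtain ⟨i, rfl⟩ := Nat.exists_eq_add_of_le' hi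
    have h2 : Finset.Icc 1 (i + 1 - 1) = Finset.Ico 1 (i + 1) := by
      ext m
      simp only [Finset.mem_Icc, Finset.mem_Ico]
      omega
    rw [h2, Finset.sum_Ico_eq_sum_range, Finset.sum_range_succ, hf, add_zero]
    refine Finset.sum_congr (by simp) fun p _ => by rw [add_comm]
  rw [hfirst (fun p => ∑ l ∈ Finset.range (i - (i + 1 - 1 - p) + 1), (1 / (l ! : ℝ)) •
      ∑ w ∈ posTuples (i - (i + 1 - 1 - p)) l,
        iteratedFDeriv ℝ l (fun t => C (i + 1 - 1 - p) t - C' (i + 1 - 1 - p) t) ϑ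
          fun r => A (w r)) ?_] at hzero
  · have h5 : ∀ p ∈ Finset.Icc 1 (i - 1),
        (∑ l ∈ Finset.range (i - (i + 1 - 1 - p) + 1), (1 / (l ! : ℝ)) •
        ∑ w ∈ posTuples (i - (i + 1 - 1 - p)) l,
        iteratedFDeriv ℝ l (fun t => C (i + 1 - 1 - p) t - C' (i + 1 - 1 - p) t) ϑ
          fun r => A (w r)) = ∑ l ∈ Finset.range (p + 1), (1 / (l ! : ℝ)) • ∑ w ∈ posTuples p l,
        iteratedFDeriv ℝ l (fun t => C (i - p) t - C' (i - p) t) ϑ fun r => A (w r) := by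
      intro p hp
      rw [Finset.mem_Icc] at hp
      rw [show i - (i + 1 - 1 - p) = p by omega, show i + 1 - 1 - p = i - p by omega]
    rw [Finset.sum_congr rfl h5] at hzero
    have h6 : (∑ l ∈ Finset.range (i - (i + 1 - 1 - 0) + 1), (1 / (l ! : ℝ)) •
        ∑ w ∈ posTuples (i - (i + 1 - 1 - 0)) l,
        iteratedFDeriv ℝ l (fun t => C (i + 1 - 1 - 0) t - C' (i + 1 - 1 - 0) t) ϑ
          fun r => A (w r)) = C i ϑ - C' i ϑ := by
      rw [show i - (i + 1 - 1 - 0) = 0 by omega, show i + 1 - 1 - 0 = i by omega]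
      rw [sum_posTuples_iteratedFDeriv (n := 0) (v := fun m => (m ! : ℝ) • A m)
        (contDiff_zero.2 (hΔ i hin).continuous).contDiffAt le_rfl fun _ _ _ => rfl,
        sum_faaTuples_zero]
    rw [h6] at hzero
    rw [← sub_eq_zero, ← neg_eq_zero, ← hzero]
    abel
  · rw [show i + 1 - 1 - i = 0 by omega]
    exact hconst0 _ 0 (fun t => by rw [hC0, hC0', sub_self]) _ (by omega)

/-- The functions `z_i^j(·, x) / i!` are the coefficients of the jets of `Y_j(t, ·)`. -/
theorem z_eq (h : S.IsPiecewiseFlow n B x Y τ G) (hn : 1 ≤ n) (hnk : n ≤ S.k) {j : ℕ}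
    (hj : j ≤ S.N) {t : ℝ} (ht : t ∈ Ioo (-B) B) {c : ℕ → EuclideanSpace ℝ (Fin d)}
    (hc : HasJet n (fun ε => Y j (t, ε)) c) {i : ℕ} (hi : 1 ≤ i) (hin : i ≤ n) :
    S.z j i t x = (i ! : ℝ) • c i := by
  have htaylor : ∀ j ≤ S.N, ∃ (C : ℕ → ℝ → EuclideanSpace ℝ (Fin d))
      (r : ℝ × ℝ → EuclideanSpace ℝ (Fin d)), Continuous r ∧ (∀ t, r (t, 0) = C n t) ∧
      (∀ t ε, Y j (t, ε) = ∑ m ∈ Finset.range n, ε ^ m • C m t + ε ^ n • r (t, ε)) ∧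
      (∀ m ≤ n, ContDiff ℝ (n - m : ℕ) (C m)) ∧ ∀ t, C 0 t = x := by
    intro j hj
    obtain ⟨C, hC⟩ := exists_taylor_snd (h.contDiff_Y j hj)
    obtain ⟨-, r, hr, hr0, hYr⟩ := hC n le_rfl
    refine ⟨C, r, hr.continuous, hr0, hYr, fun m hm => (hC m hm).1, fun t => ?_⟩
    rw [← (HasJet.of_taylor (f := Y j) hr.continuous hr0 hYr t).apply_zero, h.Y_zero j hj]
  choose! C r hr hr0 hYr hC hC0 using htaylor
  have hjet : ∀ j ≤ S.N, ∀ t, HasJet n (fun ε => Y j (t, ε)) fun i => C j i t := fun j hj t =>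
    HasJet.of_taylor (f := Y j) (hr j hj) (hr0 j hj) (hYr j hj) t
  have key : ∀ j ≤ S.N, ∀ i, 1 ≤ i → i ≤ n → ∀ t ∈ Ioo (-B) B,
      S.z j i t x = (i ! : ℝ) • C j i t := by
    intro j
    induction j with
    | zero =>
      intro hj
      obtain ⟨κ, hκ, hκz⟩ := h.exists_coeff_integral_eq hn hnk hj (hjet 0 hj) (hC0 0 hj)
      have h0 : (0 : ℝ) ∈ Ioo (-B) B := ⟨neg_lt_zero.2 h.B_pos, h.B_pos⟩
      have hinit : ∀ i, 1 ≤ i → i ≤ n → C 0 i 0 = 0 := by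
        intro i hi hin
        have h1 : HasJet n (fun _ : ℝ => x) fun i => if i = 0 then x else 0 :=
          (HasJet.polynomial n _).congr_fun (Eventually.of_forall fun ε => by
            simp)
        have h2 := ((hjet 0 hj 0).congr_fun h.Y_init).unique h1 i hin
        rwa [if_neg (by omega)] at h2
      intro i
      induction i using Nat.strong_induction_on with
      | _ i ih =>
      intro hi hin t ht
      have h1 := hκ i hi hin 0 h0 t ht
      rw [hinit i hi hin, sub_zero] at h1
      rw [z, strongSeq_eq, h1]
      congr 1
      refine intervalIntegral.integral_congr fun s hs => ?_
      have hs' : s ∈ Ioo (-B) B := ordConnected_Ioo.uIcc_subset h0 ht hs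
      refine hκz i hi hin s hs' _ fun m hm hmi => ?_
      have h2 := ih m hmi hm (by omega) s hs'
      rw [z] at h2
      rw [if_pos hmi, h2]
    | succ j ihj =>
      intro hj
      have hj' : j < S.N := hj
      obtain ⟨κ, hκ, hκz⟩ := h.exists_coeff_integral_eq hn hnk hj (hjet (j + 1) hj) (hC0 (j + 1) hj)
      intro i
      induction i using Nat.strong_induction_on with
      | _ i ih =>
      intro hi hin t ht
      have hθ := h.θ_mem j hj'
      set z' : ℕ → ℝ → EuclideanSpace ℝ (Fin d) → EuclideanSpace ℝ (Fin d) :=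
        fun m => if m < i then S.z (j + 1) m else 0 with hz'def
      have hz' : ∀ m, 1 ≤ m → m < i → ∀ t ∈ Ioo (-B) B,
          z' m t x = (m ! : ℝ) • C (j + 1) m t := by
        intro m hm hmi t ht
        rw [hz'def]
        simp only [if_pos hmi]
        exact ih m hmi hm (by omega) t ht
      have h1 := hκ i hi hin _ hθ t ht
      have h2 := h.coeff_succ_apply_θ hj' (hr j hj'.le) (hr (j + 1) hj) (hr0 j hj'.le)
        (hr0 (j + 1) hj) (hYr j hj'.le) (hYr (j + 1) hj) (hC j hj'.le) (hC (j + 1) hj)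
        (hC0 j hj'.le) (hC0 (j + 1) hj) (ihj hj'.le) hi hin hz'
      rw [sub_eq_iff_eq_add.1 h1, h2, smul_add, smul_add, ← ihj hj'.le i hi hin _ hθ]
      have h3 : S.z (j + 1) i t x = S.z j i (S.θ (j + 1) x) x +
          (i ! : ℝ) • (∫ s in (S.θ (j + 1) x)..t, S.integrand (j + 1) i z' s x) +
          (i ! : ℝ) • ∑ p ∈ Finset.Icc 1 (i - 1), (1 / (p ! : ℝ)) •
            iteratedDeriv p (fun ε : ℝ =>
              (1 / ((i - p)! : ℝ)) •
                (S.z j (i - p) (S.crossingJet (j + 1) p (S.z j) x ε) x -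
                  z' (i - p) (S.crossingJet (j + 1) p (S.z j) x ε) x)) 0 := by
        simp only [hz'def, z]
        rw [strongSeq_eq]
      have h4 : ∫ s in (S.θ (j + 1) x)..t, S.integrand (j + 1) i z' s x =
          ∫ s in (S.θ (j + 1) x)..t, κ i s := by
        refine intervalIntegral.integral_congr fun s hs => ?_
        have hs' : s ∈ Ioo (-B) B := ordConnected_Ioo.uIcc_subset hθ ht hs
        exact hκz i hi hin s hs' _ fun m hm hmi => hz' m hm hmi s hs'
      rw [h3, h4]
      abel
  rw [key j hj i hi hin t ht, (hjet j hj t).unique hc i hin]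

end IsPiecewiseFlow

end SwitchedSystem

/-! ### Construction of the pieces -/

/-- The implicit function theorem, with a globally defined implicit function. -/
theorem ContDiffAt.exists_contDiff_implicit {P X F : Type*} [NormedAddCommGroup P]
    [NormedSpace ℝ P] [FiniteDimensional ℝ P] [NormedAddCommGroup X] [NormedSpace ℝ X]
    [CompleteSpace X] [NormedAddCommGroup F] [NormedSpace ℝ F] [CompleteSpace F] {n : ℕ}
    (hn : n ≠ 0) {f : P × X → F} {p₀ : P} {x₀ : X} (hf : ContDiffAt ℝ n f (p₀, x₀))
    {D : X ≃L[ℝ] F} (hD : HasFDerivAt (fun x => f (p₀, x)) (D : X →L[ℝ] F) x₀) :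
    ∃ g : P → X, ContDiff ℝ n g ∧ g p₀ = x₀ ∧
      ∀ᶠ q in 𝓝 (p₀, x₀), f q = f (p₀, x₀) ↔ g q.1 = q.2 := by
  have hn' : ((n : ℕ) : WithTop ℕ∞) ≠ 0 := by exact_mod_cast hn
  have hfd : fderiv ℝ f (p₀, x₀) ∘L .inr ℝ P X = D :=
    (((hf.differentiableAt hn').hasFDerivAt).comp x₀ (hasFDerivAt_prodMk_right p₀ x₀)).unique hD
  have hinv : (fderiv ℝ f (p₀, x₀) ∘L .inr ℝ P X).IsInvertible := ⟨D, hfd.symm⟩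
  obtain ⟨g, hg, hgeq⟩ := (hf.contDiffAt_implicitFunction hn' hinv).exists_contDiff_eventuallyEq
  refine ⟨g, hg, ?_, ?_⟩
  · rw [hgeq.self_of_nhds]
    exact hf.implicitFunction_apply_self hn' hinv
  · have h1 := (continuous_fst.tendsto (p₀, x₀)).eventually hgeq
    filter_upwards [hf.eventually_apply_eq_iff_implicitFunction hn' hinv, h1] with q hq hq1
    rw [hq, hq1]

theorem sub_eq_intervalIntegral_of_eq_primitive {E : Type*} [NormedAddCommGroup E] [NormedSpace ℝ E]
    {g ψ : ℝ → E} (hg : Continuous g) {t₀ s t : ℝ} (hs : ψ s = ∫ u in t₀..s, g u)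
    (ht : ψ t = ∫ u in t₀..t, g u) : ψ t - ψ s = ∫ u in s..t, g u := by
  rw [hs, ht, intervalIntegral.integral_interval_sub_left] <;> exact hg.intervalIntegrable _ _

/-- One step of the construction: the crossing time `τ(x,ε)` of `x + ε ψ(t,x,ε)` with `t = θ(x)`,
and the solution `x + ε ψ'(t,x,ε)` of `x' = ε G(t,x,ε)` that takes over at this time. -/
theorem exists_contDiff_crossing {E : Type u} [NormedAddCommGroup E] [NormedSpace ℝ E]
    [FiniteDimensional ℝ E] {n : ℕ} (hn : n ≠ 0) {G : ℝ × E × ℝ → E} (hG : ContDiff ℝ n G)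
    {L : NNReal} (hL : LipschitzWith L G) {B : ℝ} (hB : 0 < B) {ψ : ℝ × E × ℝ → E}
    (hψ : ContDiff ℝ n ψ) {θ : E → ℝ} {a : E} (hθ : ContDiffAt ℝ n θ a) (hθB : |θ a| < B) :
    ∃ (τ : E × ℝ → ℝ) (ψ' : ℝ × E × ℝ → E), ContDiff ℝ n τ ∧ ContDiff ℝ n ψ' ∧ τ (a, 0) = θ a ∧
      ∀ᶠ p in 𝓝 (a, (0 : ℝ)), τ p = θ (p.1 + p.2 • ψ (τ p, p)) ∧ ψ' (τ p, p) = ψ (τ p, p) ∧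
        ∀ s t, |s| ≤ B → |t| ≤ B →
          ψ' (t, p) - ψ' (s, p) = ∫ u in s..t, G (u, p.1 + p.2 • ψ' (u, p), p.2) := by
  have : CompleteSpace E := FiniteDimensional.complete ℝ E
  have hn' : ((n : ℕ) : WithTop ℕ∞) ≠ 0 := by exact_mod_cast hn
  obtain ⟨θ', hθ', hθθ'⟩ := hθ.exists_contDiff_eventuallyEq
  obtain ⟨ε₁, hε₁, Ψ, hΨ, hΨint⟩ := exists_contDiff_flow hn hG hL hB
  have hpt : ContDiff ℝ n fun q : (E × ℝ) × ℝ => q.1.1 + q.1.2 • ψ (q.2, q.1) :=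
    contDiff_fst.fst.add (contDiff_fst.snd.smul (hψ.comp (contDiff_snd.prodMk contDiff_fst)))
  have hf : ContDiff ℝ n fun q : (E × ℝ) × ℝ => q.2 - θ' (q.1.1 + q.1.2 • ψ (q.2, q.1)) :=
    contDiff_snd.sub (hθ'.comp hpt)
  obtain ⟨τ, hτ, hτ0, hτeq⟩ := hf.contDiffAt.exists_contDiff_implicit hn (p₀ := (a, (0 : ℝ)))
    (x₀ := θ a) (D := ContinuousLinearEquiv.refl ℝ ℝ) (by
      have h1 : (fun t : ℝ => t - θ' (a + (0 : ℝ) • ψ (t, (a, (0 : ℝ))))) = fun t => t - θ' a := by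
        funext t
        rw [zero_smul, add_zero]
      simp only [h1]
      exact (hasFDerivAt_id _).sub_const _)
  have hτc : Tendsto (fun p => (p, τ p)) (𝓝 (a, (0 : ℝ))) (𝓝 ((a, (0 : ℝ)), θ a)) := by
    have := hτ.continuous.tendsto (a, (0 : ℝ))
    rw [hτ0] at this
    exact tendsto_id.prodMk_nhds this
  have hy : ContDiff ℝ n fun p : E × ℝ => p.1 + p.2 • ψ (τ p, p) :=
    hpt.comp (contDiff_id.prodMk hτ)
  refine ⟨τ, fun q => ψ (τ q.2, q.2) +
    Ψ (τ q.2, q.1, q.2.1 + q.2.2 • ψ (τ q.2, q.2), q.2.2), hτ, ?_, hτ0, ?_⟩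
  · refine (hψ.comp ((hτ.comp contDiff_snd).prodMk contDiff_snd)).add (hΨ.comp ?_)
    exact (hτ.comp contDiff_snd).prodMk
      (contDiff_fst.prodMk ((hy.comp contDiff_snd).prodMk contDiff_snd.snd))
  have hyt : Tendsto (fun p : E × ℝ => p.1 + p.2 • ψ (τ p, p)) (𝓝 (a, (0 : ℝ))) (𝓝 a) := by
    have := hy.continuous.tendsto (a, (0 : ℝ))
    simpa using this
  have hτB : ∀ᶠ p in 𝓝 (a, (0 : ℝ)), |τ p| < B :=
    (hτ.continuous.abs.tendsto _).eventually_lt_const (by rw [hτ0]; exact hθB)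
  have hε : ∀ᶠ p : E × ℝ in 𝓝 (a, (0 : ℝ)), |p.2| < ε₁ :=
    (continuous_snd.abs.tendsto (a, (0 : ℝ))).eventually_lt_const (by simpa using hε₁)
  filter_upwards [hτc.eventually hτeq, hyt.eventually hθθ', hτB, hε] with p hp1 hp2 hp3 hp4
  have hself : Ψ (τ p, τ p, p.1 + p.2 • ψ (τ p, p), p.2) = 0 := by
    rw [hΨint _ _ _ _ hp3.le hp3.le hp4.le, intervalIntegral.integral_same]
  refine ⟨?_, by rw [hself, add_zero], fun s t hs ht => ?_⟩
  · rw [← hp2]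
    have := hp1.2 rfl
    rw [zero_smul, add_zero, hθθ'.self_of_nhds, sub_self] at this
    exact sub_eq_zero.1 this
  · have hcont : Continuous fun u : ℝ => G (u, p.1 + p.2 • ψ (τ p, p) +
        p.2 • Ψ (τ p, u, p.1 + p.2 • ψ (τ p, p), p.2), p.2) := by
      have h1 := hG.continuous
      have h2 := hΨ.continuous
      fun_prop
    have h3 := sub_eq_intervalIntegral_of_eq_primitive (ψ := fun t => Ψ (τ p, t, p.1 + p.2 • ψ (τ p, p), p.2))
      hcont (hΨint (τ p) s (p.1 + p.2 • ψ (τ p, p)) p.2 hp3.le hs hp4.le)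
      (hΨint (τ p) t (p.1 + p.2 • ψ (τ p, p)) p.2 hp3.le ht hp4.le)
    simp only [add_sub_add_left_eq_sub, smul_add, ← add_assoc]
    exact h3

theorem eventually_forall_le {X : Type*} {l : Filter X} {N : ℕ} {p : ℕ → X → Prop}
    (h : ∀ j ≤ N, ∀ᶠ x in l, p j x) : ∀ᶠ x in l, ∀ j ≤ N, p j x :=
  (eventually_all_finite (finite_Iic N)).2 h

namespace SwitchedSystem

variable {d : ℕ}

theorem smul_rescaledField (S : SwitchedSystem d) (j : ℕ) (ε t : ℝ)
    (x : EuclideanSpace ℝ (Fin d)) : ε • S.rescaledField j ε t x = S.field j ε t x := by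
  rw [rescaledField, field, smul_add, Finset.smul_sum, smul_smul, ← pow_succ']
  congr 1
  refine Finset.sum_congr rfl fun i hi => ?_
  rw [smul_smul, ← pow_succ', Nat.sub_add_cancel (Finset.mem_Icc.1 hi).1]

theorem IsAdmissible.contDiffOn_rescaledField {S : SwitchedSystem d} (hS : S.IsAdmissible) {j : ℕ}
    (hj : j ≤ S.N) : ContDiffOn ℝ S.k
      (fun p : ℝ × EuclideanSpace ℝ (Fin d) × ℝ => S.rescaledField j p.2.2 p.1 p.2.1)
      (univ ×ˢ S.D ×ˢ Ioo (-S.ε₀) S.ε₀) := by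
  refine ContDiffOn.add (ContDiffOn.sum fun i hi => ?_) ?_
  · rw [Finset.mem_Icc] at hi
    refine (contDiff_snd.snd.pow _).contDiffOn.smul ?_
    exact (hS.F_contDiff i hi.1 hi.2 j hj).comp
      (g := fun p : ℝ × EuclideanSpace ℝ (Fin d) => S.F i j p.1 p.2)
      (f := fun p : ℝ × EuclideanSpace ℝ (Fin d) × ℝ => (p.1, p.2.1))
      (contDiff_fst.prodMk contDiff_snd.fst).contDiffOn fun p hp => ⟨mem_univ _, hp.2.1⟩
  · exact (contDiff_snd.snd.pow _).contDiffOn.smul (hS.R_contDiff j hj)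

/-- Globally defined functions `G_j` that agree with the rescaled right-hand sides near `a` for
small `ε`, and common constants for them and for the switching times. -/
structure IsLocalization (S : SwitchedSystem d) (n : ℕ) (a : EuclideanSpace ℝ (Fin d))
    (r ε₁ : ℝ) (L : NNReal) (C : ℝ) (G : ℕ → ℝ × EuclideanSpace ℝ (Fin d) × ℝ →
      EuclideanSpace ℝ (Fin d)) : Prop where
  r_pos : 0 < r
  closedBall_subset : Metric.closedBall a r ⊆ S.D
  ε₁_pos : 0 < ε₁
  ε₁_le : ε₁ ≤ S.ε₀
  lipschitzOnWith_θ : ∀ j ≤ S.N + 1, LipschitzOnWith L (S.θ j) (Metric.closedBall a r)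
  contDiff_G : ∀ j ≤ S.N, ContDiff ℝ n (G j)
  lipschitzWith_G : ∀ j ≤ S.N, LipschitzWith L (G j)
  norm_G_le : ∀ j ≤ S.N, ∀ q, ‖G j q‖ ≤ C
  G_eq : ∀ j ≤ S.N, ∀ t x ε, |t| ≤ 2 * S.T → x ∈ Metric.closedBall a r → |ε| < ε₁ →
    G j (t, x, ε) = S.rescaledField j ε t x

theorem IsAdmissible.exists_isLocalization {S : SwitchedSystem d} (hS : S.IsAdmissible) {n : ℕ}
    (hn : n ≠ 0) (hnk : n ≤ S.k) {a : EuclideanSpace ℝ (Fin d)} (ha : a ∈ S.D)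
    (hθ : ∀ j < S.N, ContDiffAt ℝ n (S.θ (j + 1)) a) :
    ∃ r ε₁ L C G, S.IsLocalization n a r ε₁ L C G := by
  have hD := hS.isOpen_D.mem_nhds ha
  have hθL : ∀ j ≤ S.N + 1, ∃ K, ∃ t ∈ 𝓝 a, LipschitzOnWith K (S.θ j) t := by
    have hconst : ∀ c j, (∀ x ∈ S.D, S.θ j x = c) → LipschitzOnWith 0 (S.θ j) S.D := by
      intro c j h x hx y hy
      rw [h x hx, h y hy, edist_self]
      exact zero_le
    intro j hj
    rcases Nat.eq_zero_or_pos j with rfl | hj0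
    · exact ⟨0, S.D, hD, hconst _ _ hS.θ_zero⟩
    · obtain ⟨j, rfl⟩ := Nat.exists_eq_add_of_le' hj0
      rcases Nat.lt_or_ge j S.N with hjN | hjN
      · exact ((hθ j hjN).of_le (by exact_mod_cast Nat.one_le_iff_ne_zero.2 hn)
          |>.exists_lipschitzOnWith)
      · obtain rfl : j = S.N := by omega
        exact ⟨0, S.D, hD, hconst _ _ hS.θ_last⟩
  choose! K U hU hKU using hθL
  have hU' : ∀ᶠ x in 𝓝 a, ∀ j ≤ S.N + 1, x ∈ U j := eventually_forall_le hU
  obtain ⟨r, hr, hrU⟩ := Metric.nhds_basis_closedBall.mem_iff.1 (inter_mem hD hU')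
  have hε₀ := hS.ε₀_pos
  have hG : ∀ j ≤ S.N, ∃ G : ℝ × EuclideanSpace ℝ (Fin d) × ℝ → EuclideanSpace ℝ (Fin d),
      ∃ (L : NNReal) (C : ℝ), ContDiff ℝ n G ∧ LipschitzWith L G ∧ (∀ q, ‖G q‖ ≤ C) ∧
        ∀ t x ε, |t| ≤ 2 * S.T → x ∈ Metric.closedBall a r → |ε| < S.ε₀ / 2 →
          G (t, x, ε) = S.rescaledField j ε t x := by
    intro j hj
    obtain ⟨G, hG, hGc, hGeq⟩ := exists_contDiff_hasCompactSupport_eventuallyEq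
      (K := Icc (-(2 * S.T)) (2 * S.T) ×ˢ Metric.closedBall a r ×ˢ Icc (-(S.ε₀ / 2)) (S.ε₀ / 2))
      (isCompact_Icc.prod ((isCompact_closedBall a r).prod isCompact_Icc))
      (isOpen_univ.prod (hS.isOpen_D.prod isOpen_Ioo))
      (fun p hp => ⟨mem_univ _, (hrU hp.2.1).1, by linarith [hp.2.2.1], by linarith [hp.2.2.2]⟩)
      ((hS.contDiffOn_rescaledField hj).of_le (by exact_mod_cast hnk))
    obtain ⟨L, hL⟩ := hG.lipschitzWith_of_hasCompactSupport hGc (by exact_mod_cast hn)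
    obtain ⟨C, hC⟩ := hG.continuous.bounded_above_of_compact_support hGc
    refine ⟨G, L, C, hG, hL, hC, fun t x ε ht hx hε => ?_⟩
    exact hGeq.self_of_nhdsSet (t, x, ε) ⟨abs_le.1 ht, hx, abs_le.1 hε.le⟩
  choose! G L C hG hL hC hGeq using hG
  obtain ⟨L₁, hL₁⟩ := ((Finset.range (S.N + 2)).image K ∪ (Finset.range (S.N + 1)).image L).exists_le
  obtain ⟨C₁, hC₁⟩ := ((Finset.range (S.N + 1)).image C).exists_le
  refine ⟨r, S.ε₀ / 2, L₁, C₁, G, hr, fun x hx => (hrU hx).1, by linarith, by linarith,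
    fun j hj => ?_, hG, fun j hj => ?_, fun j hj q => ?_, hGeq⟩
  · refine ((hKU j hj).mono fun x hx => (hrU hx).2 j hj).weaken (hL₁ _ ?_)
    exact Finset.mem_union_left _ (Finset.mem_image_of_mem _ (Finset.mem_range.2 (by omega)))
  · refine (hL j hj).weaken (hL₁ _ ?_)
    exact Finset.mem_union_right _ (Finset.mem_image_of_mem _ (Finset.mem_range.2 (by omega)))
  · refine (hC j hj q).trans (hC₁ _ ?_)
    exact Finset.mem_image_of_mem _ (Finset.mem_range.2 (by omega))

/-- The pieces `Y_j` of an orbit with initial value `x` and its crossing times `σ_j`: the piece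
`Y_j`, which solves `y' = ε G_j(t,y,ε)` for `|t| ≤ 2T`, is followed for `σ_j ≤ t ≤ σ_{j+1}`. -/
structure IsOrbit (S : SwitchedSystem d) (a : EuclideanSpace ℝ (Fin d)) (r : ℝ)
    (G : ℕ → ℝ × EuclideanSpace ℝ (Fin d) × ℝ → EuclideanSpace ℝ (Fin d)) (ε : ℝ)
    (x : EuclideanSpace ℝ (Fin d)) (Y : ℕ → ℝ → EuclideanSpace ℝ (Fin d)) (σ : ℕ → ℝ) : Prop where
  continuous : ∀ j ≤ S.N, Continuous (Y j)
  mem_ball : ∀ j ≤ S.N, ∀ t, |t| ≤ 2 * S.T → Y j t ∈ Metric.ball a r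
  sub_eq : ∀ j ≤ S.N, ∀ s t, |s| ≤ 2 * S.T → |t| ≤ 2 * S.T →
    Y j t - Y j s = ∫ u in s..t, ε • G j (u, Y j u, ε)
  init : Y 0 0 = x
  σ_zero : σ 0 = 0
  σ_last : σ (S.N + 1) = S.T
  σ_lt : ∀ j ≤ S.N, σ j < σ (j + 1)
  crossing : ∀ j < S.N, σ (j + 1) = S.θ (j + 1) (Y j (σ (j + 1)))
  matching : ∀ j < S.N, Y (j + 1) (σ (j + 1)) = Y j (σ (j + 1))

theorem IsAdmissible.θ_lt_of_lt {S : SwitchedSystem d} (hS : S.IsAdmissible) {i j : ℕ}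
    (hij : i < j) (hj : j ≤ S.N + 1) {x : EuclideanSpace ℝ (Fin d)} (hx : x ∈ S.D) :
    S.θ i x < S.θ j x := by
  induction j, hij using Nat.le_induction with
  | base => exact hS.θ_lt i (by omega) x hx
  | succ j hij ih => exact (ih (by omega)).trans (hS.θ_lt j (by omega) x hx)

theorem IsAdmissible.θ_le_of_le {S : SwitchedSystem d} (hS : S.IsAdmissible) {i j : ℕ}
    (hij : i ≤ j) (hj : j ≤ S.N + 1) {x : EuclideanSpace ℝ (Fin d)} (hx : x ∈ S.D) :
    S.θ i x ≤ S.θ j x := by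
  rcases hij.eq_or_lt with rfl | h
  · exact le_rfl
  · exact (hS.θ_lt_of_lt h hj hx).le

theorem IsAdmissible.θ_mem_Icc {S : SwitchedSystem d} (hS : S.IsAdmissible) {j : ℕ}
    (hj : j ≤ S.N + 1) {x : EuclideanSpace ℝ (Fin d)} (hx : x ∈ S.D) : S.θ j x ∈ Icc 0 S.T := by
  rw [← hS.θ_last x hx, ← hS.θ_zero x hx]
  exact ⟨hS.θ_le_of_le (Nat.zero_le j) hj hx, hS.θ_le_of_le hj le_rfl hx⟩

/-- The orbits near `a`, with the pieces `x + ε ψ_j(t,x,ε)` and the crossing times `τ_j(x,ε)`. -/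
theorem IsLocalization.exists_isOrbit {S : SwitchedSystem d} {n : ℕ}
    {a : EuclideanSpace ℝ (Fin d)} {r ε₁ : ℝ} {L : NNReal} {C : ℝ}
    {G : ℕ → ℝ × EuclideanSpace ℝ (Fin d) × ℝ → EuclideanSpace ℝ (Fin d)}
    (hG : S.IsLocalization n a r ε₁ L C G) (hS : S.IsAdmissible) (hn : n ≠ 0)
    (hθ : ∀ j < S.N, ContDiffAt ℝ n (S.θ (j + 1)) a) :
    ∃ (ψ : ℕ → ℝ × EuclideanSpace ℝ (Fin d) × ℝ → EuclideanSpace ℝ (Fin d))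
      (τ : ℕ → EuclideanSpace ℝ (Fin d) × ℝ → ℝ), (∀ j, ContDiff ℝ n (ψ j)) ∧
      (∀ j ≤ S.N + 1, ContDiff ℝ n (τ j)) ∧ ∀ᶠ p in 𝓝 (a, (0 : ℝ)),
        S.IsOrbit a r G p.2 p.1 (fun j t => p.1 + p.2 • ψ j (t, p)) fun j => τ j p := by
  have ha : a ∈ S.D := hG.closedBall_subset (Metric.mem_closedBall_self hG.r_pos.le)
  have hT := hS.T_pos
  have hB : 0 < 2 * S.T := by linarith
  obtain ⟨ε₂, hε₂, Ψ, hΨ, hΨint⟩ := exists_contDiff_flow hn (hG.contDiff_G 0 (Nat.zero_le _))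
    (hG.lipschitzWith_G 0 (Nat.zero_le _)) hB
  have hstep : ∀ (j : ℕ) (ψ : {ψ : ℝ × EuclideanSpace ℝ (Fin d) × ℝ → EuclideanSpace ℝ (Fin d) //
      ContDiff ℝ n ψ}), ∃ (τ : EuclideanSpace ℝ (Fin d) × ℝ → ℝ)
      (ψ' : {ψ : ℝ × EuclideanSpace ℝ (Fin d) × ℝ → EuclideanSpace ℝ (Fin d) // ContDiff ℝ n ψ}),
      j < S.N → ContDiff ℝ n τ ∧ τ (a, 0) = S.θ (j + 1) a ∧ ∀ᶠ p in 𝓝 (a, (0 : ℝ)),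
        τ p = S.θ (j + 1) (p.1 + p.2 • ψ.1 (τ p, p)) ∧ ψ'.1 (τ p, p) = ψ.1 (τ p, p) ∧
        ∀ s t, |s| ≤ 2 * S.T → |t| ≤ 2 * S.T → ψ'.1 (t, p) - ψ'.1 (s, p) =
          ∫ u in s..t, G (j + 1) (u, p.1 + p.2 • ψ'.1 (u, p), p.2) := by
    intro j ψ
    by_cases hj : j < S.N
    · have hmem := hS.θ_mem_Icc (j := j + 1) (by omega) ha
      obtain ⟨τ, ψ', hτ, hψ', hτ0, h⟩ := exists_contDiff_crossing hn (hG.contDiff_G (j + 1) hj)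
        (hG.lipschitzWith_G (j + 1) hj) hB ψ.2 (hθ j hj) (by
          rw [abs_of_nonneg hmem.1]
          linarith [hmem.2])
      exact ⟨τ, ⟨ψ', hψ'⟩, fun _ => ⟨hτ, hτ0, h⟩⟩
    · exact ⟨0, ψ, fun h => absurd h hj⟩
  choose τ' ψ' hτψ using hstep
  let ψ : ℕ → {ψ : ℝ × EuclideanSpace ℝ (Fin d) × ℝ → EuclideanSpace ℝ (Fin d) //
      ContDiff ℝ n ψ} := fun j => Nat.rec ⟨fun q => Ψ (0, q), hΨ.comp
        (contDiff_const.prodMk contDiff_id)⟩ ψ' j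
  let τ : ℕ → EuclideanSpace ℝ (Fin d) × ℝ → ℝ := fun j p =>
    if j = 0 then 0 else if j = S.N + 1 then S.T else τ' (j - 1) (ψ (j - 1)) p
  have hτsucc : ∀ j < S.N, τ (j + 1) = τ' j (ψ j) := by
    intro j hj
    funext p
    simp only [τ]
    rw [if_neg (by omega), if_neg (by omega), Nat.add_sub_cancel]
  have hτlast : τ (S.N + 1) = fun _ => S.T := by
    funext p
    simp [τ]
  have hτzero : τ 0 = fun _ => 0 := by
    funext p
    simp [τ]
  have hτ : ∀ j ≤ S.N + 1, ContDiff ℝ n (τ j) ∧ τ j (a, 0) = S.θ j a := by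
    intro j hj
    rcases Nat.eq_zero_or_pos j with rfl | hj0
    · rw [hτzero, hS.θ_zero a ha]
      exact ⟨contDiff_const, rfl⟩
    · obtain ⟨j, rfl⟩ := Nat.exists_eq_add_of_le' hj0
      rcases Nat.lt_or_ge j S.N with hjN | hjN
      · rw [hτsucc j hjN]
        exact ⟨(hτψ j (ψ j) hjN).1, (hτψ j (ψ j) hjN).2.1⟩
      · obtain rfl : j = S.N := by omega
        rw [hτlast, hS.θ_last a ha]
        exact ⟨contDiff_const, rfl⟩
  refine ⟨fun j => (ψ j).1, τ, fun j => (ψ j).2, fun j hj => (hτ j hj).1, ?_⟩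
  have hball : ∀ j ≤ S.N, ∀ᶠ p : EuclideanSpace ℝ (Fin d) × ℝ in 𝓝 (a, (0 : ℝ)),
      ∀ t ∈ Icc (-(2 * S.T)) (2 * S.T), p.1 + p.2 • (ψ j).1 (t, p) ∈ Metric.ball a r := by
    intro j _
    refine isCompact_Icc.eventually_forall_of_forall_eventually fun t _ => ?_
    have hc : Continuous fun z : (EuclideanSpace ℝ (Fin d) × ℝ) × ℝ =>
        z.1.1 + z.1.2 • (ψ j).1 (z.2, z.1) := by
      have := (ψ j).2.continuous
      fun_prop
    refine (hc.tendsto _).eventually_mem (Metric.isOpen_ball.mem_nhds ?_)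
    simpa using hG.r_pos
  have hlt : ∀ j ≤ S.N, ∀ᶠ p in 𝓝 (a, (0 : ℝ)), τ j p < τ (j + 1) p := by
    intro j hj
    refine ((hτ j (by omega)).1.continuous.tendsto _).eventually_lt
      ((hτ (j + 1) (by omega)).1.continuous.tendsto _) ?_
    rw [(hτ j (by omega)).2, (hτ (j + 1) (by omega)).2]
    exact hS.θ_lt j hj a ha
  have hε : ∀ᶠ p : EuclideanSpace ℝ (Fin d) × ℝ in 𝓝 (a, (0 : ℝ)), |p.2| < ε₂ :=
    (continuous_snd.abs.tendsto (a, (0 : ℝ))).eventually_lt_const (by simpa using hε₂)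
  have hcross : ∀ᶠ p in 𝓝 (a, (0 : ℝ)), ∀ j < S.N,
      τ (j + 1) p = S.θ (j + 1) (p.1 + p.2 • (ψ j).1 (τ (j + 1) p, p)) ∧
      (ψ (j + 1)).1 (τ (j + 1) p, p) = (ψ j).1 (τ (j + 1) p, p) ∧
        ∀ s t, |s| ≤ 2 * S.T → |t| ≤ 2 * S.T → (ψ (j + 1)).1 (t, p) - (ψ (j + 1)).1 (s, p) =
          ∫ u in s..t, G (j + 1) (u, p.1 + p.2 • (ψ (j + 1)).1 (u, p), p.2) := by
    refine (eventually_all_finite (finite_Iio S.N)).2 fun j hj => ?_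
    rw [hτsucc j hj]
    exact (hτψ j (ψ j) hj).2.2
  filter_upwards [eventually_forall_le hball, eventually_forall_le hlt, hε, hcross] with
    p hpball hplt hpε hpcross
  have h0 : |(0 : ℝ)| ≤ 2 * S.T := by rw [abs_zero]; exact hB.le
  refine ⟨fun j hj => ?_, fun j hj t ht => hpball j hj t (abs_le.1 ht), fun j hj s t hs ht => ?_,
    ?_, by rw [hτzero], by rw [hτlast], hplt, fun j hj => (hpcross j hj).1, fun j hj => ?_⟩
  · have := (ψ j).2.continuous
    fun_prop
  · rw [add_sub_add_left_eq_sub, ← smul_sub, intervalIntegral.integral_smul]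
    congr 1
    cases j with
    | zero =>
      have hc : Continuous fun u => G 0 (u, p.1 + p.2 • Ψ (0, u, p.1, p.2), p.2) := by
        have h1 := (hG.contDiff_G 0 hj).continuous
        have h2 := hΨ.continuous
        fun_prop
      exact sub_eq_intervalIntegral_of_eq_primitive (ψ := fun t => Ψ (0, t, p.1, p.2)) hc (hΨint 0 s p.1 p.2 h0 hs hpε.le)
        (hΨint 0 t p.1 p.2 h0 ht hpε.le)
    | succ j => exact (hpcross j hj).2.2 s t hs ht
  · have h1 : (ψ 0).1 (0, p) = 0 := by
      change Ψ (0, 0, p.1, p.2) = 0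
      rw [hΨint 0 0 p.1 p.2 h0 h0 hpε.le, intervalIntegral.integral_same]
    rw [h1, smul_zero, add_zero]
  · rw [(hpcross j hj).2.1]

end SwitchedSystem

/-! ### Expansion of the displacement -/

namespace SwitchedSystem

variable {d : ℕ} {S : SwitchedSystem d} {n : ℕ} {a : EuclideanSpace ℝ (Fin d)} {r ε₁ : ℝ}
  {L : NNReal} {C : ℝ}
  {G : ℕ → ℝ × EuclideanSpace ℝ (Fin d) × ℝ → EuclideanSpace ℝ (Fin d)}

theorem IsLocalization.eventually_isPiecewiseFlow (hG : S.IsLocalization n a r ε₁ L C G)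
    (hS : S.IsAdmissible) (hnk : n ≤ S.k)
    (hθ : ∀ j < S.N, ContDiffAt ℝ n (S.θ (j + 1)) a)
    {ψ : ℕ → ℝ × EuclideanSpace ℝ (Fin d) × ℝ → EuclideanSpace ℝ (Fin d)}
    {τ : ℕ → EuclideanSpace ℝ (Fin d) × ℝ → ℝ} (hψ : ∀ j, ContDiff ℝ n (ψ j))
    (hτ : ∀ j ≤ S.N + 1, ContDiff ℝ n (τ j))
    (hY : ∀ᶠ p in 𝓝 (a, (0 : ℝ)),
      S.IsOrbit a r G p.2 p.1 (fun j t => p.1 + p.2 • ψ j (t, p)) fun j => τ j p) :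
    ∀ᶠ x in 𝓝 a, S.IsPiecewiseFlow n (2 * S.T) x (fun j q => x + q.2 • ψ j (q.1, x, q.2))
      (fun j ε => τ j (x, ε)) G := by
  have hT := hS.T_pos
  have hθ' : ∀ᶠ x in 𝓝 a, ∀ j < S.N, ContDiffAt ℝ n (S.θ (j + 1)) x :=
    (eventually_all_finite (finite_Iio S.N)).2 fun j hj =>
      (hθ j hj).eventually (by exact_mod_cast WithTop.coe_ne_top)
  filter_upwards [hY.curry_nhds, hθ', Metric.ball_mem_nhds a hG.r_pos] with x hYx hθx hx
  have hxD : x ∈ S.D := hG.closedBall_subset (Metric.ball_subset_closedBall hx)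
  have hDx := hS.isOpen_D.mem_nhds hxD
  have habs : ∀ t ∈ Ioo (-(2 * S.T)) (2 * S.T), |t| ≤ 2 * S.T := fun t ht =>
    (abs_lt.2 ht).le
  refine ⟨by linarith, fun j hj i hi hik t => ?_, fun j hj t => ?_, hθx, fun j hj => ?_,
    fun j _ => ?_, hG.contDiff_G, fun j hj => ?_, fun j _ t => ?_, fun j hj t ht => ?_,
    fun j hj s hs t ht => ?_, ?_, fun j hj => ?_, fun j hj => ?_⟩
  · have h1 : ContDiffAt ℝ S.k (fun p : ℝ × EuclideanSpace ℝ (Fin d) => S.F i j p.1 p.2) (t, x) :=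
      (hS.F_contDiff i hi hik j hj).contDiffAt (prod_mem_nhds univ_mem hDx)
    exact (h1.of_le (by exact_mod_cast hnk)).comp x
      (contDiff_const.prodMk contDiff_id).contDiffAt
  · have h1 : ContDiffAt ℝ S.k
        (fun p : ℝ × EuclideanSpace ℝ (Fin d) × ℝ => S.R j p.1 p.2.1 p.2.2) (t, x, 0) :=
      (hS.R_contDiff j hj).contDiffAt (prod_mem_nhds univ_mem (prod_mem_nhds hDx
        (Ioo_mem_nhds (neg_lt_zero.2 hS.ε₀_pos) hS.ε₀_pos)))
    exact h1.continuousAt.comp (f := fun p : EuclideanSpace ℝ (Fin d) × ℝ => (t, p))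
      (by fun_prop)
  · have h1 := hS.θ_mem_Icc (j := j + 1) (by omega) hxD
    exact ⟨by linarith [h1.1], by linarith [h1.2]⟩
  · have := hψ j
    fun_prop
  · exact ((hτ (j + 1) (by omega)).comp (contDiff_const.prodMk contDiff_id)).contDiffAt
  · simp
  · have h1 : ∀ᶠ p : EuclideanSpace ℝ (Fin d) × ℝ in 𝓝 (x, 0), p.1 ∈ Metric.ball a r :=
      continuousAt_fst.eventually (Metric.isOpen_ball.mem_nhds hx)
    have h2 : ∀ᶠ p : EuclideanSpace ℝ (Fin d) × ℝ in 𝓝 (x, 0), |p.2| < ε₁ :=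
      (continuous_snd.abs.tendsto (x, (0 : ℝ))).eventually_lt_const (by simpa using hG.ε₁_pos)
    filter_upwards [h1, h2] with p hp1 hp2
    exact hG.G_eq j hj t p.1 p.2 (habs t ht) (Metric.ball_subset_closedBall hp1) hp2
  · filter_upwards [hYx] with ε hε
    rw [← intervalIntegral.integral_smul]
    exact hε.sub_eq j hj s t (habs s hs) (habs t ht)
  · filter_upwards [hYx] with ε hε using hε.init
  · filter_upwards [hYx] with ε hε using hε.crossing j hj
  · filter_upwards [hYx] with ε hε using hε.matching j hj

/-- The expansion of the displacement `ε ψ_N(T,x,ε)` has the Melnikov functions as coefficients. If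
the first `n - 1` of them vanish, then it is `ε^n h(x,ε)` with `h(·,0) = M_n` near `a`. -/
theorem IsLocalization.exists_displacement_eq (hG : S.IsLocalization n a r ε₁ L C G)
    (hS : S.IsAdmissible) (hn : 1 ≤ n) (hnk : n ≤ S.k)
    (hθ : ∀ j < S.N, ContDiffAt ℝ n (S.θ (j + 1)) a)
    (hvanish : ∀ i, 1 ≤ i → i < n → ∀ x ∈ S.D, S.melnikov i x = 0)
    {ψ : ℕ → ℝ × EuclideanSpace ℝ (Fin d) × ℝ → EuclideanSpace ℝ (Fin d)}
    {τ : ℕ → EuclideanSpace ℝ (Fin d) × ℝ → ℝ} (hψ : ∀ j, ContDiff ℝ n (ψ j))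
    (hτ : ∀ j ≤ S.N + 1, ContDiff ℝ n (τ j))
    (hY : ∀ᶠ p in 𝓝 (a, (0 : ℝ)),
      S.IsOrbit a r G p.2 p.1 (fun j t => p.1 + p.2 • ψ j (t, p)) fun j => τ j p) :
    ∃ h : EuclideanSpace ℝ (Fin d) × ℝ → EuclideanSpace ℝ (Fin d), ContDiff ℝ 1 h ∧
      (∀ᶠ x in 𝓝 a, h (x, 0) = S.melnikov n x) ∧
      ∀ᶠ p in 𝓝 (a, (0 : ℝ)), ψ S.N (S.T, p) = p.2 ^ (n - 1) • h p := by
  have hT := hS.T_pos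
  have hTmem : S.T ∈ Ioo (-(2 * S.T)) (2 * S.T) := ⟨by linarith, by linarith⟩
  have hf : ContDiff ℝ n fun p : EuclideanSpace ℝ (Fin d) × ℝ => ψ S.N (S.T, p) :=
    (hψ S.N).comp (contDiff_const.prodMk contDiff_id)
  obtain ⟨c, hc⟩ := exists_taylor_snd hf
  obtain ⟨-, h, hh, hh0, hψh⟩ := hc (n - 1) (Nat.sub_le n 1)
  have hM : ∀ᶠ x in 𝓝 a, ∀ i, 1 ≤ i → i ≤ n → S.melnikov i x = c (i - 1) x := by
    filter_upwards [hG.eventually_isPiecewiseFlow hS hnk hθ hψ hτ hY] with x hx i hi hin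
    have h1 : HasJet (n - 1) (fun ε => ψ S.N (S.T, x, ε)) fun i => c i x :=
      HasJet.of_taylor (f := fun p : EuclideanSpace ℝ (Fin d) × ℝ => ψ S.N (S.T, p))
        hh.continuous hh0 hψh x
    have h2 : HasJet n (fun ε => ε • ψ S.N (S.T, x, ε))
        fun i => Nat.casesOn i 0 fun i => c i x := by
      have := h1.smul_id (c' := fun i => Nat.casesOn i 0 fun i => c i x) rfl fun i _ => rfl
      rwa [Nat.sub_add_cancel hn] at this
    have h3 : HasJet n (fun _ : ℝ => x) fun i => if i = 0 then x else 0 :=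
      (HasJet.polynomial n _).congr_fun (Eventually.of_forall fun ε => by simp)
    rw [melnikov, hx.z_eq hn hnk le_rfl hTmem (h3.add h2) hi hin, smul_smul,
      one_div_mul_cancel (by positivity), one_smul, if_neg (by omega), zero_add]
    obtain ⟨i, rfl⟩ := Nat.exists_eq_add_of_le' hi
    rfl
  refine ⟨h, ?_, ?_, ?_⟩
  · rw [Nat.sub_sub_self hn] at hh
    exact_mod_cast hh
  · filter_upwards [hM] with x hx
    rw [hh0, hx n hn le_rfl]
  · have hD : ∀ᶠ x in 𝓝 a, x ∈ S.D := by
      filter_upwards [Metric.closedBall_mem_nhds a hG.r_pos] with x hx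
        using hG.closedBall_subset hx
    filter_upwards [(continuous_fst.tendsto (a, (0 : ℝ))).eventually (hM.and hD)] with p hp
    rw [hψh p.1 p.2, Finset.sum_eq_zero, zero_add]
    intro m hm
    have hm' := Finset.mem_range.1 hm
    have h1 := hp.1 (m + 1) (by omega) (by omega)
    rw [hvanish (m + 1) (by omega) (by omega) p.1 hp.2, Nat.add_sub_cancel] at h1
    rw [← h1, smul_zero]

end SwitchedSystem

/-! ### Filippov solutions near `a` -/

/-- Uniqueness for the integral equation `y(t) = y(b) + ∫_b^t g(u, y(u)) du`. -/
theorem eqOn_Icc_of_integral_eq {E : Type*} [NormedAddCommGroup E] [NormedSpace ℝ E]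
    [CompleteSpace E] {g : ℝ → E → E} (hg : Continuous g.uncurry) {K : NNReal}
    (hK : ∀ t, LipschitzWith K (g t)) {b c : ℝ} {y w : ℝ → E} (hy : Continuous y)
    (hw : Continuous w) (hyg : ∀ t ∈ Icc b c, y t - y b = ∫ u in b..t, g u (y u))
    (hwg : ∀ t ∈ Icc b c, w t - w b = ∫ u in b..t, g u (w u)) (h : y b = w b) :
    EqOn y w (Icc b c) := by
  have hderiv : ∀ f : ℝ → E, Continuous f →
      (∀ t ∈ Icc b c, f t - f b = ∫ u in b..t, g u (f u)) →
      ∀ t ∈ Ico b c, HasDerivWithinAt f (g t (f t)) (Ici t) t := by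
    intro f hf hfg t ht
    have hc : Continuous fun u => g u (f u) := hg.comp (continuous_id.prodMk hf)
    have h1 : HasDerivAt (fun t => f b + ∫ u in b..t, g u (f u)) (g t (f t)) t :=
      (hc.integral_hasStrictDerivAt b t).hasDerivAt.const_add _
    refine h1.hasDerivWithinAt.congr_of_eventuallyEq ?_ ?_
    · filter_upwards [Ico_mem_nhdsGE ht.2] with s hs
      rw [← hfg s ⟨ht.1.trans hs.1, hs.2.le⟩, add_sub_cancel]
    · rw [← hfg t ⟨ht.1, ht.2.le⟩, add_sub_cancel]
  exact ODE_solution_unique_of_mem_Icc_right (s := fun _ => univ)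
    (fun t _ => (hK t).lipschitzOnWith) hy.continuousOn (hderiv y hy hyg) (fun _ _ => mem_univ _)
    hw.continuousOn (hderiv w hw hwg) (fun _ _ => mem_univ _) h

namespace SwitchedSystem

variable {d : ℕ} {S : SwitchedSystem d} {n : ℕ} {a : EuclideanSpace ℝ (Fin d)} {r ε₁ : ℝ}
  {L : NNReal} {C : ℝ}
  {G : ℕ → ℝ × EuclideanSpace ℝ (Fin d) × ℝ → EuclideanSpace ℝ (Fin d)} {ε : ℝ}

/-- In the interior of a zone the Filippov set is a singleton. -/
theorem IsAdmissible.eq_field_of_mem_filippovSet (hS : S.IsAdmissible) {j : ℕ} (hj : j ≤ S.N)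
    {t : ℝ} {x v : EuclideanSpace ℝ (Fin d)} (hx : x ∈ S.D) (h1 : S.θ j x < t)
    (h2 : t < S.θ (j + 1) x) (hv : v ∈ S.filippovSet ε t x) : v = S.field j ε t x := by
  have hT := hS.T_pos
  have hsub : {v | ∃ j ≤ S.N, ∃ n : ℤ, S.θ j x ≤ t - n * S.T ∧ t - n * S.T ≤ S.θ (j + 1) x ∧
      v = S.field j ε t x} ⊆ {S.field j ε t x} := by
    rintro v ⟨i, hi, m, hm1, hm2, rfl⟩
    have ht0 : 0 < t := (hS.θ_mem_Icc (j := j) (by omega) hx).1.trans_lt h1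
    have htT : t < S.T := h2.trans_le (hS.θ_mem_Icc (j := j + 1) (by omega) hx).2
    have hi0 := (hS.θ_mem_Icc (j := i) (by omega) hx).1.trans hm1
    have hiT := hm2.trans (hS.θ_mem_Icc (j := i + 1) (by omega) hx).2
    have hm : m = 0 := by
      have h3 : (m : ℝ) < 1 := by
        by_contra! h
        nlinarith
      have h4 : (-1 : ℝ) < m := by
        by_contra! h
        nlinarith
      have h5 : m < 1 := by exact_mod_cast h3
      have h6 : -1 < m := by exact_mod_cast h4
      omega
    subst hm
    simp only [Int.cast_zero, zero_mul, sub_zero] at hm1 hm2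
    rcases lt_trichotomy i j with hij | rfl | hij
    · linarith [hS.θ_le_of_le (i := i + 1) (j := j) hij (by omega) hx]
    · rfl
    · linarith [hS.θ_le_of_le (i := j + 1) (j := i) hij (by omega) hx]
  exact convexHull_min hsub (convex_singleton _) hv

theorem IsLocalization.field_eq (hG : S.IsLocalization n a r ε₁ L C G) (hε : |ε| < ε₁) {j : ℕ}
    (hj : j ≤ S.N) {t : ℝ} (ht : |t| ≤ 2 * S.T) {x : EuclideanSpace ℝ (Fin d)}
    (hx : x ∈ Metric.closedBall a r) : S.field j ε t x = ε • G j (t, x, ε) := by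
  rw [hG.G_eq j hj t x ε ht hx hε, smul_rescaledField]

theorem IsLocalization.norm_le_of_mem_filippovSet (hG : S.IsLocalization n a r ε₁ L C G)
    (hε : |ε| < ε₁) {t : ℝ} (ht : |t| ≤ 2 * S.T) {x v : EuclideanSpace ℝ (Fin d)}
    (hx : x ∈ Metric.closedBall a r) (hv : v ∈ S.filippovSet ε t x) : ‖v‖ ≤ |ε| * C := by
  have hsub : {v | ∃ j ≤ S.N, ∃ n : ℤ, S.θ j x ≤ t - n * S.T ∧ t - n * S.T ≤ S.θ (j + 1) x ∧
      v = S.field j ε t x} ⊆ Metric.closedBall 0 (|ε| * C) := by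
    rintro v ⟨j, hj, m, -, -, rfl⟩
    rw [mem_closedBall_zero_iff, hG.field_eq hε hj ht hx, norm_smul, Real.norm_eq_abs]
    exact mul_le_mul_of_nonneg_left (hG.norm_G_le j hj _) (abs_nonneg ε)
  exact mem_closedBall_zero_iff.1 (convexHull_min hsub (convex_closedBall _ _) hv)

/-- Along a slow curve, `t - θ_j` is strictly increasing, so every switching surface is crossed
transversally and at most once. -/
theorem IsLocalization.strictMonoOn_sub_θ (hG : S.IsLocalization n a r ε₁ L C G)
    (hslow : |ε| * C * L < 1) {j : ℕ} (hj : j ≤ S.N + 1) {I : Set ℝ}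
    {y : ℝ → EuclideanSpace ℝ (Fin d)} (hy : ∀ t ∈ I, y t ∈ Metric.closedBall a r)
    (hyC : ∀ s ∈ I, ∀ t ∈ I, ‖y t - y s‖ ≤ |ε| * C * |t - s|) :
    StrictMonoOn (fun t => t - S.θ j (y t)) I := by
  intro s hs t ht hst
  have h1 := (hG.lipschitzOnWith_θ j hj).norm_sub_le (hy t ht) (hy s hs)
  have h2 := hyC s hs t ht
  rw [abs_of_pos (sub_pos.2 hst)] at h2
  have h3 : S.θ j (y t) - S.θ j (y s) ≤ L * (|ε| * C * (t - s)) :=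
    (le_abs_self _).trans (h1.trans (mul_le_mul_of_nonneg_left h2 L.2))
  have h4 : L * (|ε| * C * (t - s)) < t - s := by
    calc L * (|ε| * C * (t - s)) = |ε| * C * L * (t - s) := by ring
      _ < 1 * (t - s) := mul_lt_mul_of_pos_right hslow (sub_pos.2 hst)
      _ = t - s := one_mul _
  simp only
  linarith

theorem abs_le_two_mul_of_mem_Icc (hT : 0 < S.T) {t : ℝ} (ht : t ∈ Icc 0 S.T) : |t| ≤ 2 * S.T := by
  rw [abs_of_nonneg ht.1]
  linarith [ht.2]

namespace IsOrbit

variable {x : EuclideanSpace ℝ (Fin d)} {Y : ℕ → ℝ → EuclideanSpace ℝ (Fin d)} {σ : ℕ → ℝ}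

theorem σ_le_of_le (hY : S.IsOrbit a r G ε x Y σ) {i j : ℕ} (hij : i ≤ j) (hj : j ≤ S.N + 1) :
    σ i ≤ σ j := by
  induction j, hij using Nat.le_induction with
  | base => exact le_rfl
  | succ j hij ih => exact (ih (by omega)).trans (hY.σ_lt j (by omega)).le

theorem σ_mem_Icc (hY : S.IsOrbit a r G ε x Y σ) {j : ℕ} (hj : j ≤ S.N + 1) :
    σ j ∈ Icc 0 S.T := by
  rw [← hY.σ_zero, ← hY.σ_last]
  exact ⟨hY.σ_le_of_le (Nat.zero_le j) hj, hY.σ_le_of_le hj le_rfl⟩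

theorem mem_closedBall (hY : S.IsOrbit a r G ε x Y σ) (hT : 0 < S.T) {j : ℕ} (hj : j ≤ S.N)
    {t : ℝ} (ht : t ∈ Icc 0 S.T) : Y j t ∈ Metric.closedBall a r :=
  Metric.ball_subset_closedBall (hY.mem_ball j hj t (abs_le_two_mul_of_mem_Icc hT ht))

theorem norm_sub_le (hY : S.IsOrbit a r G ε x Y σ) (hG : S.IsLocalization n a r ε₁ L C G)
    (hT : 0 < S.T) {j : ℕ} (hj : j ≤ S.N) {s t : ℝ} (hs : s ∈ Icc 0 S.T) (ht : t ∈ Icc 0 S.T) :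
    ‖Y j t - Y j s‖ ≤ |ε| * C * |t - s| := by
  rw [hY.sub_eq j hj s t (abs_le_two_mul_of_mem_Icc hT hs) (abs_le_two_mul_of_mem_Icc hT ht)]
  refine intervalIntegral.norm_integral_le_of_norm_le_const fun u _ => ?_
  rw [norm_smul, Real.norm_eq_abs]
  exact mul_le_mul_of_nonneg_left (hG.norm_G_le j hj _) (abs_nonneg ε)

theorem σ_eq_right (hY : S.IsOrbit a r G ε x Y σ) (hG : S.IsLocalization n a r ε₁ L C G)
    (hS : S.IsAdmissible) {j : ℕ} (hj : j ≤ S.N) : σ (j + 1) = S.θ (j + 1) (Y j (σ (j + 1))) := by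
  rcases hj.lt_or_eq with h | rfl
  · exact hY.crossing j h
  · rw [hY.σ_last, hS.θ_last _ (hG.closedBall_subset
      (hY.mem_closedBall hS.T_pos le_rfl ⟨hS.T_pos.le, le_rfl⟩))]

theorem σ_eq_left (hY : S.IsOrbit a r G ε x Y σ) (hG : S.IsLocalization n a r ε₁ L C G)
    (hS : S.IsAdmissible) {j : ℕ} (hj : j ≤ S.N) : σ j = S.θ j (Y j (σ j)) := by
  cases j with
  | zero =>
    rw [hY.σ_zero, hS.θ_zero _ (hG.closedBall_subset
      (hY.mem_closedBall hS.T_pos hj ⟨le_rfl, hS.T_pos.le⟩))]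
  | succ j => rw [hY.matching j hj, ← hY.crossing j hj]

theorem strictMonoOn_sub_θ (hY : S.IsOrbit a r G ε x Y σ) (hG : S.IsLocalization n a r ε₁ L C G)
    (hT : 0 < S.T) (hslow : |ε| * C * L < 1) {j : ℕ} (hj : j ≤ S.N) {i : ℕ} (hi : i ≤ S.N + 1) :
    StrictMonoOn (fun t => t - S.θ i (Y j t)) (Icc 0 S.T) :=
  hG.strictMonoOn_sub_θ hslow hi (fun _ ht => hY.mem_closedBall hT hj ht)
    fun _ hs _ ht => hY.norm_sub_le hG hT hj hs ht

end IsOrbit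

theorem IsSolution.exists_integral {y : ℝ → EuclideanSpace ℝ (Fin d)} (hy : S.IsSolution ε y) :
    ∃ v : ℝ → EuclideanSpace ℝ (Fin d), (∀ s t, IntervalIntegrable v volume s t) ∧
      (∀ s t, y t - y s = ∫ u in s..t, v u) ∧ ∀ᵐ t, v t ∈ S.filippovSet ε t (y t) := by
  obtain ⟨v, hv, hyv, hvF⟩ := hy.2
  have hvi : ∀ s t, IntervalIntegrable v volume s t := fun s t =>
    ⟨(hv.integrableOn_isCompact isCompact_Icc).mono_set Ioc_subset_Icc_self,
      (hv.integrableOn_isCompact isCompact_Icc).mono_set Ioc_subset_Icc_self⟩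
  refine ⟨v, hvi, fun s t => ?_, hvF⟩
  rw [hyv t, hyv s, add_sub_add_left_eq_sub,
    intervalIntegral.integral_interval_sub_left (hvi _ _) (hvi _ _)]

theorem IsSolution.continuous {y : ℝ → EuclideanSpace ℝ (Fin d)} (hy : S.IsSolution ε y) :
    Continuous y := by
  obtain ⟨v, hv, hyv, -⟩ := hy.exists_integral
  have h1 : y = fun t => y 0 + ∫ u in (0 : ℝ)..t, v u := by
    funext t
    rw [← hyv 0 t, add_sub_cancel]
  rw [h1]
  exact continuous_const.add (intervalIntegral.continuous_primitive hv 0)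

theorem IsSolution.norm_sub_le (hG : S.IsLocalization n a r ε₁ L C G) (hT : 0 < S.T)
    (hε : |ε| < ε₁) {y : ℝ → EuclideanSpace ℝ (Fin d)} (hy : S.IsSolution ε y) {s t : ℝ}
    (hs : 0 ≤ s) (hst : s ≤ t) (ht : t ≤ S.T) (hyr : ∀ u ∈ Ioo s t, y u ∈ Metric.closedBall a r) :
    ‖y t - y s‖ ≤ |ε| * C * |t - s| := by
  obtain ⟨v, -, hyv, hvF⟩ := hy.exists_integral
  rw [hyv s t]
  refine intervalIntegral.norm_integral_le_of_norm_le_const_ae ?_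
  filter_upwards [hvF, volume.ae_ne t] with u hu hut hust
  rw [uIoc_of_le hst] at hust
  exact hG.norm_le_of_mem_filippovSet hε
    (abs_le_two_mul_of_mem_Icc hT ⟨hs.trans hust.1.le, hust.2.trans ht⟩)
    (hyr u ⟨hust.1, lt_of_le_of_ne hust.2 hut⟩) hu

/-- A priori bound: for small `ε`, a solution that starts near `a` stays near `a` on `[0,T]`. -/
theorem IsSolution.mem_ball (hG : S.IsLocalization n a r ε₁ L C G) (hT : 0 < S.T)
    (hε : |ε| < ε₁) (hfar : |ε| * C * S.T < r / 2) {y : ℝ → EuclideanSpace ℝ (Fin d)}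
    (hy : S.IsSolution ε y) (hy0 : y 0 ∈ Metric.ball a (r / 2)) {t : ℝ} (ht : t ∈ Icc 0 S.T) :
    y t ∈ Metric.ball a r := by
  by_contra hyt
  have hC : 0 ≤ C := (norm_nonneg _).trans (hG.norm_G_le 0 (Nat.zero_le _) 0)
  -- the first time at which the ball is left
  have hK : IsCompact (Icc 0 S.T ∩ y ⁻¹' (Metric.ball a r)ᶜ) :=
    isCompact_Icc.inter_right (Metric.isOpen_ball.isClosed_compl.preimage hy.continuous)
  obtain ⟨s, ⟨hsT, hs⟩, hmin⟩ := hK.exists_isLeast ⟨t, ht, hyt⟩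
  have h1 : ‖y s - y 0‖ ≤ |ε| * C * |s - 0| := by
    refine IsSolution.norm_sub_le hG hT hε hy le_rfl hsT.1 hsT.2 fun u hu => ?_
    by_contra hu'
    have h2 := hmin ⟨⟨hu.1.le, hu.2.le.trans hsT.2⟩,
      fun h => hu' (Metric.ball_subset_closedBall h)⟩
    exact absurd hu.2 h2.not_gt
  rw [sub_zero, abs_of_nonneg hsT.1] at h1
  have h3 : |ε| * C * s ≤ |ε| * C * S.T := by
    have := hsT.2
    gcongr
  rw [Metric.mem_ball, dist_eq_norm] at hy0
  refine hs ?_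
  rw [Metric.mem_ball, dist_eq_norm]
  have h4 := norm_sub_le_norm_sub_add_norm_sub (y s) (y 0) a
  linarith

/-- A Filippov solution that stays near `a` on `[0,T]` follows the pieces of the orbit. -/
theorem IsOrbit.eq_of_isSolution (hG : S.IsLocalization n a r ε₁ L C G) (hS : S.IsAdmissible)
    (hε : |ε| < ε₁) (hslow : |ε| * C * L < 1) {y : ℝ → EuclideanSpace ℝ (Fin d)}
    (hy : S.IsSolution ε y) (hyr : ∀ t ∈ Icc 0 S.T, y t ∈ Metric.ball a r)
    {Y : ℕ → ℝ → EuclideanSpace ℝ (Fin d)} {σ : ℕ → ℝ} (hY : S.IsOrbit a r G ε (y 0) Y σ)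
    {j : ℕ} (hj : j ≤ S.N) {t : ℝ} (ht : t ∈ Icc (σ j) (σ (j + 1))) : y t = Y j t := by
  have hT := hS.T_pos
  have hyr' : ∀ t ∈ Icc 0 S.T, y t ∈ Metric.closedBall a r := fun t ht =>
    Metric.ball_subset_closedBall (hyr t ht)
  have hyD : ∀ t, y t ∈ S.D := hy.1
  have hyC : ∀ s ∈ Icc 0 S.T, ∀ t ∈ Icc 0 S.T, ‖y t - y s‖ ≤ |ε| * C * |t - s| := by
    have key : ∀ s ∈ Icc 0 S.T, ∀ t ∈ Icc 0 S.T, s ≤ t → ‖y t - y s‖ ≤ |ε| * C * |t - s| :=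
      fun s hs t ht hst => IsSolution.norm_sub_le hG hT hε hy hs.1 hst ht.2
        fun u hu => hyr' u ⟨hs.1.trans hu.1.le, hu.2.le.trans ht.2⟩
    intro s hs t ht
    rcases le_total s t with h | h
    · exact key s hs t ht h
    · rw [norm_sub_rev, abs_sub_comm]
      exact key t ht s hs h
  have hmono : ∀ j ≤ S.N + 1, StrictMonoOn (fun t => t - S.θ j (y t)) (Icc 0 S.T) := fun j hj =>
    hG.strictMonoOn_sub_θ hslow hj hyr' hyC
  obtain ⟨v, hv, hyv, hvF⟩ := hy.exists_integral
  have hstep : ∀ j ≤ S.N, y (σ j) = Y j (σ j) → EqOn y (Y j) (Icc (σ j) (σ (j + 1))) := by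
    intro j hj hyj
    have hσj := hY.σ_mem_Icc (j := j) (by omega)
    have hσj' := hY.σ_mem_Icc (j := j + 1) (by omega)
    have hθj : σ j = S.θ j (y (σ j)) := by
      rw [hyj]
      exact hY.σ_eq_left hG hS hj
    -- the time `s` at which `y` leaves the zone `j`
    have hcont : ContinuousOn (fun t => t - S.θ (j + 1) (y t)) (Icc (σ j) S.T) := by
      refine continuousOn_id.sub ((hG.lipschitzOnWith_θ (j + 1) (by omega)).continuousOn.comp
        hy.continuous.continuousOn fun t ht => hyr' t ⟨hσj.1.trans ht.1, ht.2⟩)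
    have hneg : σ j - S.θ (j + 1) (y (σ j)) < 0 := by
      have := hS.θ_lt j hj _ (hyD (σ j))
      linarith
    have hpos : 0 ≤ S.T - S.θ (j + 1) (y S.T) :=
      sub_nonneg.2 (hS.θ_mem_Icc (by omega) (hyD S.T)).2
    obtain ⟨s, hs, hs0⟩ := intermediate_value_Icc hσj.2 hcont ⟨hneg.le, hpos⟩
    simp only at hs0
    have hsσ : σ j < s := lt_of_le_of_ne hs.1 fun h => by
      rw [← h] at hs0
      linarith
    have hsT : s ∈ Icc 0 S.T := ⟨hσj.1.trans hs.1, hs.2⟩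
    have hzone : ∀ u ∈ Ioo (σ j) s, S.θ j (y u) < u ∧ u < S.θ (j + 1) (y u) := by
      intro u hu
      have huT : u ∈ Icc 0 S.T := ⟨hσj.1.trans hu.1.le, hu.2.le.trans hs.2⟩
      have h1 := hmono j (by omega) hσj huT hu.1
      have h2 := hmono (j + 1) (by omega) huT hsT hu.2
      simp only at h1 h2
      constructor <;> linarith
    have hfield : ∀ᵐ u, u ∈ Ioo (σ j) s → v u = ε • G j (u, y u, ε) := by
      filter_upwards [hvF] with u hu hus
      have huT : u ∈ Icc 0 S.T := ⟨hσj.1.trans hus.1.le, hus.2.le.trans hs.2⟩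
      rw [← hG.field_eq hε hj (abs_le_two_mul_of_mem_Icc hT huT) (hyr' u huT)]
      exact hS.eq_field_of_mem_filippovSet hj (hyD u) (hzone u hus).1 (hzone u hus).2 hu
    have hyint : ∀ t ∈ Icc (σ j) s, y t - y (σ j) = ∫ u in (σ j)..t, ε • G j (u, y u, ε) := by
      intro t ht
      rw [hyv]
      refine intervalIntegral.integral_congr_ae ?_
      filter_upwards [hfield, volume.ae_ne s] with u hu hus hut
      rw [uIoc_of_le ht.1] at hut
      exact hu ⟨hut.1, lt_of_le_of_ne (hut.2.trans ht.2) hus⟩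
    have hYint : ∀ t ∈ Icc (σ j) s,
        Y j t - Y j (σ j) = ∫ u in (σ j)..t, ε • G j (u, Y j u, ε) := fun t ht =>
      hY.sub_eq j hj _ _ (abs_le_two_mul_of_mem_Icc hT hσj)
        (abs_le_two_mul_of_mem_Icc hT ⟨hσj.1.trans ht.1, ht.2.trans hs.2⟩)
    have hGc := (hG.contDiff_G j hj).continuous
    have heq : EqOn y (Y j) (Icc (σ j) s) := by
      refine eqOn_Icc_of_integral_eq (g := fun u x => ε • G j (u, x, ε)) (K := ‖ε‖₊ * L)
        ?_ (fun u => ?_) hy.continuous (hY.continuous j hj) hyint hYint hyj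
      · change Continuous fun p : ℝ × EuclideanSpace ℝ (Fin d) => ε • G j (p.1, p.2, ε)
        fun_prop
      · refine LipschitzWith.of_dist_le_mul fun x x' => ?_
        have h1 := (hG.lipschitzWith_G j hj).dist_le_mul (u, x, ε) (u, x', ε)
        rw [dist_smul₀, NNReal.coe_mul, coe_nnnorm, mul_assoc]
        refine mul_le_mul_of_nonneg_left (h1.trans_eq ?_) (norm_nonneg _)
        simp [Prod.dist_eq]
    -- by uniqueness of the crossing time, `s = σ_{j+1}`
    have hsσ' : s = σ (j + 1) := by
      refine (hY.strictMonoOn_sub_θ hG hT hslow hj (i := j + 1) (by omega)).injOn hsT hσj' ?_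
      rw [← heq ⟨hs.1, le_rfl⟩, hs0, ← hY.σ_eq_right hG hS hj, sub_self]
    rwa [← hsσ']
  have hinit : ∀ j, j ≤ S.N → y (σ j) = Y j (σ j) := by
    intro j
    induction j with
    | zero => exact fun _ => by rw [hY.σ_zero, hY.init]
    | succ j ih =>
      intro hj
      rw [hY.matching j hj]
      exact hstep j (by omega) (ih (by omega)) ⟨(hY.σ_lt j (by omega)).le, le_rfl⟩
  exact hstep j hj (hinit j hj) ht

end SwitchedSystem

/-! ### Orbits and periodic solutions -/

namespace SwitchedSystem

variable {d : ℕ} {S : SwitchedSystem d} {n : ℕ} {a : EuclideanSpace ℝ (Fin d)} {r ε₁ : ℝ}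
  {L : NNReal} {C : ℝ}
  {G : ℕ → ℝ × EuclideanSpace ℝ (Fin d) × ℝ → EuclideanSpace ℝ (Fin d)} {ε : ℝ}

theorem IsAdmissible.field_sub_zsmul (hS : S.IsAdmissible) {j : ℕ} (hj : j ≤ S.N)
    {x : EuclideanSpace ℝ (Fin d)} (hx : x ∈ S.D) (hε : |ε| < S.ε₀) (t : ℝ) (m : ℤ) :
    S.field j ε (t - m • S.T) x = S.field j ε t x := by
  have h : Function.Periodic (fun t => S.field j ε t x) S.T := by
    intro t
    simp only [field]
    rw [hS.R_periodic j hj t x hx ε (abs_lt.1 hε)]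
    congr 1
    refine Finset.sum_congr rfl fun i hi => ?_
    rw [Finset.mem_Icc] at hi
    rw [hS.F_periodic i hi.1 hi.2 j hj t x hx]
  exact h.sub_zsmul_eq m

theorem exists_mem_Ico_succ {σ : ℕ → ℝ} {s : ℝ} (h0 : σ 0 ≤ s) {m : ℕ} (hm : s < σ m) :
    ∃ j < m, s ∈ Ico (σ j) (σ (j + 1)) := by
  induction m with
  | zero => exact absurd hm h0.not_gt
  | succ m ih =>
    rcases lt_or_ge s (σ m) with h | h
    · obtain ⟨j, hj, hs⟩ := ih h
      exact ⟨j, hj.trans (Nat.lt_succ_self m), hs⟩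
    · exact ⟨m, Nat.lt_succ_self m, h, hm⟩

/-- An orbit whose last piece returns to the initial value gives a periodic solution. -/
theorem IsOrbit.exists_isPeriodicSolution {x : EuclideanSpace ℝ (Fin d)}
    {Y : ℕ → ℝ → EuclideanSpace ℝ (Fin d)} {σ : ℕ → ℝ} (hY : S.IsOrbit a r G ε x Y σ)
    (hG : S.IsLocalization n a r ε₁ L C G) (hS : S.IsAdmissible) (hε : |ε| < ε₁)
    (hslow : |ε| * C * L < 1) (hper : Y S.N S.T = x) :
    ∃ ξ, S.IsPeriodicSolution ε ξ ∧ ξ 0 = x ∧ ∀ t ∈ Icc 0 S.T, ξ t ∈ Metric.ball a r := by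
  have hT := hS.T_pos
  let g : ℕ → ℝ → EuclideanSpace ℝ (Fin d) := fun j t => ε • G j (t, Y j t, ε)
  have hg : ∀ j ≤ S.N, Continuous (g j) := by
    intro j hj
    have h1 := (hG.contDiff_G j hj).continuous
    have h2 := hY.continuous j hj
    fun_prop
  let v₀ : ℝ → EuclideanSpace ℝ (Fin d) := fun t =>
    ∑ j ∈ Finset.range (S.N + 1), (Ico (σ j) (σ (j + 1))).indicator (g j) t
  have hv₀ : ∀ j ≤ S.N, ∀ s ∈ Ico (σ j) (σ (j + 1)), v₀ s = g j s := by
    intro j hj s hs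
    rw [← indicator_of_mem hs (g j)]
    refine Finset.sum_eq_single j (fun i hi hij => ?_) fun h =>
      absurd (Finset.mem_range.2 (by omega)) h
    have hi' := Finset.mem_range.1 hi
    refine indicator_of_notMem (fun hs' => ?_) _
    rcases hij.lt_or_gt with h | h
    · exact absurd (hs'.2.trans_le ((hY.σ_le_of_le h (by omega)).trans hs.1)) (lt_irrefl s)
    · exact absurd (hs.2.trans_le ((hY.σ_le_of_le h (by omega)).trans hs'.1)) (lt_irrefl s)
  have hv₀i : Integrable v₀ := by
    refine integrable_finsetSum _ fun j hj => ?_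
    have hj' := Finset.mem_range.1 hj
    exact (((hg j (by omega)).integrableOn_Icc).mono_set Ico_subset_Icc_self).integrable_indicator
      measurableSet_Ico
  -- the periodic extension of the velocity
  let v : ℝ → EuclideanSpace ℝ (Fin d) := fun t => v₀ (toIcoMod hT 0 t)
  have hvper : Function.Periodic v S.T := fun t => by simp only [v, toIcoMod_add_right]
  have hmod : ∀ t ∈ Ico 0 S.T, toIcoMod hT 0 t = t := fun t ht =>
    (toIcoMod_eq_self hT).2 (by rwa [zero_add])
  have hvi : ∀ s t, IntervalIntegrable v volume s t := by
    refine hvper.intervalIntegrable₀ hT.ne' ?_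
    rw [intervalIntegrable_iff_integrableOn_Ico_of_le hT.le]
    exact hv₀i.integrableOn.congr_fun (fun t ht => by simp only [v, hmod t ht]) measurableSet_Ico
  let ξ : ℝ → EuclideanSpace ℝ (Fin d) := fun t => x + ∫ s in (0 : ℝ)..t, v s
  have hξsub : ∀ s t, ξ t - ξ s = ∫ u in s..t, v u := fun s t => by
    simp only [ξ, add_sub_add_left_eq_sub]
    exact intervalIntegral.integral_interval_sub_left (hvi _ _) (hvi _ _)
  have hξ0 : ξ 0 = x := by simp [ξ]
  have hstep : ∀ j ≤ S.N, ξ (σ j) = Y j (σ j) →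
      ∀ t ∈ Icc (σ j) (σ (j + 1)), ξ t = Y j t := by
    intro j hj hξj t ht
    have hσj := hY.σ_mem_Icc (j := j) (by omega)
    have hσj' := hY.σ_mem_Icc (j := j + 1) (by omega)
    have htT : t ∈ Icc 0 S.T := ⟨hσj.1.trans ht.1, ht.2.trans hσj'.2⟩
    have h1 : ξ t - ξ (σ j) = Y j t - Y j (σ j) := by
      rw [hξsub, hY.sub_eq j hj _ _ (abs_le_two_mul_of_mem_Icc hT hσj) (abs_le_two_mul_of_mem_Icc hT htT)]
      refine intervalIntegral.integral_congr_Ioo_of_le ht.1 fun u hu => ?_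
      simp only [v]
      rw [hmod u ⟨hσj.1.trans hu.1.le, hu.2.trans_le htT.2⟩,
        hv₀ j hj u ⟨hu.1.le, hu.2.trans_le ht.2⟩]
    rwa [hξj, sub_left_inj] at h1
  have hinit : ∀ j, j ≤ S.N → ξ (σ j) = Y j (σ j) := by
    intro j
    induction j with
    | zero => exact fun _ => by rw [hY.σ_zero, hY.init, hξ0]
    | succ j ih =>
      intro hj
      rw [hY.matching j hj]
      exact hstep j (by omega) (ih (by omega)) _ ⟨(hY.σ_lt j (by omega)).le, le_rfl⟩
  have hξY : ∀ j ≤ S.N, ∀ t ∈ Icc (σ j) (σ (j + 1)), ξ t = Y j t := fun j hj =>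
    hstep j hj (hinit j hj)
  have hξT : ξ S.T = ξ 0 := by
    have h1 := hY.σ_lt S.N le_rfl
    rw [hY.σ_last] at h1
    rw [hξY S.N le_rfl S.T ⟨h1.le, hY.σ_last.ge⟩, hper, hξ0]
  have hξper : Function.Periodic ξ S.T := by
    intro t
    have h1 := hvper.intervalIntegral_add_eq t 0
    rw [← hξsub, ← hξsub, zero_add, hξT, sub_self] at h1
    exact sub_eq_zero.1 h1
  have hξmod : ∀ t, ξ (toIcoMod hT 0 t) = ξ t := fun t => by
    rw [← self_sub_toIcoDiv_zsmul hT 0 t]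
    exact hξper.sub_zsmul_eq _
  have hpiece : ∀ s ∈ Ico 0 S.T, ∃ j ≤ S.N, s ∈ Ico (σ j) (σ (j + 1)) := by
    intro s hs
    obtain ⟨j, hj, hjs⟩ := exists_mem_Ico_succ (σ := σ) (s := s) (m := S.N + 1) (by
      rw [hY.σ_zero]; exact hs.1) (by rw [hY.σ_last]; exact hs.2)
    exact ⟨j, Nat.lt_succ_iff.1 hj, hjs⟩
  have hball : ∀ s ∈ Ico 0 S.T, ξ s ∈ Metric.ball a r := by
    intro s hs
    obtain ⟨j, hj, hjs⟩ := hpiece s hs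
    rw [hξY j hj s ⟨hjs.1, hjs.2.le⟩]
    exact hY.mem_ball j hj s (abs_le_two_mul_of_mem_Icc hT ⟨hs.1, hs.2.le⟩)
  have hmem : ∀ t, toIcoMod hT 0 t ∈ Ico 0 S.T := toIcoMod_mem_Ico' hT
  refine ⟨ξ, ⟨⟨fun t => ?_, v, ?_, fun t => ?_, Eventually.of_forall fun t => ?_⟩, hξper⟩, hξ0,
    fun t ht => ?_⟩
  · rw [← hξmod]
    exact hG.closedBall_subset (Metric.ball_subset_closedBall (hball _ (hmem t)))
  · intro t
    refine ⟨Icc (t - 1) (t + 1), Icc_mem_nhds (by linarith) (by linarith), ?_⟩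
    rw [← intervalIntegrable_iff_integrableOn_Icc_of_le (by linarith)]
    exact hvi _ _
  · rw [hξ0]
  · set s := toIcoMod hT 0 t with hs
    have hsT : s ∈ Icc 0 S.T := ⟨(hmem t).1, (hmem t).2.le⟩
    obtain ⟨j, hj, hjs⟩ := hpiece s (hmem t)
    have hσj := hY.σ_mem_Icc (j := j) (by omega)
    have hσj' := hY.σ_mem_Icc (j := j + 1) (by omega)
    have hxY : ξ t = Y j s := by rw [← hξmod, hξY j hj s ⟨hjs.1, hjs.2.le⟩]
    have hts : t - (toIcoDiv hT 0 t : ℝ) * S.T = s := by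
      rw [hs, ← self_sub_toIcoDiv_zsmul hT 0 t, zsmul_eq_mul]
    refine subset_convexHull ℝ _ ⟨j, hj, toIcoDiv hT 0 t, ?_, ?_, ?_⟩
    · rw [hts, hxY]
      have h1 := (hY.strictMonoOn_sub_θ hG hT hslow hj (i := j) (by omega)).monotoneOn hσj hsT
        hjs.1
      rw [← hY.σ_eq_left hG hS hj, sub_self] at h1
      exact sub_nonneg.1 h1
    · rw [hts, hxY]
      have h1 := (hY.strictMonoOn_sub_θ hG hT hslow hj (i := j + 1) (by omega)).monotoneOn hsT
        hσj' hjs.2.le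
      rw [← hY.σ_eq_right hG hS hj, sub_self] at h1
      exact sub_nonpos.1 h1
    · have hYr := hY.mem_closedBall hT hj hsT
      have h1 : v t = g j s := hv₀ j hj s hjs
      rw [h1, hxY, ← hS.field_sub_zsmul hj (hG.closedBall_subset hYr)
        (hε.trans_le hG.ε₁_le) t (toIcoDiv hT 0 t), self_sub_toIcoDiv_zsmul, ← hs,
        hG.field_eq hε hj (abs_le_two_mul_of_mem_Icc hT hsT) hYr]
  · rcases ht.2.lt_or_eq with h | h
    · exact hball t ⟨ht.1, h⟩
    · rw [h, hξT]
      exact hball 0 ⟨le_rfl, hT⟩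

/-- A periodic solution that starts near `a` returns to its initial value along the last piece. -/
theorem IsOrbit.apply_T_eq (hG : S.IsLocalization n a r ε₁ L C G) (hS : S.IsAdmissible)
    (hε : |ε| < ε₁) (hslow : |ε| * C * L < 1) {y : ℝ → EuclideanSpace ℝ (Fin d)}
    (hy : S.IsPeriodicSolution ε y) (hyr : ∀ t ∈ Icc 0 S.T, y t ∈ Metric.ball a r)
    {Y : ℕ → ℝ → EuclideanSpace ℝ (Fin d)} {σ : ℕ → ℝ} (hY : S.IsOrbit a r G ε (y 0) Y σ) :
    Y S.N S.T = y 0 := by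
  have h1 := hY.σ_lt S.N le_rfl
  rw [hY.σ_last] at h1
  rw [← hY.eq_of_isSolution hG hS hε hslow hy.1 hyr le_rfl ⟨h1.le, hY.σ_last.ge⟩]
  exact hy.2.eq

/-- Two periodic solutions near `a` with the same initial value coincide. -/
theorem IsOrbit.eq_of_isPeriodicSolution (hG : S.IsLocalization n a r ε₁ L C G)
    (hS : S.IsAdmissible) (hε : |ε| < ε₁) (hslow : |ε| * C * L < 1)
    {y w : ℝ → EuclideanSpace ℝ (Fin d)}
    (hy : S.IsPeriodicSolution ε y) (hyr : ∀ t ∈ Icc 0 S.T, y t ∈ Metric.ball a r)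
    (hw : S.IsPeriodicSolution ε w) (hwr : ∀ t ∈ Icc 0 S.T, w t ∈ Metric.ball a r)
    {Y : ℕ → ℝ → EuclideanSpace ℝ (Fin d)} {σ : ℕ → ℝ} (hY : S.IsOrbit a r G ε (y 0) Y σ)
    (h0 : y 0 = w 0) : y = w := by
  have hT := hS.T_pos
  have hmod : ∀ {f : ℝ → EuclideanSpace ℝ (Fin d)}, Function.Periodic f S.T → ∀ t,
      f (toIcoMod hT 0 t) = f t := fun hf t => by
    rw [← self_sub_toIcoDiv_zsmul hT 0 t]
    exact hf.sub_zsmul_eq _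
  funext t
  rw [← hmod hy.2, ← hmod hw.2]
  have hs := toIcoMod_mem_Ico' hT t
  obtain ⟨j, hj, hjs⟩ := exists_mem_Ico_succ (σ := σ) (s := toIcoMod hT 0 t) (m := S.N + 1) (by
    rw [hY.σ_zero]; exact hs.1) (by rw [hY.σ_last]; exact hs.2)
  have hj' := Nat.lt_succ_iff.1 hj
  rw [hY.eq_of_isSolution hG hS hε hslow hy.1 hyr hj' ⟨hjs.1, hjs.2.le⟩]
  rw [h0] at hY
  rw [hY.eq_of_isSolution hG hS hε hslow hw.1 hwr hj' ⟨hjs.1, hjs.2.le⟩]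

end SwitchedSystem

/-! ### Branches of periodic solutions -/

theorem theoremB {d : ℕ} (S : SwitchedSystem d) (hS : S.IsAdmissible)
    (ℓ : ℕ) (hℓ : 1 ≤ ℓ) (hℓk : ℓ ≤ S.k)
    (hvanish : ∀ i, 1 ≤ i → i < ℓ → ∀ x ∈ S.D, S.melnikov i x = 0)
    (a : EuclideanSpace ℝ (Fin d)) (ha : a ∈ S.D)
    (hθ : ℓ = S.k → ∀ j, 1 ≤ j → j ≤ S.N → ContDiffAt ℝ S.k (S.θ j) a)
    (hzero : S.melnikov ℓ a = 0)
    (hsimple : (fderiv ℝ (S.melnikov ℓ) a).det ≠ 0) :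
    ∃ ξ : ℝ → ℝ → EuclideanSpace ℝ (Fin d),
      Tendsto (fun ε => ξ ε 0) (𝓝[≠] 0) (𝓝 a) ∧
      (∀ᶠ ε in 𝓝[≠] (0 : ℝ), S.IsPeriodicSolution ε (ξ ε)) ∧
      ∃ U ∈ 𝓝 a, ∀ᶠ ε in 𝓝[≠] (0 : ℝ), ∀ y : ℝ → EuclideanSpace ℝ (Fin d),
        S.IsPeriodicSolution ε y → y 0 ∈ U → y = ξ ε := by
  have hT := hS.T_pos
  have hℓ0 : ℓ ≠ 0 := by omega
  have hθℓ : ∀ j < S.N, ContDiffAt ℝ ℓ (S.θ (j + 1)) a := by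
    intro j hj
    rcases hℓk.eq_or_lt with h | h
    · rw [h]
      exact hθ h (j + 1) (by omega) hj
    · exact ((hS.θ_contDiff (j + 1) (by omega) hj).contDiffAt (hS.isOpen_D.mem_nhds ha)).of_le
        (by norm_cast; omega)
  obtain ⟨r, ε₁, L, C, G, hG⟩ := hS.exists_isLocalization hℓ0 hℓk ha hθℓ
  obtain ⟨ψ, τ, hψ, hτ, hY⟩ := hG.exists_isOrbit hS hℓ0 hθℓ
  obtain ⟨h, hh, hhM, hψh⟩ := hG.exists_displacement_eq hS hℓ hℓk hθℓ hvanish hψ hτ hY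
  have hha : h (a, 0) = 0 := by rw [hhM.self_of_nhds, hzero]
  -- the branch `g` of zeros of `h`
  have hder : HasFDerivAt (fun x => h (x, 0)) (fderiv ℝ (S.melnikov ℓ) a) a := by
    have h1 : ContDiff ℝ 1 fun x => h (x, 0) := hh.comp (contDiff_id.prodMk contDiff_const)
    have h2 := (h1.differentiable one_ne_zero a).hasFDerivAt
    rwa [EventuallyEq.fderiv_eq (f₁ := fun x => h (x, 0)) (f := S.melnikov ℓ) hhM] at h2
  obtain ⟨g, hg, hg0, hgh⟩ := ContDiffAt.exists_contDiff_implicit one_ne_zero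
    (f := fun q : ℝ × EuclideanSpace ℝ (Fin d) => h (q.2, q.1)) (p₀ := 0) (x₀ := a)
    (D := (fderiv ℝ (S.melnikov ℓ) a).toContinuousLinearEquivOfDetNeZero hsimple)
    (ContDiff.contDiffAt (by
      have := hh.comp (contDiff_snd.prodMk contDiff_fst :
        ContDiff ℝ 1 fun q : ℝ × EuclideanSpace ℝ (Fin d) => (q.2, q.1))
      exact_mod_cast this))
    (by simpa using hder)
  have hswap : Tendsto (fun p : EuclideanSpace ℝ (Fin d) × ℝ => (p.2, p.1)) (𝓝 (a, 0))
      (𝓝 (0, a)) := (continuous_snd.prodMk continuous_fst).tendsto _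
  have hall := hY.and (hψh.and (hswap.eventually hgh))
  rw [nhds_prod_eq, eventually_prod_iff] at hall
  obtain ⟨pa, hpa, pb, hpb, hp⟩ := hall
  have hsmall : ∀ᶠ ε : ℝ in 𝓝[≠] 0, ε ≠ 0 ∧ pb ε ∧ pa (g ε) ∧ |ε| < ε₁ ∧ |ε| * C * L < 1 ∧
      |ε| * C * S.T < r / 2 := by
    have habs : Tendsto (fun ε : ℝ => |ε|) (𝓝 0) (𝓝 0) := by
      simpa using continuous_abs.tendsto (0 : ℝ)
    have hgc := hg.continuous.tendsto 0
    rw [hg0] at hgc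
    have h1 : ∀ c : ℝ, Tendsto (fun ε : ℝ => |ε| * C * c) (𝓝 0) (𝓝 0) := fun c => by
      simpa using (habs.mul_const C).mul_const c
    have h2 := habs.eventually_lt_const hG.ε₁_pos
    have h3 := (h1 L).eventually_lt_const one_pos
    have h4 := (h1 S.T).eventually_lt_const (half_pos hG.r_pos)
    filter_upwards [self_mem_nhdsWithin, nhdsWithin_le_nhds
      (hpb.and ((hgc.eventually hpa).and (h2.and (h3.and h4))))] with ε h0 h5 using ⟨h0, h5⟩
  have hexists : ∀ ε : ℝ, ∃ ξ, ε ≠ 0 ∧ pb ε ∧ pa (g ε) ∧ |ε| < ε₁ ∧ |ε| * C * L < 1 ∧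
      |ε| * C * S.T < r / 2 →
      S.IsPeriodicSolution ε ξ ∧ ξ 0 = g ε ∧ ∀ t ∈ Icc 0 S.T, ξ t ∈ Metric.ball a r := by
    intro ε
    by_cases hε : ε ≠ 0 ∧ pb ε ∧ pa (g ε) ∧ |ε| < ε₁ ∧ |ε| * C * L < 1 ∧
      |ε| * C * S.T < r / 2
    · obtain ⟨-, hε1, hε2, hε3, hε4, -⟩ := hε
      obtain ⟨h1, h2, h3⟩ := hp hε2 hε1
      have h4 : h (g ε, ε) = 0 := (h3.2 rfl).trans hha
      obtain ⟨ξ, hξ⟩ := h1.exists_isPeriodicSolution hG hS hε3 hε4 (by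
        simp only
        rw [h2, h4, smul_zero, smul_zero, add_zero])
      exact ⟨ξ, fun _ => hξ⟩
    · exact ⟨0, fun h => absurd h hε⟩
  choose ξ hξ using hexists
  refine ⟨ξ, ?_, hsmall.mono fun ε hε => (hξ ε hε).1, {x | pa x} ∩ Metric.ball a (r / 2),
    inter_mem hpa (Metric.ball_mem_nhds a (half_pos hG.r_pos)), ?_⟩
  · have hgc := hg.continuous.tendsto 0
    rw [hg0] at hgc
    refine (hgc.mono_left nhdsWithin_le_nhds).congr' ?_
    filter_upwards [hsmall] with ε hε using (hξ ε hε).2.1.symm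
  · filter_upwards [hsmall] with ε hε y hy hyU
    obtain ⟨hξper, hξ0, hξr⟩ := hξ ε hε
    obtain ⟨hε0, hε1, -, hε3, hε4, hε5⟩ := hε
    obtain ⟨h1, h2, h3⟩ := hp hyU.1 hε1
    have hyr : ∀ t ∈ Icc 0 S.T, y t ∈ Metric.ball a r := fun t ht =>
      hy.1.mem_ball hG hT hε3 hε5 hyU.2 ht
    -- the initial value of `y` is a zero of `h`
    have h4 := SwitchedSystem.IsOrbit.apply_T_eq hG hS hε3 hε4 hy hyr h1
    rw [add_eq_left, smul_eq_zero_iff_right hε0, h2,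
      smul_eq_zero_iff_right (pow_ne_zero _ hε0)] at h4
    exact SwitchedSystem.IsOrbit.eq_of_isPeriodicSolution hG hS hε3 hε4 hy hyr hξper hξr h1
      ((h3.1 (h4.trans hha.symm)).symm.trans hξ0.symm)
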